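/- Let $p>1$ be real and $p'=p/(p-1)$. For an oriented Riemannian manifold $M$ (smooth, without boundary, second countable) let $\Omega^{k,p}(M)$ be the space of $L^p$ differential $k$-forms on $M$ whose exterior differential, in the sense of distributions, is also $L^p$ (forms equal almost everywhere are identified). Put $H^{k,p}(M)=\ker d/\operatorname{im} d$ for the complex $(\Omega^{*,p}(M),d)$, and let the torsion $T^{k,p}(M)=\overline{\operatorname{im} d}/\operatorname{im} d\subset H^{k,p}(M)$ be the set of classes of forms lying in the $L^p$-closure of $\operatorname{im} d$. For $M$ complete of dimension $n$, a class in $H^{k,p}(M)$ is called *robust* if it contains a closed form $\omega$ for which there is a sequence $\omega'_j\in\Omega^{n-k,p'}(M)$ such that 1. the integrals $\int_M\omega\wedge\omega'_j$ stay away from $0$: there is $\delta>0$ with $\left|\int_M\omega\wedge\omega'_j\right|\ge\delta$ for all large $j$; 2. $\|\omega'_j\|_{L^{p'}}$ tends to $+\infty$ with at most polynomial growth in $j$: $\|\omega'_j\|_{L^{p'}}\to+\infty$ and $\|\omega'_j\|_{L^{p'}}=O(j^N)$ for some $N$; 3. $\|d\omega'_j\|_{L^{p'}}$ tends to $0$ exponentially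 in $j$: $\|d\omega'_j\|_{L^{p'}}=O(e^{-aj})$ for some $a>0$. A *robust torsion class* is a robust class that belongs to $T^{k,p}(M)$. **Proposition.** Let $M_1$ and $M_2$ be complete oriented Riemannian manifolds, with projections $\pi_i:M_1\times M_2\to M_i$, let $M_1\times M_2$ carry the product metric and the product orientation, and let $c_i\in H^{k_i,p}(M_i)$ be robust torsion classes, $i=1,2$. Then the forms $\pi_1^*\omega_1\wedge\pi_2^*\omega_2$, for $\omega_1\in c_1$ and $\omega_2\in c_2$, all lie in one class $c_1\times c_2\in H^{k_1+k_2,p}(M_1\times M_2)$. This class is robust, and in particular it is nonzero. If moreover $k_1=\dim M_1$ or $k_2=\dim M_2$, then $c_1\times c_2$ is a robust torsion class. -/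

import Mathlib

open Set Filter Topology MeasureTheory Bundle
open scoped Manifold ContDiff ENNReal

noncomputable section

namespace LpForms

/-! ### Linear algebra of alternating forms on one vector space -/

section Algebra

variable {V : Type*} [AddCommGroup V] [Module ℝ V]

/-- The wedge product of two alternating forms (sum over shuffles, without numerical factor). -/
def wedge {k l : ℕ} (α : V [⋀^Fin k]→ₗ[ℝ] ℝ) (β : V [⋀^Fin l]→ₗ[ℝ] ℝ) :
    V [⋀^Fin (k + l)]→ₗ[ℝ] ℝ :=
  ((LinearMap.mul' ℝ ℝ).compAlternatingMap (α.domCoprod β)).domDomCongr finSumFinEquiv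

/-- Transport of an alternating form along an equality of degrees. -/
def castDeg {k l : ℕ} (h : k = l) (α : V [⋀^Fin k]→ₗ[ℝ] ℝ) : V [⋀^Fin l]→ₗ[ℝ] ℝ :=
  α.domDomCongr (finCongr h)

/-- The bases of `V` that are orthonormal for the scalar product `g`. -/
def OrthonormalFrame (g : V → V → ℝ) : Type _ :=
  {b : Fin (Module.finrank ℝ V) → V // ∀ i j, g (b i) (b j) = if i = j then 1 else 0}

/-- The Euclidean norm of a `k`-form for the scalar product `g`: if `b` is an orthonormal basis,
`|α|² = ∑_{i₁ < ⋯ < iₖ} α(b_{i₁}, …, b_{iₖ})² = (1 / k!) ∑_{i₁, …, iₖ} α(b_{i₁}, …, b_{iₖ})²`.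
The value is the same for all orthonormal bases, so that the supremum is over a constant family. -/
def formNorm (g : V → V → ℝ) {k : ℕ} (α : V [⋀^Fin k]→ₗ[ℝ] ℝ) : ℝ :=
  ⨆ b : OrthonormalFrame g,
    Real.sqrt ((∑ s : Fin k → Fin (Module.finrank ℝ V), α (fun i => b.1 (s i)) ^ 2) /
      (k.factorial : ℝ))

end Algebra

/-! ### Forms, metrics, volume and exterior derivative on a manifold -/

section Manifold

variable {E : Type*} [NormedAddCommGroup E] [NormedSpace ℝ E]
  {H : Type*} [TopologicalSpace H] (I : ModelWithCorners ℝ E H)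
  (M : Type*) [TopologicalSpace M] [ChartedSpace H M]

/-- Differential `k`-forms on `M`, without any regularity. -/
abbrev DiffForm (k : ℕ) : Type _ := ∀ x : M, (TangentSpace I x) [⋀^Fin k]→ₗ[ℝ] ℝ

/-- Fields of scalar products on the tangent spaces of `M` (as functions of two vectors). -/
abbrev MetricField : Type _ := ∀ x : M, TangentSpace I x → TangentSpace I x → ℝ

variable {I M}

/-- The expression of a form in the chart around `x₀`, i.e. its pull-back by the inverse of
the chart. It is meaningful on the target of the chart. -/
def inChart (x₀ : M) {k : ℕ} (θ : DiffForm I M k) (y : E) : E [⋀^Fin k]→ₗ[ℝ] ℝ :=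
  (θ ((extChartAt I x₀).symm y)).compLinearMap
    (mfderiv 𝓘(ℝ, E) I (extChartAt I x₀).symm y).toLinearMap

/-- A continuous form of maximal degree that has norm one at each point. On an orientable
Riemannian manifold, this is the same as the choice of an orientation. -/
def IsVolumeForm (g : MetricField I M) (vol : DiffForm I M (Module.finrank ℝ E)) : Prop :=
  (∀ x, formNorm (V := TangentSpace I x) (g x) (vol x) = 1) ∧
    ∀ (x₀ : M) (v : Fin (Module.finrank ℝ E) → E),
      ContinuousOn (fun y => inChart x₀ vol y v) (extChartAt I x₀).target

variable [FiniteDimensional ℝ E] [MeasurableSpace E] [BorelSpace E]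

/-- The Riemannian density `√det(gᵢⱼ)` in the chart around `x₀`, with respect to the fixed
basis of `E`. -/
def chartDensity (g : MetricField I M) (x₀ : M) (y : E) : ℝ :=
  Real.sqrt (Matrix.det (Matrix.of fun i j : Fin (Module.finrank ℝ E) =>
    g ((extChartAt I x₀).symm y)
      (mfderiv 𝓘(ℝ, E) I (extChartAt I x₀).symm y (Module.finBasis ℝ E i))
      (mfderiv 𝓘(ℝ, E) I (extChartAt I x₀).symm y (Module.finBasis ℝ E j))))

/-- Lebesgue measure on the target of the chart around `x₀`, normalised by the fixed basis
of `E`. -/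
def chartLebesgue (I : ModelWithCorners ℝ E H) (x₀ : M) : Measure E :=
  (Module.finBasis ℝ E).addHaar.restrict (extChartAt I x₀).target

variable [MeasurableSpace M]

/-- The Riemannian volume measure. The measures `√det(gᵢⱼ) dy` on the domains of the charts,
extended by zero, agree on overlaps, and their supremum is the measure which extends them all. -/
def riemVolume (g : MetricField I M) : Measure M :=
  ⨆ x₀ : M, ((chartLebesgue I x₀).withDensity
    (fun y => ENNReal.ofReal (chartDensity g x₀ y))).map (extChartAt I x₀).symm

/-- The `L^p` norm of a form, in `[0, ∞]`. -/
def eLpNormForm (g : MetricField I M) (p : ℝ) {k : ℕ} (θ : DiffForm I M k) : ℝ≥0∞ :=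
  eLpNorm (fun x => formNorm (V := TangentSpace I x) (g x) (θ x)) (ENNReal.ofReal p)
    (riemVolume g)

/-- The `L^p` norm of a form, as a real number (used for `L^p` forms only). -/
def lpNormForm (g : MetricField I M) (p : ℝ) {k : ℕ} (θ : DiffForm I M k) : ℝ :=
  (eLpNormForm g p θ).toReal

/-- `θ` is an `L^p` form: its coefficients in charts are measurable and its `L^p` norm is
finite. -/
def IsLpForm (g : MetricField I M) (p : ℝ) {k : ℕ} (θ : DiffForm I M k) : Prop :=
  (∀ (x₀ : M) (v : Fin k → E),
    AEStronglyMeasurable (fun y => inChart x₀ θ y v) (chartLebesgue I x₀)) ∧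
  eLpNormForm g p θ < ⊤

/-- `dθ = η` in the sense of distributions: in each chart and for constant vectors `v₀, …, vₖ`,
`η(v₀, …, vₖ) = ∑ᵢ (-1)^i ∂_{vᵢ} (θ(v₀, …, v̂ᵢ, …, vₖ))` holds against all smooth test functions
with compact support in the target of the chart. -/
def IsWeakExtDeriv {k : ℕ} (θ : DiffForm I M k) (η : DiffForm I M (k + 1)) : Prop :=
  ∀ (x₀ : M) (φ : E → ℝ), ContDiff ℝ ∞ φ → HasCompactSupport φ →
    tsupport φ ⊆ (extChartAt I x₀).target → ∀ v : Fin (k + 1) → E,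
      ∫ y, φ y * inChart x₀ η y v ∂(chartLebesgue I x₀) =
        -∫ y, ∑ i : Fin (k + 1), (-1 : ℝ) ^ (i : ℕ) *
          (fderiv ℝ φ y (v i) * inChart x₀ θ y (fun j => v (i.succAbove j)))
          ∂(chartLebesgue I x₀)

/-- The integral of the form `τ` of maximal degree over `M`, oriented by the Riemannian volume
form `vol`: if `τ = f vol`, this is the integral of `f` for the Riemannian measure. -/
def integralForm (g : MetricField I M) (vol τ : DiffForm I M (Module.finrank ℝ E)) : ℝ :=
  ∫ x, τ x (Module.finBasis ℝ E) / vol x (Module.finBasis ℝ E) ∂(riemVolume g)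

/-! ### `L^p` cohomology -/

/-- The closed forms in `Ω^{k,p}(M)`. -/
def IsClosedLp (g : MetricField I M) (p : ℝ) {k : ℕ} (θ : DiffForm I M k) : Prop :=
  IsLpForm g p θ ∧ IsWeakExtDeriv θ 0

/-- The forms in the image of `d : Ω^{k-1,p}(M) → Ω^{k,p}(M)`. Forms are identified when they are
equal almost everywhere, and there are no forms of degree `-1`. -/
def IsExactLp (g : MetricField I M) (p : ℝ) : ∀ {k : ℕ}, DiffForm I M k → Prop
  | 0, θ => IsLpForm g p θ ∧ ∀ᵐ x ∂(riemVolume g), θ x = 0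
  | _ + 1, θ => IsLpForm g p θ ∧ ∃ φ, IsLpForm g p φ ∧ IsWeakExtDeriv φ θ

/-- The cohomology class of a form: all closed `L^p` forms that differ from it by an element of
`d Ω^{k-1,p}(M)`. -/
def lpClass (g : MetricField I M) (p : ℝ) {k : ℕ} (θ : DiffForm I M k) : Set (DiffForm I M k) :=
  {θ' | IsClosedLp g p θ' ∧ IsExactLp g p (θ' - θ)}

/-- The `L^p` cohomology `H^{k,p}(M) = ker d / im d`, as the set of cosets of `im d` in `ker d`. -/
def lpCohomology (g : MetricField I M) (p : ℝ) (k : ℕ) : Set (Set (DiffForm I M k)) :=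
  {c | ∃ θ, IsClosedLp g p θ ∧ c = lpClass g p θ}

/-- The torsion `T^{k,p}(M)`: classes of forms in the `L^p` closure of `im d`. -/
def lpTorsion (g : MetricField I M) (p : ℝ) (k : ℕ) : Set (Set (DiffForm I M k)) :=
  {c | c ∈ lpCohomology g p k ∧ ∀ θ ∈ c, ∀ ε : ℝ≥0∞, 0 < ε →
    ∃ β, IsExactLp g p β ∧ eLpNormForm g p (θ - β) ≤ ε}

/-- The robustness property of a `k`-form `θ` on `M`, oriented by `vol`: there are forms `θ'ⱼ` of
complementary degree in `L^{p'}`, `p' = p / (p - 1)`, with differentials `ηⱼ = dθ'ⱼ` in `L^{p'}`,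
such that `∫ θ ∧ θ'ⱼ` stays away from zero, `‖θ'ⱼ‖` tends to infinity with polynomial growth in `j`
and `‖dθ'ⱼ‖` tends to zero exponentially in `j`. -/
def IsRobustForm (g : MetricField I M) (vol : DiffForm I M (Module.finrank ℝ E)) (p : ℝ) {k : ℕ}
    (θ : DiffForm I M k) : Prop :=
  ∃ (l : ℕ) (h : k + l = Module.finrank ℝ E) (θ' : ℕ → DiffForm I M l)
    (η : ℕ → DiffForm I M (l + 1)),
    (∀ j, IsLpForm g (p / (p - 1)) (θ' j) ∧ IsLpForm g (p / (p - 1)) (η j) ∧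
      IsWeakExtDeriv (θ' j) (η j)) ∧
    (∃ δ : ℝ, 0 < δ ∧ ∀ᶠ j in atTop,
      δ ≤ |integralForm g vol (fun x => castDeg h (wedge (θ x) (θ' j x)))|) ∧
    (Tendsto (fun j => lpNormForm g (p / (p - 1)) (θ' j)) atTop atTop ∧
      ∃ N : ℕ, (fun j => lpNormForm g (p / (p - 1)) (θ' j)) =O[atTop] fun j : ℕ => (j : ℝ) ^ N) ∧
    ∃ a : ℝ, 0 < a ∧
      (fun j => lpNormForm g (p / (p - 1)) (η j)) =O[atTop] fun j : ℕ => Real.exp (-a * j)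

/-- The robust classes in `H^{k,p}(M)`: those which contain a form with the robustness property. -/
def robustClasses (g : MetricField I M) (vol : DiffForm I M (Module.finrank ℝ E)) (p : ℝ)
    (k : ℕ) : Set (Set (DiffForm I M k)) :=
  {c | c ∈ lpCohomology g p k ∧ ∃ θ ∈ c, IsRobustForm g vol p θ}

/-- The robust torsion classes. -/
def robustTorsion (g : MetricField I M) (vol : DiffForm I M (Module.finrank ℝ E)) (p : ℝ)
    (k : ℕ) : Set (Set (DiffForm I M k)) :=
  robustClasses g vol p k ∩ lpTorsion g p k

end Manifold

/-- The metric of a Riemannian manifold, as a field of scalar products. -/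
def metricOf {E : Type*} [NormedAddCommGroup E] [NormedSpace ℝ E]
    {H : Type*} [TopologicalSpace H] (I : ModelWithCorners ℝ E H)
    (M : Type*) [TopologicalSpace M] [ChartedSpace H M]
    [RiemannianBundle (fun x : M => TangentSpace I x)] : MetricField I M :=
  fun _ v w => inner ℝ v w

/-! ### Products -/

section Product

variable {E₁ : Type*} [NormedAddCommGroup E₁] [NormedSpace ℝ E₁]
  {H₁ : Type*} [TopologicalSpace H₁] {I₁ : ModelWithCorners ℝ E₁ H₁}
  {M₁ : Type*} [TopologicalSpace M₁] [ChartedSpace H₁ M₁]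
  {E₂ : Type*} [NormedAddCommGroup E₂] [NormedSpace ℝ E₂]
  {H₂ : Type*} [TopologicalSpace H₂] {I₂ : ModelWithCorners ℝ E₂ H₂}
  {M₂ : Type*} [TopologicalSpace M₂] [ChartedSpace H₂ M₂]

/-- The Riemannian product metric `π₁^* g₁ + π₂^* g₂`. -/
def prodMetric (g₁ : MetricField I₁ M₁) (g₂ : MetricField I₂ M₂) :
    MetricField (I₁.prod I₂) (M₁ × M₂) := fun x v w =>
  g₁ x.1 (mfderiv (I₁.prod I₂) I₁ Prod.fst x v) (mfderiv (I₁.prod I₂) I₁ Prod.fst x w) +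
  g₂ x.2 (mfderiv (I₁.prod I₂) I₂ Prod.snd x v) (mfderiv (I₁.prod I₂) I₂ Prod.snd x w)

/-- The cartesian product `α × β = π₁^* α ∧ π₂^* β` of differential forms. -/
def cross {k l : ℕ} (α : DiffForm I₁ M₁ k) (β : DiffForm I₂ M₂ l) :
    DiffForm (I₁.prod I₂) (M₁ × M₂) (k + l) := fun x =>
  wedge
    ((α x.1).compLinearMap
      (mfderiv (I₁.prod I₂) I₁ Prod.fst x).toLinearMap)
    ((β x.2).compLinearMap
      (mfderiv (I₁.prod I₂) I₂ Prod.snd x).toLinearMap)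

/-- The volume form of the product orientation. -/
def prodVolumeForm [FiniteDimensional ℝ E₁] [FiniteDimensional ℝ E₂]
    (vol₁ : DiffForm I₁ M₁ (Module.finrank ℝ E₁)) (vol₂ : DiffForm I₂ M₂ (Module.finrank ℝ E₂)) :
    DiffForm (I₁.prod I₂) (M₁ × M₂) (Module.finrank ℝ (E₁ × E₂)) := fun x =>
  castDeg (V := TangentSpace (I₁.prod I₂) x) Module.finrank_prod.symm (cross vol₁ vol₂ x)

end Product

end LpForms

end

set_option linter.unusedSectionVars false

noncomputable section

namespace LpForms

/-! ### Algebra of wedge products -/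

section WedgeAlgebra

variable {V W : Type*} [AddCommGroup V] [Module ℝ V] [AddCommGroup W] [Module ℝ W]

/-- Alternatization of real-valued multilinear maps. -/
abbrev alt {k : ℕ} (f : MultilinearMap ℝ (fun _ : Fin k => V) ℝ) : V [⋀^Fin k]→ₗ[ℝ] ℝ :=
  MultilinearMap.alternatization f

lemma exists_alt_eq {k : ℕ} (α : V [⋀^Fin k]→ₗ[ℝ] ℝ) :
    ∃ f : MultilinearMap ℝ (fun _ : Fin k => V) ℝ, alt f = α := by
  refine ⟨(((k.factorial : ℝ)⁻¹ • α : V [⋀^Fin k]→ₗ[ℝ] ℝ) : MultilinearMap ℝ _ ℝ), ?_⟩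
  rw [alt, AlternatingMap.coe_alternatization, Fintype.card_fin, ← Nat.cast_smul_eq_nsmul ℝ,
    smul_smul, mul_inv_cancel₀ (by positivity), one_smul]

/-- The product of two multilinear maps, in consecutive blocks of variables. -/
def tens {k l : ℕ} (f : MultilinearMap ℝ (fun _ : Fin k => V) ℝ)
    (g : MultilinearMap ℝ (fun _ : Fin l => V) ℝ) :
    MultilinearMap ℝ (fun _ : Fin (k + l) => V) ℝ :=
  ((LinearMap.mul' ℝ ℝ).compMultilinearMap (f.domCoprod g)).domDomCongr finSumFinEquiv

lemma tens_apply {k l : ℕ} (f : MultilinearMap ℝ (fun _ : Fin k => V) ℝ)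
    (g : MultilinearMap ℝ (fun _ : Fin l => V) ℝ) (v : Fin (k + l) → V) :
    tens f g v = f (fun i => v (Fin.castAdd l i)) * g (fun j => v (Fin.natAdd k j)) := by
  simp [tens]

/-- The product of a linear form and a multilinear map. -/
def lconsMul {k : ℕ} (ℓ : V →ₗ[ℝ] ℝ) (f : MultilinearMap ℝ (fun _ : Fin k => V) ℝ) :
    MultilinearMap ℝ (fun _ : Fin (k + 1) => V) ℝ :=
  LinearMap.uncurryLeft (ℓ.smulRight f)

lemma lconsMul_apply {k : ℕ} (ℓ : V →ₗ[ℝ] ℝ) (f : MultilinearMap ℝ (fun _ : Fin k => V) ℝ)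
    (v : Fin (k + 1) → V) : lconsMul ℓ f v = ℓ (v 0) * f (fun i => v i.succ) := by
  simp [lconsMul, Fin.tail_def]

lemma alt_domDomCongr {ι ι' : Type*} [Fintype ι] [DecidableEq ι] [Fintype ι'] [DecidableEq ι']
    (e : ι ≃ ι') (f : MultilinearMap ℝ (fun _ : ι => V) ℝ) :
    MultilinearMap.alternatization (f.domDomCongr e) =
      (MultilinearMap.alternatization f).domDomCongr e := by
  ext v
  simp only [MultilinearMap.alternatization_apply, AlternatingMap.domDomCongr_apply,
    MultilinearMap.domDomCongr_apply]
  refine Fintype.sum_equiv (e.permCongr).symm _ _ fun σ => ?_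
  congr 1
  · simp [Equiv.permCongr, Equiv.equivCongr]
  · congr 1
    ext i
    simp

lemma wedge_alt {k l : ℕ} (f : MultilinearMap ℝ (fun _ : Fin k => V) ℝ)
    (g : MultilinearMap ℝ (fun _ : Fin l => V) ℝ) :
    wedge (alt f) (alt g) = alt (tens f g) := by
  rw [alt, alt, alt, tens, alt_domDomCongr, LinearMap.compMultilinearMap_alternatization,
    MultilinearMap.domCoprod_alternization, wedge]

/-- The wedge product as a sum over all permutations. -/
lemma wedge_apply {k l : ℕ} (α : V [⋀^Fin k]→ₗ[ℝ] ℝ) (β : V [⋀^Fin l]→ₗ[ℝ] ℝ)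
    (v : Fin (k + l) → V) :
    wedge α β v = ∑ σ : Equiv.Perm (Fin (k + l)),
      ((Equiv.Perm.sign σ : ℤ) : ℝ) / (k.factorial * l.factorial) *
        (α (fun i => v (σ (Fin.castAdd l i))) * β (fun j => v (σ (Fin.natAdd k j)))) := by
  have hk : (k.factorial : ℝ) ≠ 0 := by positivity
  have hl : (l.factorial : ℝ) ≠ 0 := by positivity
  have h1 : α = alt ((k.factorial : ℝ)⁻¹ • (α : MultilinearMap ℝ (fun _ : Fin k => V) ℝ)) := by
    have : (k.factorial : ℝ)⁻¹ • (α : MultilinearMap ℝ (fun _ : Fin k => V) ℝ) =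
      (((k.factorial : ℝ)⁻¹ • α : V [⋀^Fin k]→ₗ[ℝ] ℝ) : MultilinearMap ℝ _ ℝ) := rfl
    rw [this, alt, AlternatingMap.coe_alternatization, Fintype.card_fin,
      ← Nat.cast_smul_eq_nsmul ℝ, smul_smul, mul_inv_cancel₀ hk, one_smul]
  have h2 : β = alt ((l.factorial : ℝ)⁻¹ • (β : MultilinearMap ℝ (fun _ : Fin l => V) ℝ)) := by
    have : (l.factorial : ℝ)⁻¹ • (β : MultilinearMap ℝ (fun _ : Fin l => V) ℝ) =
      (((l.factorial : ℝ)⁻¹ • β : V [⋀^Fin l]→ₗ[ℝ] ℝ) : MultilinearMap ℝ _ ℝ) := rfl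
    rw [this, alt, AlternatingMap.coe_alternatization, Fintype.card_fin,
      ← Nat.cast_smul_eq_nsmul ℝ, smul_smul, mul_inv_cancel₀ hl, one_smul]
  conv_lhs => rw [h1, h2, wedge_alt, alt, MultilinearMap.alternatization_apply]
  refine Finset.sum_congr rfl fun σ _ => ?_
  rw [MultilinearMap.domDomCongr_apply, tens_apply, Units.smul_def, zsmul_eq_mul]
  simp only [_root_.smul_apply, smul_eq_mul, AlternatingMap.coe_multilinearMap]
  field_simp

lemma alt_eq_of_equiv {m n : ℕ} (h : m = n) (e : Fin m ≃ Fin n) :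
    ∃ ε : ℝ, |ε| = 1 ∧ ∀ {V : Type*} [AddCommGroup V] [Module ℝ V]
      (f : MultilinearMap ℝ (fun _ : Fin m => V) ℝ) (f' : MultilinearMap ℝ (fun _ : Fin n => V) ℝ),
      (∀ v, f' v = f (v ∘ e)) → alt f' = ε • castDeg h (alt f) := by
  subst h
  refine ⟨((Equiv.Perm.sign e : ℤ) : ℝ), ?_, fun f f' hf => ?_⟩
  · rcases Int.units_eq_one_or (Equiv.Perm.sign e) with h | h <;> simp [h]
  · have : f' = f.domDomCongr e := by
      ext v; rw [hf, MultilinearMap.domDomCongr_apply]; rfl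
    rw [this, alt, alt_domDomCongr, AlternatingMap.domDomCongr_perm]
    ext v
    simp [castDeg, Units.smul_def]

lemma castDeg_apply {k l : ℕ} (h : k = l) (α : V [⋀^Fin k]→ₗ[ℝ] ℝ) (v : Fin l → V) :
    castDeg h α v = α (fun i => v (Fin.cast h i)) := rfl

/-- The wedge product of a linear form and an alternating form. -/
def lwedge {k : ℕ} (ℓ : V →ₗ[ℝ] ℝ) (β : V [⋀^Fin k]→ₗ[ℝ] ℝ) : V [⋀^Fin (k + 1)]→ₗ[ℝ] ℝ :=
  AlternatingMap.alternatizeUncurryFin (ℓ.smulRight β)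

lemma lwedge_apply {k : ℕ} (ℓ : V →ₗ[ℝ] ℝ) (β : V [⋀^Fin k]→ₗ[ℝ] ℝ) (v : Fin (k + 1) → V) :
    lwedge ℓ β v =
      ∑ i : Fin (k + 1), (-1 : ℝ) ^ (i : ℕ) * (ℓ (v i) * β (fun j => v (i.succAbove j))) := by
  simp only [lwedge, AlternatingMap.alternatizeUncurryFin_apply]
  refine Finset.sum_congr rfl fun i _ => ?_
  simp only [LinearMap.smulRight_apply, AlternatingMap.smul_apply, smul_eq_mul, zsmul_eq_mul]
  push_cast
  rfl

lemma lwedge_add {k : ℕ} (ℓ ℓ' : V →ₗ[ℝ] ℝ) (β : V [⋀^Fin k]→ₗ[ℝ] ℝ) :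
    lwedge (ℓ + ℓ') β = lwedge ℓ β + lwedge ℓ' β := by
  ext v
  simp [lwedge_apply, add_mul, mul_add, Finset.sum_add_distrib]

lemma lwedge_alt {k : ℕ} (ℓ : V →ₗ[ℝ] ℝ) (f : MultilinearMap ℝ (fun _ : Fin k => V) ℝ) :
    lwedge ℓ (alt f) = alt (lconsMul ℓ f) := by
  ext v
  rw [lwedge_apply, alt, alt, MultilinearMap.alternatization_apply]
  simp only [MultilinearMap.alternatization_apply, Finset.mul_sum]
  rw [← Fintype.sum_prod_type']
  refine Fintype.sum_bijective
    (fun p : Fin (k + 1) × Equiv.Perm (Fin k) =>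
      p.1.cycleRange.symm * Equiv.Perm.decomposeFin.symm (0, p.2)) ?_ _ _ ?_
  · rw [Fintype.bijective_iff_injective_and_card]
    refine ⟨?_, by simp [Fintype.card_perm, Nat.factorial_succ]⟩
    rintro ⟨i, σ⟩ ⟨i', σ'⟩ h
    have h0 : i = i' := by
      have := congrArg (fun τ => τ 0) h
      simpa using this
    subst h0
    have h1 := mul_left_cancel h
    simpa using h1
  · rintro ⟨i, σ⟩
    rw [MultilinearMap.domDomCongr_apply, MultilinearMap.domDomCongr_apply, lconsMul_apply]
    simp only [Equiv.Perm.coe_mul, Function.comp_apply, Equiv.Perm.decomposeFin_symm_apply_zero,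
      Equiv.Perm.decomposeFin_symm_apply_succ, Equiv.swap_self, Equiv.refl_apply,
      Fin.cycleRange_symm_zero, Fin.cycleRange_symm_succ, Equiv.Perm.sign_mul,
      Equiv.Perm.decomposeFin.symm_sign, if_true, one_mul, Equiv.Perm.sign_symm, Units.smul_def,
      Fin.sign_cycleRange, zsmul_eq_mul]
    push_cast
    ring

lemma lwedge_wedge_left {k l : ℕ} (h : k + 1 + l = k + l + 1) (ℓ : V →ₗ[ℝ] ℝ)
    (β : V [⋀^Fin k]→ₗ[ℝ] ℝ) (γ : V [⋀^Fin l]→ₗ[ℝ] ℝ) :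
    castDeg h (wedge (lwedge ℓ β) γ) = lwedge ℓ (wedge β γ) := by
  obtain ⟨f, rfl⟩ := exists_alt_eq β
  obtain ⟨g, rfl⟩ := exists_alt_eq γ
  rw [wedge_alt, lwedge_alt, lwedge_alt, wedge_alt, castDeg, alt, ← alt_domDomCongr, alt]
  congr 1
  ext v
  rw [MultilinearMap.domDomCongr_apply, tens_apply, lconsMul_apply, lconsMul_apply, tens_apply,
    mul_assoc]
  congr 1
  congr 1
  congr 1
  ext j
  congr 1
  ext
  simp
  omega

lemma exists_sign_lwedge_wedge_right (k l : ℕ) :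
    ∃ ε : ℝ, |ε| = 1 ∧ ∀ {V : Type*} [AddCommGroup V] [Module ℝ V] (ℓ : V →ₗ[ℝ] ℝ)
      (β : V [⋀^Fin k]→ₗ[ℝ] ℝ) (γ : V [⋀^Fin l]→ₗ[ℝ] ℝ),
      lwedge ℓ (wedge β γ) = ε • wedge β (lwedge ℓ γ) := by
  obtain ⟨ε, hε, H⟩ := alt_eq_of_equiv (rfl : k + l + 1 = k + l + 1)
    (Fin.cycleRange (Fin.natAdd k (0 : Fin (l + 1))))
  refine ⟨ε, hε, fun ℓ β γ => ?_⟩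
  obtain ⟨f, rfl⟩ := exists_alt_eq β
  obtain ⟨g, rfl⟩ := exists_alt_eq γ
  rw [lwedge_alt, wedge_alt, lwedge_alt, wedge_alt]
  refine H _ _ fun v => ?_
  rw [tens_apply, lconsMul_apply, lconsMul_apply, tens_apply]
  set c : Fin (k + l + 1) := Fin.natAdd k (0 : Fin (l + 1))
  have h0 : Fin.cycleRange c c = 0 := Fin.cycleRange_self _
  have h1 (i : Fin k) : Fin.castAdd (l + 1) i = c.succAbove (Fin.castAdd l i) := by
    rw [Fin.succAbove_of_castSucc_lt]
    · rfl
    · simp [Fin.lt_def, c]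
  have h2 (i : Fin l) : Fin.natAdd k i.succ = c.succAbove (Fin.natAdd k i) := by
    rw [Fin.succAbove_of_le_castSucc]
    · rfl
    · simp [Fin.le_def, c]
  simp only [Function.comp_apply, h0, h1, h2, Fin.cycleRange_succAbove]
  ring

/-- `(α₁ ∧ α₂) ∧ (β₁ ∧ β₂) = ± (α₁ ∧ β₁) ∧ (α₂ ∧ β₂)`. -/
lemma exists_sign_wedge_wedge_wedge_comm (k₁ k₂ l₁ l₂ : ℕ)
    (h : k₁ + k₂ + (l₁ + l₂) = k₁ + l₁ + (k₂ + l₂)) :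
    ∃ ε : ℝ, |ε| = 1 ∧ ∀ {V : Type*} [AddCommGroup V] [Module ℝ V]
      (α₁ : V [⋀^Fin k₁]→ₗ[ℝ] ℝ) (α₂ : V [⋀^Fin k₂]→ₗ[ℝ] ℝ)
      (β₁ : V [⋀^Fin l₁]→ₗ[ℝ] ℝ) (β₂ : V [⋀^Fin l₂]→ₗ[ℝ] ℝ),
      wedge (wedge α₁ β₁) (wedge α₂ β₂) = ε • castDeg h (wedge (wedge α₁ α₂) (wedge β₁ β₂)) := by
  obtain ⟨ε, hε, H⟩ := alt_eq_of_equiv h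
    ((finSumFinEquiv.symm.trans ((finSumFinEquiv.symm.sumCongr finSumFinEquiv.symm).trans
      (Equiv.sumSumSumComm _ _ _ _))).trans ((finSumFinEquiv.sumCongr finSumFinEquiv).trans
        finSumFinEquiv))
  refine ⟨ε, hε, fun α₁ α₂ β₁ β₂ => ?_⟩
  obtain ⟨f₁, rfl⟩ := exists_alt_eq α₁
  obtain ⟨f₂, rfl⟩ := exists_alt_eq α₂
  obtain ⟨g₁, rfl⟩ := exists_alt_eq β₁
  obtain ⟨g₂, rfl⟩ := exists_alt_eq β₂
  rw [wedge_alt, wedge_alt, wedge_alt, wedge_alt, wedge_alt, wedge_alt]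
  refine H _ _ fun v => ?_
  have h₁ (i : Fin k₁) : Equiv.sumSumSumComm (Fin k₁) (Fin k₂) (Fin l₁) (Fin l₂)
    (Sum.inl (Sum.inl i)) = Sum.inl (Sum.inl i) := rfl
  have h₂ (i : Fin k₂) : Equiv.sumSumSumComm (Fin k₁) (Fin k₂) (Fin l₁) (Fin l₂)
    (Sum.inl (Sum.inr i)) = Sum.inr (Sum.inl i) := rfl
  have h₃ (i : Fin l₁) : Equiv.sumSumSumComm (Fin k₁) (Fin k₂) (Fin l₁) (Fin l₂)
    (Sum.inr (Sum.inl i)) = Sum.inl (Sum.inr i) := rfl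
  have h₄ (i : Fin l₂) : Equiv.sumSumSumComm (Fin k₁) (Fin k₂) (Fin l₁) (Fin l₂)
    (Sum.inr (Sum.inr i)) = Sum.inr (Sum.inr i) := rfl
  simp only [tens_apply, Function.comp_def, Equiv.trans_apply, finSumFinEquiv_symm_apply_castAdd,
    finSumFinEquiv_symm_apply_natAdd, Equiv.sumCongr_apply, Sum.map_inl, Sum.map_inr,
    h₁, h₂, h₃, h₄, finSumFinEquiv_apply_left, finSumFinEquiv_apply_right]
  ring

/-! ### Pull-backs and products of vector spaces -/

lemma wedge_compLinearMap {k l : ℕ} (L : W →ₗ[ℝ] V) (α : V [⋀^Fin k]→ₗ[ℝ] ℝ)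
    (β : V [⋀^Fin l]→ₗ[ℝ] ℝ) :
    (wedge α β).compLinearMap L = wedge (α.compLinearMap L) (β.compLinearMap L) := by
  ext v
  simp [wedge_apply]

lemma lwedge_compLinearMap {k : ℕ} (L : W →ₗ[ℝ] V) (ℓ : V →ₗ[ℝ] ℝ) (β : V [⋀^Fin k]→ₗ[ℝ] ℝ) :
    (lwedge ℓ β).compLinearMap L = lwedge (ℓ ∘ₗ L) (β.compLinearMap L) := by
  ext v
  simp [lwedge_apply]

/-- The product `π₁^* α ∧ π₂^* β` of forms on two vector spaces. -/
def vcross {k l : ℕ} (α : V [⋀^Fin k]→ₗ[ℝ] ℝ) (β : W [⋀^Fin l]→ₗ[ℝ] ℝ) :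
    (V × W) [⋀^Fin (k + l)]→ₗ[ℝ] ℝ :=
  wedge (α.compLinearMap (LinearMap.fst ℝ V W)) (β.compLinearMap (LinearMap.snd ℝ V W))

lemma vcross_apply {k l : ℕ} (α : V [⋀^Fin k]→ₗ[ℝ] ℝ) (β : W [⋀^Fin l]→ₗ[ℝ] ℝ)
    (v : Fin (k + l) → V × W) :
    vcross α β v = ∑ σ : Equiv.Perm (Fin (k + l)),
      ((Equiv.Perm.sign σ : ℤ) : ℝ) / (k.factorial * l.factorial) *
        (α (fun i => (v (σ (Fin.castAdd l i))).1) * β (fun j => (v (σ (Fin.natAdd k j))).2)) := by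
  rw [vcross, wedge_apply]
  rfl

/-- The product of forms on a tuple of vectors of the first space followed by a tuple of vectors of
the second one. -/
lemma vcross_append {k l : ℕ} (α : V [⋀^Fin k]→ₗ[ℝ] ℝ) (β : W [⋀^Fin l]→ₗ[ℝ] ℝ)
    (a : Fin k → V) (b : Fin l → W) :
    vcross α β (Fin.append (fun i => (a i, 0)) (fun j => (0, b j))) = α a * β b := by
  set u : Fin k ⊕ Fin l → V × W := Sum.elim (fun i => (a i, 0)) (fun j => (0, b j)) with hu
  have hv : Fin.append (fun i => ((a i, 0) : V × W)) (fun j => (0, b j)) =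
      fun i => u (finSumFinEquiv.symm i) := by
    ext1 i
    refine Fin.addCases (fun i => ?_) (fun i => ?_) i <;> simp [hu]
  rw [hv, vcross, wedge, AlternatingMap.domDomCongr_apply]
  have hu' : (fun i => u (finSumFinEquiv.symm i)) ∘ finSumFinEquiv = u := by
    ext1 i; simp
  simp only [LinearMap.compAlternatingMap_apply, hu', AlternatingMap.domCoprod_apply]
  rw [_root_.sum_apply]
  refine (congrArg (LinearMap.mul' ℝ ℝ) (Fintype.sum_eq_single
    (Quotient.mk'' 1 : Equiv.Perm.ModSumCongr (Fin k) (Fin l)) ?_)).trans ?_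
  · intro σ hσ
    induction σ using Quotient.inductionOn' with
    | h σ =>
    have h1 : ¬∀ i, ∃ j, Sum.inl j = σ (Sum.inl i) := by
      intro h1
      refine hσ (Quotient.sound' ?_)
      rw [QuotientGroup.leftRel_apply, mul_one, inv_mem_iff]
      refine Equiv.Perm.mem_sumCongrHom_range_of_perm_mapsTo_inl ?_
      rintro _ ⟨i, rfl⟩
      exact h1 i
    obtain ⟨i, hi⟩ := not_forall.mp h1
    obtain ⟨j, hj⟩ : ∃ j, σ (Sum.inl i) = Sum.inr j := by
      rcases hx : σ (Sum.inl i) with a | b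
      · exact absurd ⟨a, hx.symm⟩ hi
      · exact ⟨b, rfl⟩
    rw [AlternatingMap.domCoprod.summand_mk'', _root_.smul_apply,
      MultilinearMap.domDomCongr_apply, MultilinearMap.domCoprod_apply]
    have h0 : (α.compLinearMap (LinearMap.fst ℝ V W)) (fun i => u (σ (Sum.inl i))) = 0 := by
      rw [AlternatingMap.compLinearMap_apply]
      exact α.map_coord_zero i (by simp [hj, hu])
    simp [h0]
  · rw [AlternatingMap.domCoprod.summand_mk'']
    simp [hu]

/-- `ℓ ∧ (β × γ) = (ℓ₁ ∧ β) × γ ± β × (ℓ₂ ∧ γ)` if `ℓ = (ℓ₁, ℓ₂)`. -/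
lemma exists_sign_lwedge_vcross (k l : ℕ) (h : k + 1 + l = k + l + 1) :
    ∃ ε : ℝ, |ε| = 1 ∧ ∀ {V W : Type*} [AddCommGroup V] [Module ℝ V] [AddCommGroup W] [Module ℝ W]
      (ℓ : V × W →ₗ[ℝ] ℝ) (β : V [⋀^Fin k]→ₗ[ℝ] ℝ) (γ : W [⋀^Fin l]→ₗ[ℝ] ℝ),
      lwedge ℓ (vcross β γ) =
        castDeg h (vcross (lwedge (ℓ ∘ₗ LinearMap.inl ℝ V W) β) γ) +
          ε • vcross β (lwedge (ℓ ∘ₗ LinearMap.inr ℝ V W) γ) := by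
  obtain ⟨ε, hε, H⟩ := exists_sign_lwedge_wedge_right k l
  refine ⟨ε, hε, fun {V W} _ _ _ _ ℓ β γ => ?_⟩
  have hℓ : ℓ = (ℓ ∘ₗ LinearMap.inl ℝ V W) ∘ₗ LinearMap.fst ℝ V W +
      (ℓ ∘ₗ LinearMap.inr ℝ V W) ∘ₗ LinearMap.snd ℝ V W := by
    ext v <;> simp [← Prod.zero_eq_mk]
  conv_lhs => rw [hℓ, lwedge_add, vcross]
  rw [← lwedge_wedge_left h, H, vcross, vcross, lwedge_compLinearMap, lwedge_compLinearMap]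

lemma exists_sign_wedge_vcross (k₁ k₂ l₁ l₂ : ℕ)
    (h : k₁ + k₂ + (l₁ + l₂) = k₁ + l₁ + (k₂ + l₂)) :
    ∃ ε : ℝ, |ε| = 1 ∧ ∀ {V W : Type*} [AddCommGroup V] [Module ℝ V] [AddCommGroup W] [Module ℝ W]
      (α₁ : V [⋀^Fin k₁]→ₗ[ℝ] ℝ) (α₂ : W [⋀^Fin k₂]→ₗ[ℝ] ℝ)
      (β₁ : V [⋀^Fin l₁]→ₗ[ℝ] ℝ) (β₂ : W [⋀^Fin l₂]→ₗ[ℝ] ℝ),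
      vcross (wedge α₁ β₁) (wedge α₂ β₂) =
        ε • castDeg h (wedge (vcross α₁ α₂) (vcross β₁ β₂)) := by
  obtain ⟨ε, hε, H⟩ := exists_sign_wedge_wedge_wedge_comm k₁ k₂ l₁ l₂ h
  refine ⟨ε, hε, fun α₁ α₂ β₁ β₂ => ?_⟩
  rw [vcross, wedge_compLinearMap, wedge_compLinearMap, H]
  rfl

end WedgeAlgebra


/-! ### Scalar products and norms of forms -/

section ScalarProduct

open scoped Matrix

variable {V W : Type*} [AddCommGroup V] [Module ℝ V] [AddCommGroup W] [Module ℝ W]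

lemma formNorm_castDeg {g : V → V → ℝ} {k l : ℕ} (h : k = l) (α : V [⋀^Fin k]→ₗ[ℝ] ℝ) :
    formNorm g (castDeg h α) = formNorm g α := by
  subst h; rfl

lemma sqrt_sum_add_sq_le {ι : Type*} [Fintype ι] (f f' : ι → ℝ) :
    √(∑ i, (f i + f' i) ^ 2) ≤ √(∑ i, f i ^ 2) + √(∑ i, f' i ^ 2) := by
  have h := norm_add_le (WithLp.toLp 2 f : EuclideanSpace ℝ ι) (WithLp.toLp 2 f')
  simpa [EuclideanSpace.norm_eq] using h

/-- `g` is a scalar product on `V`. -/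
structure IsScalarProduct (g : V → V → ℝ) : Prop where
  symm : ∀ v w, g v w = g w v
  add_left : ∀ u v w, g (u + v) w = g u w + g v w
  smul_left : ∀ (c : ℝ) v w, g (c • v) w = c * g v w
  pos : ∀ v, v ≠ 0 → 0 < g v v

/-- The Gram matrix of a family of vectors. -/
def gram {ι : Type*} (g : V → V → ℝ) (e : ι → V) : Matrix ι ι ℝ := Matrix.of fun i j => g (e i) (e j)

namespace IsScalarProduct

variable {g : V → V → ℝ} (hg : IsScalarProduct g)
include hg

lemma smul_right (c : ℝ) (v w : V) : g v (c • w) = c * g v w := by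
  rw [hg.symm, hg.smul_left, hg.symm w]

lemma zero_left (w : V) : g 0 w = 0 := by simpa using hg.smul_left 0 0 w

lemma nonneg (v : V) : 0 ≤ g v v := by
  rcases eq_or_ne v 0 with rfl | h
  · exact (hg.zero_left 0).ge
  · exact (hg.pos v h).le

lemma sum_left {ι : Type*} (s : Finset ι) (f : ι → V) (w : V) :
    g (∑ i ∈ s, f i) w = ∑ i ∈ s, g (f i) w := by
  classical
  induction s using Finset.induction_on with
  | empty => simp [hg.zero_left]
  | insert a s ha ih => rw [Finset.sum_insert ha, Finset.sum_insert ha, hg.add_left, ih]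

lemma sum_right {ι : Type*} (s : Finset ι) (f : ι → V) (w : V) :
    g w (∑ i ∈ s, f i) = ∑ i ∈ s, g w (f i) := by
  rw [hg.symm, hg.sum_left]
  simp_rw [hg.symm w]

lemma comp_injective {L : W →ₗ[ℝ] V} (hL : Function.Injective L) :
    IsScalarProduct fun v w => g (L v) (L w) where
  symm _ _ := hg.symm _ _
  add_left _ _ _ := by simp [hg.add_left]
  smul_left _ _ _ := by simp [hg.smul_left]
  pos v hv := hg.pos _ (by simpa using hL.ne hv)

lemma linearIndependent {ι : Type*} [DecidableEq ι] {b : ι → V}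
    (hb : ∀ i j, g (b i) (b j) = if i = j then 1 else 0) : LinearIndependent ℝ b := by
  rw [linearIndependent_iff']
  intro s c hc i hi
  have := hg.sum_left s (fun i => c i • b i) (b i)
  rw [hc, hg.zero_left] at this
  simpa [hg.smul_left, hb, hi] using this.symm

lemma nonempty_frame [FiniteDimensional ℝ V] : Nonempty (OrthonormalFrame g) := by
  let c : InnerProductSpace.Core ℝ V :=
    { inner := g
      conj_inner_symm := fun x y => by simpa using hg.symm y x
      re_inner_nonneg := fun x => by simpa using hg.nonneg x
      add_left := hg.add_left
      smul_left := fun x y r => by simpa using hg.smul_left r x y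
      definite := fun x hx => by
        by_contra h
        exact (hg.pos x h).ne' hx }
  let _ : NormedAddCommGroup V := c.toNormedAddCommGroup
  let _ : InnerProductSpace ℝ V := InnerProductSpace.ofCore c.toCore
  exact ⟨stdOrthonormalBasis ℝ V, fun i j => (stdOrthonormalBasis ℝ V).inner_eq_ite i j⟩

/-- An orthonormal frame, as a basis. -/
def frameBasis [FiniteDimensional ℝ V] (b : OrthonormalFrame g) :
    Module.Basis (Fin (Module.finrank ℝ V)) ℝ V :=
  basisOfLinearIndependentOfCardEqFinrank' b.1 (hg.linearIndependent b.2) (by simp)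

lemma coe_frameBasis [FiniteDimensional ℝ V] (b : OrthonormalFrame g) :
    ⇑(hg.frameBasis b) = b.1 :=
  coe_basisOfLinearIndependentOfCardEqFinrank' _ _ _

lemma sum_frame [FiniteDimensional ℝ V] (b : OrthonormalFrame g) (v : V) :
    v = ∑ i, g v (b.1 i) • b.1 i := by
  have h := (hg.frameBasis b).sum_repr v
  simp only [hg.coe_frameBasis] at h
  conv_lhs => rw [← h]
  refine Finset.sum_congr rfl fun i _ => ?_
  congr 1
  conv_rhs => rw [← h]
  simp [hg.sum_left, hg.smul_left, b.2]

lemma apply_eq_sum_frame [FiniteDimensional ℝ V] (b : OrthonormalFrame g) (v w : V) :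
    g v w = ∑ i, g v (b.1 i) * g w (b.1 i) := by
  conv_lhs => rw [hg.sum_frame b v]
  rw [hg.sum_left]
  refine Finset.sum_congr rfl fun i _ => ?_
  rw [hg.smul_left, hg.symm w]

lemma abs_apply_frame_le [FiniteDimensional ℝ V] (b : OrthonormalFrame g) (v : V)
    (i : Fin (Module.finrank ℝ V)) : |g v (b.1 i)| ≤ √(g v v) := by
  refine Real.abs_le_sqrt ?_
  rw [hg.apply_eq_sum_frame b v v, sq]
  exact Finset.single_le_sum (f := fun i => g v (b.1 i) * g v (b.1 i))
    (fun i _ => mul_self_nonneg _) (Finset.mem_univ i)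

/-- The square norm of a form in terms of an arbitrary basis. -/
lemma sum_frame_sq [FiniteDimensional ℝ V] {ι : Type*} [Fintype ι] [DecidableEq ι]
    (e : Module.Basis ι ℝ V) (b : OrthonormalFrame g) {k : ℕ} (α : V [⋀^Fin k]→ₗ[ℝ] ℝ) :
    ∑ s : Fin k → Fin (Module.finrank ℝ V), α (fun i => b.1 (s i)) ^ 2 =
      ∑ S : Fin k → ι, ∑ T : Fin k → ι, (∏ a, (gram g e)⁻¹ (S a) (T a)) *
        (α (fun i => e (S i)) * α (fun i => e (T i))) := by
  set A : Matrix (Fin (Module.finrank ℝ V)) ι ℝ := Matrix.of fun i j => e.repr (b.1 i) j with hA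
  set B : Matrix ι (Fin (Module.finrank ℝ V)) ℝ := Matrix.of fun j i => g (e j) (b.1 i) with hB
  have hAB : A * B = 1 := by
    ext i j
    have : ∑ l, e.repr (b.1 i) l * g (e l) (b.1 j) = g (b.1 i) (b.1 j) := by
      conv_rhs => rw [← e.sum_repr (b.1 i), hg.sum_left]
      simp [hg.smul_left]
    rw [Matrix.mul_apply, Matrix.one_apply, ← b.2 i j, ← this]
    rfl
  have hBA : B * A = 1 := by
    have hc : Fintype.card (Fin (Module.finrank ℝ V)) = Fintype.card ι := by
      rw [Fintype.card_fin, Module.finrank_eq_card_basis e]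
    exact (Matrix.mul_eq_one_comm_of_card_eq _ _ _ hc).1 hAB
  have hG : gram g e = B * B.transpose := by
    ext i j
    rw [Matrix.mul_apply]
    exact hg.apply_eq_sum_frame b (e i) (e j)
  have hGinv : (gram g e)⁻¹ = A.transpose * A := by
    refine Matrix.inv_eq_left_inv ?_
    rw [hG, Matrix.mul_assoc, ← Matrix.mul_assoc A, hAB, Matrix.one_mul, ← Matrix.transpose_mul,
      hBA, Matrix.transpose_one]
  have hα (s : Fin k → Fin (Module.finrank ℝ V)) : α (fun i => b.1 (s i)) =
      ∑ S : Fin k → ι, (∏ a, A (s a) (S a)) * α (fun i => e (S i)) := by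
    have h1 : (fun i => b.1 (s i)) = fun i => ∑ j, A (s i) j • e j := by
      ext1 i
      exact (e.sum_repr _).symm
    rw [h1, ← AlternatingMap.coe_multilinearMap, MultilinearMap.map_sum]
    refine Finset.sum_congr rfl fun S _ => ?_
    rw [MultilinearMap.map_smul_univ, smul_eq_mul]
  simp_rw [hα, sq, Finset.sum_mul_sum]
  rw [Finset.sum_comm]
  refine Finset.sum_congr rfl fun S _ => ?_
  rw [Finset.sum_comm]
  refine Finset.sum_congr rfl fun T _ => ?_
  have : ∏ a, (gram g e)⁻¹ (S a) (T a) =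
      ∑ s : Fin k → Fin (Module.finrank ℝ V), ∏ a, A (s a) (S a) * A (s a) (T a) := by
    rw [hGinv]
    simp only [Matrix.mul_apply, Matrix.transpose_apply]
    rw [Finset.prod_univ_sum, Fintype.piFinset_univ]
  rw [this, Finset.sum_mul]
  refine Finset.sum_congr rfl fun s _ => ?_
  rw [Finset.prod_mul_distrib]
  ring

lemma formNorm_eq_frame [FiniteDimensional ℝ V] (b : OrthonormalFrame g) {k : ℕ}
    (α : V [⋀^Fin k]→ₗ[ℝ] ℝ) :
    formNorm g α = √((∑ s : Fin k → Fin (Module.finrank ℝ V), α (fun i => b.1 (s i)) ^ 2) /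
      (k.factorial : ℝ)) := by
  have : Nonempty (OrthonormalFrame g) := ⟨b⟩
  have h (b' : OrthonormalFrame g) :
      √((∑ s : Fin k → Fin (Module.finrank ℝ V), α (fun i => b'.1 (s i)) ^ 2) /
        (k.factorial : ℝ)) =
      √((∑ s : Fin k → Fin (Module.finrank ℝ V), α (fun i => b.1 (s i)) ^ 2) /
        (k.factorial : ℝ)) := by
    rw [hg.sum_frame_sq (hg.frameBasis b), hg.sum_frame_sq (hg.frameBasis b)]
  rw [formNorm]
  simp_rw [h]
  exact ciSup_const

lemma formNorm_eq_gram [FiniteDimensional ℝ V] {ι : Type*} [Fintype ι] [DecidableEq ι]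
    (e : Module.Basis ι ℝ V) {k : ℕ} (α : V [⋀^Fin k]→ₗ[ℝ] ℝ) :
    formNorm g α = √((∑ S : Fin k → ι, ∑ T : Fin k → ι, (∏ a, (gram g e)⁻¹ (S a) (T a)) *
        (α (fun i => e (S i)) * α (fun i => e (T i)))) / (k.factorial : ℝ)) := by
  obtain ⟨b⟩ := hg.nonempty_frame
  rw [hg.formNorm_eq_frame b, hg.sum_frame_sq e]

lemma formNorm_nonneg [FiniteDimensional ℝ V] {k : ℕ} (α : V [⋀^Fin k]→ₗ[ℝ] ℝ) :
    0 ≤ formNorm g α := by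
  obtain ⟨b⟩ := hg.nonempty_frame
  rw [hg.formNorm_eq_frame b]
  positivity

lemma formNorm_zero [FiniteDimensional ℝ V] {k : ℕ} :
    formNorm g (0 : V [⋀^Fin k]→ₗ[ℝ] ℝ) = 0 := by
  obtain ⟨b⟩ := hg.nonempty_frame
  simp [hg.formNorm_eq_frame b]

lemma formNorm_smul [FiniteDimensional ℝ V] {k : ℕ} (c : ℝ) (α : V [⋀^Fin k]→ₗ[ℝ] ℝ) :
    formNorm g (c • α) = |c| * formNorm g α := by
  obtain ⟨b⟩ := hg.nonempty_frame
  rw [hg.formNorm_eq_frame b, hg.formNorm_eq_frame b, ← Real.sqrt_sq_eq_abs,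
    ← Real.sqrt_mul (sq_nonneg c)]
  simp [mul_pow, ← Finset.mul_sum, mul_div_assoc]

lemma formNorm_add_le [FiniteDimensional ℝ V] {k : ℕ} (α β : V [⋀^Fin k]→ₗ[ℝ] ℝ) :
    formNorm g (α + β) ≤ formNorm g α + formNorm g β := by
  obtain ⟨b⟩ := hg.nonempty_frame
  simp only [hg.formNorm_eq_frame b]
  rw [Real.sqrt_div (by positivity), Real.sqrt_div (by positivity), Real.sqrt_div (by positivity),
    ← add_div]
  gcongr
  exact sqrt_sum_add_sq_le _ _

lemma abs_apply_frame_le_formNorm [FiniteDimensional ℝ V] (b : OrthonormalFrame g) {k : ℕ}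
    (α : V [⋀^Fin k]→ₗ[ℝ] ℝ) (s : Fin k → Fin (Module.finrank ℝ V)) :
    |α fun i => b.1 (s i)| ≤ √(k.factorial : ℝ) * formNorm g α := by
  rw [hg.formNorm_eq_frame b, ← Real.sqrt_mul (by positivity), mul_div_cancel₀ _ (by positivity)]
  exact Real.abs_le_sqrt (Finset.single_le_sum (f := fun s => α (fun i => b.1 (s i)) ^ 2)
    (fun i _ => sq_nonneg _) (Finset.mem_univ s))

/-- The values of a form are bounded by its norm. -/
lemma abs_apply_le [FiniteDimensional ℝ V] {k : ℕ} (α : V [⋀^Fin k]→ₗ[ℝ] ℝ) (w : Fin k → V) :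
    |α w| ≤ (Module.finrank ℝ V) ^ k * √(k.factorial : ℝ) * (∏ i, √(g (w i) (w i))) *
      formNorm g α := by
  obtain ⟨b⟩ := hg.nonempty_frame
  have h1 : w = fun i => ∑ j, g (w i) (b.1 j) • b.1 j := by
    ext1 i
    exact hg.sum_frame b _
  conv_lhs => rw [h1, ← AlternatingMap.coe_multilinearMap, MultilinearMap.map_sum]
  refine (Finset.abs_sum_le_sum_abs _ _).trans ?_
  have h2 (S : Fin k → Fin (Module.finrank ℝ V)) :
      |(α : MultilinearMap ℝ _ ℝ) fun i => g (w i) (b.1 (S i)) • b.1 (S i)| ≤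
        (∏ i, √(g (w i) (w i))) * (√(k.factorial : ℝ) * formNorm g α) := by
    rw [MultilinearMap.map_smul_univ, smul_eq_mul, abs_mul, Finset.abs_prod]
    refine mul_le_mul ?_ (hg.abs_apply_frame_le_formNorm b α S) (abs_nonneg _) (by positivity)
    exact Finset.prod_le_prod (fun i _ => abs_nonneg _) fun i _ => hg.abs_apply_frame_le b _ _
  refine (Finset.sum_le_sum fun S _ => h2 S).trans (le_of_eq ?_)
  simp
  ring

/-- The norm of a form is bounded by its values on an orthonormal frame. -/
lemma formNorm_le_of_forall [FiniteDimensional ℝ V] (b : OrthonormalFrame g) {k : ℕ}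
    (α : V [⋀^Fin k]→ₗ[ℝ] ℝ) {C : ℝ} (hC : 0 ≤ C)
    (h : ∀ s : Fin k → Fin (Module.finrank ℝ V), |α fun i => b.1 (s i)| ≤ C) :
    formNorm g α ≤ √((Module.finrank ℝ V : ℝ) ^ k) * C := by
  rw [hg.formNorm_eq_frame b]
  have : √((Module.finrank ℝ V : ℝ) ^ k) * C = √((Module.finrank ℝ V : ℝ) ^ k * C ^ 2) := by
    rw [Real.sqrt_mul (by positivity), Real.sqrt_sq hC]
  rw [this]
  refine Real.sqrt_le_sqrt ?_
  refine (div_le_self (by positivity) (by exact_mod_cast k.factorial_pos)).trans ?_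
  refine (Finset.sum_le_sum fun s _ => sq_le_sq' (abs_le.1 (h s)).1 (abs_le.1 (h s)).2).trans ?_
  simp

/-- In maximal degree, the norm is the value on an orthonormal frame. -/
lemma abs_apply_basis_eq [FiniteDimensional ℝ V]
    (e : Module.Basis (Fin (Module.finrank ℝ V)) ℝ V)
    (α : V [⋀^Fin (Module.finrank ℝ V)]→ₗ[ℝ] ℝ) :
    |α e| = formNorm g α * √(gram g e).det := by
  obtain ⟨b⟩ := hg.nonempty_frame
  have h1 : formNorm g α = |α b.1| := by
    rw [hg.formNorm_eq_frame b]
    have h : ∑ s : Fin (Module.finrank ℝ V) → Fin (Module.finrank ℝ V),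
        α (fun i => b.1 (s i)) ^ 2 =
        ∑ σ : Equiv.Perm (Fin (Module.finrank ℝ V)), α (fun i => b.1 (σ i)) ^ 2 := by
      symm
      refine Finset.sum_bij_ne_zero (fun σ _ _ => ⇑σ) (fun _ _ _ => Finset.mem_univ _)
        (fun σ _ _ τ _ _ h => DFunLike.coe_injective h) (fun s _ hs => ?_) (fun _ _ _ => rfl)
      have hinj : Function.Injective s := by
        by_contra hn
        refine hs ?_
        rw [α.map_eq_zero_of_not_injective _ fun h => hn fun i j hij => h (by simp [hij])]
        simp
      exact ⟨Equiv.ofBijective s (Finite.injective_iff_bijective.1 hinj), Finset.mem_univ _,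
        by simpa using hs, rfl⟩
    have h2 (σ : Equiv.Perm (Fin (Module.finrank ℝ V))) :
        α (fun i => b.1 (σ i)) ^ 2 = α b.1 ^ 2 := by
      have := α.map_perm b.1 σ
      rw [show (fun i => b.1 (σ i)) = b.1 ∘ σ from rfl, this, Units.smul_def]
      rcases Int.units_eq_one_or (Equiv.Perm.sign σ) with h | h <;> simp [h]
    rw [h]
    simp_rw [h2]
    rw [Finset.sum_const, Finset.card_univ, Fintype.card_perm, Fintype.card_fin, nsmul_eq_mul,
      mul_div_cancel_left₀ _ (by positivity), Real.sqrt_sq_eq_abs]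
  have h3 : gram g e = ((hg.frameBasis b).toMatrix e).transpose * (hg.frameBasis b).toMatrix e := by
    ext i j
    rw [Matrix.mul_apply]
    have hr (v : V) (i) : (hg.frameBasis b).repr v i = g v (b.1 i) := by
      have h := congrArg (fun v => (hg.frameBasis b).repr v i) (hg.sum_frame b v)
      simp only [← hg.coe_frameBasis b] at h ⊢
      rw [h]
      simp [Finsupp.single_apply]
    simp only [Matrix.transpose_apply, Module.Basis.toMatrix_apply, hr]
    exact hg.apply_eq_sum_frame b (e i) (e j)
  rw [h1, h3, Matrix.det_mul, Matrix.det_transpose, Real.sqrt_mul_self_eq_abs, ← abs_mul]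
  conv_lhs => rw [α.eq_smul_basis_det (hg.frameBasis b)]
  rw [AlternatingMap.smul_apply, Module.Basis.det_apply, hg.coe_frameBasis, smul_eq_mul]

lemma det_gram_pos [FiniteDimensional ℝ V] {ι : Type*} [Fintype ι] [DecidableEq ι]
    (e : Module.Basis ι ℝ V) : 0 < (gram g e).det := by
  refine Matrix.PosDef.det_pos (Matrix.PosDef.of_dotProduct_mulVec_pos ?_ fun x hx => ?_)
  · ext i j
    exact hg.symm _ _
  · have h : star x ⬝ᵥ Matrix.mulVec (gram g e) x = g (∑ i, x i • e i) (∑ j, x j • e j) := by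
      simp only [hg.sum_left, hg.sum_right, hg.smul_left, hg.smul_right, dotProduct,
        Matrix.mulVec, Finset.mul_sum, gram, Matrix.of_apply, star_trivial]
      refine Finset.sum_congr rfl fun i _ => Finset.sum_congr rfl fun j _ => ?_
      ring
    rw [h]
    refine hg.pos _ fun h0 => hx ?_
    ext i
    exact Fintype.linearIndependent_iff.1 e.linearIndependent x h0 i

lemma prod {g' : W → W → ℝ} (hg' : IsScalarProduct g') :
    IsScalarProduct fun v w : V × W => g v.1 w.1 + g' v.2 w.2 where
  symm v w := by rw [hg.symm, hg'.symm]
  add_left u v w := by simp only [Prod.fst_add, Prod.snd_add, hg.add_left, hg'.add_left]; ring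
  smul_left c v w := by simp only [Prod.smul_fst, Prod.smul_snd, hg.smul_left, hg'.smul_left]; ring
  pos v hv := by
    by_cases h : v.1 = 0
    · exact add_pos_of_nonneg_of_pos (hg.nonneg _) (hg'.pos _ fun h' => hv (Prod.ext h h'))
    · exact add_pos_of_pos_of_nonneg (hg.pos _ h) (hg'.nonneg _)

end IsScalarProduct

lemma abs_sign_div_le {n : ℕ} (σ : Equiv.Perm (Fin n)) (k l : ℕ) :
    |((Equiv.Perm.sign σ : ℤ) : ℝ) / (k.factorial * l.factorial)| ≤ 1 := by
  rw [abs_div]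
  refine div_le_one_of_le₀ ?_ (abs_nonneg _)
  have h1 : (1 : ℝ) ≤ k.factorial := by exact_mod_cast k.factorial_pos
  have h2 : (1 : ℝ) ≤ l.factorial := by exact_mod_cast l.factorial_pos
  have h3 : |((Equiv.Perm.sign σ : ℤ) : ℝ)| = 1 := by
    rcases Int.units_eq_one_or (Equiv.Perm.sign σ) with h | h <;> simp [h]
  rw [h3]
  exact (one_le_mul_of_one_le_of_one_le h1 h2).trans (le_abs_self _)

/-- The norm of a wedge product is bounded by the product of the norms, up to a constant. -/
lemma exists_formNorm_wedge_le (n k l : ℕ) : ∃ C : ℝ, 0 ≤ C ∧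
    ∀ {V : Type*} [AddCommGroup V] [Module ℝ V] [FiniteDimensional ℝ V] {g : V → V → ℝ},
      Module.finrank ℝ V = n → IsScalarProduct g → ∀ (α : V [⋀^Fin k]→ₗ[ℝ] ℝ)
      (β : V [⋀^Fin l]→ₗ[ℝ] ℝ), formNorm g (wedge α β) ≤ C * (formNorm g α * formNorm g β) := by
  refine ⟨√((n : ℝ) ^ (k + l)) * ((k + l).factorial * (√k.factorial * √l.factorial)),
    by positivity, fun {V} _ _ _ g hn hg α β => ?_⟩
  obtain ⟨b⟩ := hg.nonempty_frame
  have hα := hg.formNorm_nonneg α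
  have hβ := hg.formNorm_nonneg β
  refine (hg.formNorm_le_of_forall b (wedge α β) (C := (k + l).factorial *
    ((√k.factorial * formNorm g α) * (√l.factorial * formNorm g β))) (by positivity)
    fun s => ?_).trans (le_of_eq (by rw [hn]; ring))
  rw [wedge_apply]
  refine (Finset.abs_sum_le_sum_abs _ _).trans ?_
  refine (Finset.sum_le_card_nsmul _ _ _ fun σ _ => ?_).trans (le_of_eq (by
    rw [Finset.card_univ, Fintype.card_perm, Fintype.card_fin, nsmul_eq_mul]))
  rw [abs_mul, abs_mul]
  refine (mul_le_of_le_one_left (by positivity) (abs_sign_div_le σ k l)).trans ?_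
  exact mul_le_mul (hg.abs_apply_frame_le_formNorm b α _) (hg.abs_apply_frame_le_formNorm b β _)
    (abs_nonneg _) (by positivity)

lemma exists_formNorm_lwedge_le (n k : ℕ) : ∃ C : ℝ, 0 ≤ C ∧
    ∀ {V : Type*} [AddCommGroup V] [Module ℝ V] [FiniteDimensional ℝ V] {g : V → V → ℝ},
      Module.finrank ℝ V = n → IsScalarProduct g → ∀ (ℓ : V →ₗ[ℝ] ℝ) (β : V [⋀^Fin k]→ₗ[ℝ] ℝ)
      (A : ℝ), 0 ≤ A → (∀ v, |ℓ v| ≤ A * √(g v v)) →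
        formNorm g (lwedge ℓ β) ≤ C * (A * formNorm g β) := by
  refine ⟨√((n : ℝ) ^ (k + 1)) * ((k + 1 : ℕ) * √k.factorial),
    by positivity, fun {V} _ _ _ g hn hg ℓ β A hA hℓ => ?_⟩
  obtain ⟨b⟩ := hg.nonempty_frame
  have hβ := hg.formNorm_nonneg β
  refine (hg.formNorm_le_of_forall b (lwedge ℓ β) (C := (k + 1 : ℕ) *
    (A * (√k.factorial * formNorm g β))) (by positivity)
    fun s => ?_).trans (le_of_eq (by rw [hn]; ring))
  rw [lwedge_apply]
  refine (Finset.abs_sum_le_sum_abs _ _).trans ?_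
  refine (Finset.sum_le_card_nsmul _ _ _ fun i _ => ?_).trans (le_of_eq (by
    rw [Finset.card_univ, Fintype.card_fin, nsmul_eq_mul]))
  rw [abs_mul, abs_mul, abs_pow, abs_neg, abs_one, one_pow, one_mul]
  refine mul_le_mul ?_ (hg.abs_apply_frame_le_formNorm b β _) (abs_nonneg _) hA
  simpa [b.2] using hℓ (b.1 (s i))

/-- The norm of the product of forms on two vector spaces is comparable with the product of the
norms. -/
lemma exists_formNorm_vcross_le (n₁ n₂ k l : ℕ) : ∃ C : ℝ, 0 ≤ C ∧
    ∀ {V W : Type*} [AddCommGroup V] [Module ℝ V] [FiniteDimensional ℝ V]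
      [AddCommGroup W] [Module ℝ W] [FiniteDimensional ℝ W] {g : V → V → ℝ} {g' : W → W → ℝ},
      Module.finrank ℝ V = n₁ → Module.finrank ℝ W = n₂ → IsScalarProduct g → IsScalarProduct g' →
      ∀ (α : V [⋀^Fin k]→ₗ[ℝ] ℝ) (β : W [⋀^Fin l]→ₗ[ℝ] ℝ),
        formNorm (fun v w : V × W => g v.1 w.1 + g' v.2 w.2) (vcross α β) ≤
          C * (formNorm g α * formNorm g' β) ∧
        formNorm g α * formNorm g' β ≤
          C * formNorm (fun v w : V × W => g v.1 w.1 + g' v.2 w.2) (vcross α β) := by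
  set C₁ : ℝ := (n₁ : ℝ) ^ k * √k.factorial with hC₁
  set C₂ : ℝ := (n₂ : ℝ) ^ l * √l.factorial with hC₂
  set C₃ : ℝ := ((n₁ + n₂ : ℕ) : ℝ) ^ (k + l) * √(k + l).factorial with hC₃
  set C₄ : ℝ := √(((n₁ + n₂ : ℕ) : ℝ) ^ (k + l)) * ((k + l).factorial * (C₁ * C₂)) with hC₄
  set C₅ : ℝ := √((n₂ : ℝ) ^ l) * (√((n₁ : ℝ) ^ k) * C₃) with hC₅
  refine ⟨max C₄ C₅, by positivity, fun {V W} _ _ _ _ _ _ g g' hn₁ hn₂ hg hg' α β => ?_⟩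
  have hG := hg.prod hg'
  have hn : Module.finrank ℝ (V × W) = n₁ + n₂ := by rw [Module.finrank_prod, hn₁, hn₂]
  set G : V × W → V × W → ℝ := fun v w : V × W => g v.1 w.1 + g' v.2 w.2 with hGdef
  obtain ⟨b⟩ := hG.nonempty_frame
  obtain ⟨b₁⟩ := hg.nonempty_frame
  obtain ⟨b₂⟩ := hg'.nonempty_frame
  have hα := hg.formNorm_nonneg α
  have hβ := hg'.formNorm_nonneg β
  have hαβ := hG.formNorm_nonneg (vcross α β)
  constructor
  · refine (?_ : _ ≤ C₄ * (formNorm g α * formNorm g' β)).trans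
      (mul_le_mul_of_nonneg_right (le_max_left _ _) (by positivity))
    refine (hG.formNorm_le_of_forall b (vcross α β) (C := (k + l).factorial *
      ((C₁ * formNorm g α) * (C₂ * formNorm g' β))) (by positivity)
      fun s => ?_).trans (le_of_eq (by rw [hn]; ring))
    rw [vcross_apply]
    refine (Finset.abs_sum_le_sum_abs _ _).trans ?_
    refine (Finset.sum_le_card_nsmul _ _ _ fun σ _ => ?_).trans (le_of_eq (by
      rw [Finset.card_univ, Fintype.card_perm, Fintype.card_fin, nsmul_eq_mul]))
    rw [abs_mul, abs_mul]
    refine (mul_le_of_le_one_left (by positivity) (abs_sign_div_le σ k l)).trans ?_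
    have hb (i) : g (b.1 i).1 (b.1 i).1 + g' (b.1 i).2 (b.1 i).2 = 1 := by
      have := b.2 i i
      simpa [hGdef] using this
    refine mul_le_mul ((hg.abs_apply_le α _).trans ?_) ((hg'.abs_apply_le β _).trans ?_)
      (abs_nonneg _) (by positivity)
    · rw [hn₁, ← hC₁]
      refine mul_le_mul_of_nonneg_right (mul_le_of_le_one_right (by positivity) ?_) hα
      refine Finset.prod_le_one (fun _ _ => Real.sqrt_nonneg _) fun i _ => ?_
      rw [Real.sqrt_le_one]
      linarith [hb (s (σ (Fin.castAdd l i))), hg'.nonneg (b.1 (s (σ (Fin.castAdd l i)))).2]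
    · rw [hn₂, ← hC₂]
      refine mul_le_mul_of_nonneg_right (mul_le_of_le_one_right (by positivity) ?_) hβ
      refine Finset.prod_le_one (fun _ _ => Real.sqrt_nonneg _) fun i _ => ?_
      rw [Real.sqrt_le_one]
      linarith [hb (s (σ (Fin.natAdd k i))), hg.nonneg (b.1 (s (σ (Fin.natAdd k i)))).1]
  · refine (?_ : _ ≤ C₅ * formNorm G (vcross α β)).trans
      (mul_le_mul_of_nonneg_right (le_max_right _ _) hαβ)
    have key (s₁ : Fin k → Fin (Module.finrank ℝ V)) (s₂ : Fin l → Fin (Module.finrank ℝ W)) :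
        |α (fun i => b₁.1 (s₁ i)) * β (fun i => b₂.1 (s₂ i))| ≤ C₃ * formNorm G (vcross α β) := by
      rw [← vcross_append]
      refine (hG.abs_apply_le _ _).trans ?_
      rw [hn, ← hC₃]
      refine mul_le_mul_of_nonneg_right (mul_le_of_le_one_right (by positivity) ?_) hαβ
      refine Finset.prod_le_one (fun _ _ => Real.sqrt_nonneg _) fun i _ => ?_
      rw [Real.sqrt_le_one]
      refine Fin.addCases (fun i => ?_) (fun i => ?_) i
      · simp [hGdef, hg'.zero_left, b₁.2]
      · simp [hGdef, hg.zero_left, b₂.2]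
    have h1 (s₂ : Fin l → Fin (Module.finrank ℝ W)) :
        |β fun i => b₂.1 (s₂ i)| * formNorm g α ≤ √((n₁ : ℝ) ^ k) * (C₃ * formNorm G (vcross α β)) := by
      rw [← hg.formNorm_smul, ← hn₁]
      refine hg.formNorm_le_of_forall b₁ _ (by positivity) fun s₁ => ?_
      rw [AlternatingMap.smul_apply, smul_eq_mul, mul_comm]
      exact key s₁ s₂
    rw [← abs_of_nonneg hα, ← hg'.formNorm_smul]
    refine (hg'.formNorm_le_of_forall b₂ _ (C := √((n₁ : ℝ) ^ k) * (C₃ * formNorm G (vcross α β)))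
      (by positivity) fun s₂ => ?_).trans (le_of_eq (by rw [hn₂]; ring))
    rw [AlternatingMap.smul_apply, smul_eq_mul, abs_mul, abs_of_nonneg hα, mul_comm]
    exact h1 s₂

end ScalarProduct


/-! ### Charts and the Riemannian measure -/

section Charts

variable {E : Type*} [NormedAddCommGroup E] [NormedSpace ℝ E]
  {H : Type*} [TopologicalSpace H] {I : ModelWithCorners ℝ E H}
  {M : Type*} [TopologicalSpace M] [ChartedSpace H M]

/-- The derivative of the inverse of the chart around `x₀`. -/
abbrev dchart (I : ModelWithCorners ℝ E H) (x₀ : M) (y : E) :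
    E →L[ℝ] TangentSpace I ((extChartAt I x₀).symm y) :=
  mfderiv 𝓘(ℝ, E) I (extChartAt I x₀).symm y

/-- `g` is a continuous Riemannian metric. -/
structure IsRiemMetric (g : MetricField I M) : Prop where
  scalar : ∀ x, IsScalarProduct (V := TangentSpace I x) (g x)
  continuousOn : ∀ (x₀ : M) (v w : E), ContinuousOn
    (fun y => g ((extChartAt I x₀).symm y) (dchart I x₀ y v) (dchart I x₀ y w))
    (extChartAt I x₀).target

variable [I.Boundaryless] [IsManifold I ∞ M]

lemma isInvertible_dchart {x₀ : M} {y : E} (hy : y ∈ (extChartAt I x₀).target) :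
    (dchart I x₀ y).IsInvertible := by
  have h := isInvertible_mfderivWithin_extChartAt_symm (I := I) hy
  rwa [I.range_eq_univ, mfderivWithin_univ] at h

lemma mdifferentiableAt_chart_symm {x₀ : M} {y : E} (hy : y ∈ (extChartAt I x₀).target) :
    MDifferentiableAt 𝓘(ℝ, E) I (extChartAt I x₀).symm y := by
  have h := mdifferentiableWithinAt_extChartAt_symm (I := I) hy
  rwa [I.range_eq_univ, mdifferentiableWithinAt_univ] at h

/-- The derivative of the inverse of the chart, as an equivalence. -/
def chartEquiv {x₀ : M} {y : E} (hy : y ∈ (extChartAt I x₀).target) :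
    E ≃L[ℝ] TangentSpace I ((extChartAt I x₀).symm y) :=
  (isInvertible_dchart hy).choose

lemma chartEquiv_apply {x₀ : M} {y : E} (hy : y ∈ (extChartAt I x₀).target) (v : E) :
    chartEquiv hy v = dchart I x₀ y v :=
  congrArg (fun L : E →L[ℝ] TangentSpace I ((extChartAt I x₀).symm y) => L v)
    (isInvertible_dchart hy).choose_spec

instance [FiniteDimensional ℝ E] (x : M) : FiniteDimensional ℝ (TangentSpace I x) :=
  inferInstanceAs (FiniteDimensional ℝ E)

/-- The image of a basis under the derivative of the inverse of a chart. -/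
def chartBasis {ι : Type*} (e : Module.Basis ι ℝ E) {x₀ : M} {y : E}
    (hy : y ∈ (extChartAt I x₀).target) :
    Module.Basis ι ℝ (TangentSpace I ((extChartAt I x₀).symm y)) :=
  e.map (chartEquiv hy).toLinearEquiv

lemma chartBasis_apply {ι : Type*} (e : Module.Basis ι ℝ E) {x₀ : M} {y : E}
    (hy : y ∈ (extChartAt I x₀).target) (i : ι) :
    chartBasis e hy i = dchart I x₀ y (e i) := by
  rw [chartBasis, Module.Basis.map_apply]
  exact chartEquiv_apply hy _

/-- The Gram matrix of the metric in a chart. -/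
def chartGram {ι : Type*} (g : MetricField I M) (e : ι → E) (x₀ : M) (y : E) : Matrix ι ι ℝ :=
  Matrix.of fun i j => g ((extChartAt I x₀).symm y) (dchart I x₀ y (e i)) (dchart I x₀ y (e j))

lemma chartGram_eq {ι : Type*} (g : MetricField I M) (e : Module.Basis ι ℝ E) {x₀ : M} {y : E}
    (hy : y ∈ (extChartAt I x₀).target) :
    chartGram g e x₀ y = gram (g ((extChartAt I x₀).symm y)) (chartBasis e hy) := by
  ext i j
  simp only [chartGram, gram, Matrix.of_apply, chartBasis_apply]

variable [FiniteDimensional ℝ E]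

lemma chartDensity_eq (g : MetricField I M) (x₀ : M) (y : E) :
    chartDensity g x₀ y = √(chartGram g (Module.finBasis ℝ E) x₀ y).det := rfl

namespace IsRiemMetric

variable {g : MetricField I M} (hg : IsRiemMetric g)
include hg

lemma continuousOn_chartGram {ι : Type*} (e : ι → E) (x₀ : M) :
    ContinuousOn (chartGram g e x₀) (extChartAt I x₀).target :=
  continuousOn_pi.2 fun _ => continuousOn_pi.2 fun _ => hg.continuousOn x₀ _ _

lemma det_chartGram_pos {ι : Type*} [Fintype ι] [DecidableEq ι] (e : Module.Basis ι ℝ E) {x₀ : M}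
    {y : E} (hy : y ∈ (extChartAt I x₀).target) : 0 < (chartGram g e x₀ y).det := by
  rw [chartGram_eq g e hy]
  exact (hg.scalar _).det_gram_pos _

lemma continuousOn_chartDensity (x₀ : M) :
    ContinuousOn (chartDensity g x₀) (extChartAt I x₀).target := by
  refine Real.continuous_sqrt.comp_continuousOn ?_
  exact (Continuous.matrix_det continuous_id).comp_continuousOn (hg.continuousOn_chartGram _ x₀)

lemma chartDensity_pos {x₀ : M} {y : E} (hy : y ∈ (extChartAt I x₀).target) :
    0 < chartDensity g x₀ y := Real.sqrt_pos.2 (hg.det_chartGram_pos _ hy)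

/-- The norm of a form in a chart. -/
lemma formNorm_chart {k : ℕ} (θ : DiffForm I M k) {x₀ : M} {y : E}
    (hy : y ∈ (extChartAt I x₀).target) :
    formNorm (V := TangentSpace I ((extChartAt I x₀).symm y)) (g ((extChartAt I x₀).symm y))
      (θ ((extChartAt I x₀).symm y)) =
    √((∑ S : Fin k → Fin (Module.finrank ℝ E), ∑ T : Fin k → Fin (Module.finrank ℝ E),
      (∏ a, (chartGram g (Module.finBasis ℝ E) x₀ y)⁻¹ (S a) (T a)) *
        (inChart x₀ θ y (fun i => Module.finBasis ℝ E (S i)) *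
          inChart x₀ θ y (fun i => Module.finBasis ℝ E (T i)))) / (k.factorial : ℝ)) := by
  rw [(hg.scalar _).formNorm_eq_gram (chartBasis (Module.finBasis ℝ E) hy), ← chartGram_eq]
  simp only [chartBasis_apply]
  rfl

lemma abs_inChart_le {k : ℕ} (θ : DiffForm I M k) (x₀ : M) (y : E) (v : Fin k → E) :
    |inChart x₀ θ y v| ≤ (Module.finrank ℝ E) ^ k * √(k.factorial : ℝ) *
      (∏ i, √(g ((extChartAt I x₀).symm y) (dchart I x₀ y (v i)) (dchart I x₀ y (v i)))) *
      formNorm (V := TangentSpace I ((extChartAt I x₀).symm y)) (g ((extChartAt I x₀).symm y))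
        (θ ((extChartAt I x₀).symm y)) :=
  (hg.scalar ((extChartAt I x₀).symm y)).abs_apply_le (θ ((extChartAt I x₀).symm y))
    fun i => dchart I x₀ y (v i)

/-- In maximal degree, the value in a chart is the norm times the density. -/
lemma abs_inChart_basis (τ : DiffForm I M (Module.finrank ℝ E)) {x₀ : M} {y : E}
    (hy : y ∈ (extChartAt I x₀).target) :
    |inChart x₀ τ y (Module.finBasis ℝ E)| =
      formNorm (V := TangentSpace I ((extChartAt I x₀).symm y)) (g ((extChartAt I x₀).symm y))
        (τ ((extChartAt I x₀).symm y)) * chartDensity g x₀ y := by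
  have h := (hg.scalar ((extChartAt I x₀).symm y)).abs_apply_basis_eq
    (chartBasis (Module.finBasis ℝ E) hy) (τ ((extChartAt I x₀).symm y))
  have h2 := chartGram_eq g (Module.finBasis ℝ E) hy
  rw [chartDensity_eq, h2]
  refine Eq.trans ?_ h
  have h3 : (⇑(chartBasis (Module.finBasis ℝ E) hy) : _ → TangentSpace I _) =
      fun i => dchart I x₀ y (Module.finBasis ℝ E i) := by
    ext1 i
    exact chartBasis_apply _ hy i
  exact congrArg (fun w => |τ ((extChartAt I x₀).symm y) w|) h3.symm

end IsRiemMetric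

lemma isContinuousRiemannianBundle_tangent [RiemannianBundle (fun x : M => TangentSpace I x)]
    [h : IsContMDiffRiemannianBundle I ∞ E (fun x : M => TangentSpace I x)] :
    IsContinuousRiemannianBundle E (fun x : M => TangentSpace I x) := by
  obtain ⟨g, hg, h⟩ := h.exists_contMDiff
  exact ⟨g, hg.continuous, h⟩

/-- The metric of a Riemannian manifold is continuous. -/
lemma isRiemMetric_metricOf [RiemannianBundle (fun x : M => TangentSpace I x)]
    [IsContMDiffRiemannianBundle I ∞ E (fun x : M => TangentSpace I x)] :
    IsRiemMetric (metricOf I M) where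
  scalar x :=
    { symm := fun v w => real_inner_comm _ _
      add_left := fun u v w => inner_add_left _ _ _
      smul_left := fun c v w => by simp [metricOf, inner_smul_left]
      pos := fun v hv => real_inner_self_pos.2 hv }
  continuousOn x₀ v w := by
    have hs : ContMDiffOn 𝓘(ℝ, E) I 1 (extChartAt I x₀).symm (extChartAt I x₀).target :=
      contMDiffOn_extChartAt_symm x₀
    have ho : IsOpen (extChartAt I x₀).target := isOpen_extChartAt_target x₀
    have h1 := hs.continuousOn_tangentMapWithin le_rfl ho.uniqueMDiffOn
    have h2 (v : E) : ContinuousOn (fun y => (⟨(extChartAt I x₀).symm y, dchart I x₀ y v⟩ :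
        TotalSpace E (TangentSpace I : M → Type _))) (extChartAt I x₀).target := by
      have h3 : Continuous fun y : E => (⟨y, v⟩ : TangentBundle 𝓘(ℝ, E) E) := by
        exact ((contMDiff_vectorSpace_iff_contDiff (n := 0) (V := fun _ => v)).2
          contDiff_const).continuous
      refine (h1.comp h3.continuousOn fun y hy => hy).congr fun y hy => ?_
      simp only [Function.comp_apply, tangentMapWithin]
      rw [mfderivWithin_of_isOpen ho hy]
      rfl
    have hc : IsContinuousRiemannianBundle E (fun x : M => TangentSpace I x) :=
      isContinuousRiemannianBundle_tangent
    exact (h2 v).inner_bundle (h2 w)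

end Charts


section Gluing

variable {X ι : Type*} [MeasurableSpace X]

lemma measure_eq_tsum_disjointed (ν : Measure X) {U : ℕ → Set X} (hU : ∀ n, MeasurableSet (U n))
    (hcov : ⋃ n, U n = univ) {s : Set X} (hs : MeasurableSet s) :
    ν s = ∑' n, ν (s ∩ disjointed U n) := by
  have h : s = ⋃ n, s ∩ disjointed U n := by
    rw [← inter_iUnion, iUnion_disjointed, hcov, inter_univ]
  conv_lhs => rw [h]
  refine measure_iUnion (fun i j hij => ?_) fun n => hs.inter (MeasurableSet.disjointed hU n)
  exact ((disjoint_disjointed U) hij).mono inter_subset_right inter_subset_right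

lemma iSup_measure_eq {m : ι → Measure X} {U : ι → Set X} (hU : ∀ i, MeasurableSet (U i))
    {t : Set ι} (ht : t.Countable) (hcov : ⋃ i ∈ t, U i = univ) {ν : Measure X}
    (hν : ∀ i, ν.restrict (U i) = m i) : ⨆ i, m i = ν := by
  refine le_antisymm (iSup_le fun i => (hν i).symm ▸ Measure.restrict_le_self) ?_
  rcases t.eq_empty_or_nonempty with rfl | hne
  · have : IsEmpty X := by
      rw [← univ_eq_empty_iff, ← hcov]; simp
    rw [Measure.eq_zero_of_isEmpty ν]
    exact bot_le
  obtain ⟨f, rfl⟩ := ht.exists_eq_range hne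
  rw [biUnion_range] at hcov
  refine Measure.le_iff.2 fun s hs => ?_
  rw [measure_eq_tsum_disjointed ν (fun n => hU (f n)) hcov hs,
    measure_eq_tsum_disjointed (⨆ i, m i) (fun n => hU (f n)) hcov hs]
  refine ENNReal.tsum_le_tsum fun n => ?_
  have h1 : ν (s ∩ disjointed (fun n => U (f n)) n) =
      m (f n) (s ∩ disjointed (fun n => U (f n)) n) := by
    rw [← hν, Measure.restrict_apply (hs.inter (MeasurableSet.disjointed (fun n => hU (f n)) n))]
    congr 1
    exact (inter_eq_left.2 (inter_subset_right.trans (disjointed_subset _ n))).symm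
  rw [h1]
  exact (le_iSup m (f n)) _

/-- Compatible measures on the members of a cover are restrictions of a common measure. -/
lemma exists_measure_restrict_eq {m : ι → Measure X} {U : ι → Set X}
    (hU : ∀ i, MeasurableSet (U i)) {t : Set ι} (ht : t.Countable) (hcov : ⋃ i ∈ t, U i = univ)
    (hfin : ∀ i, SFinite (m i)) (hsupp : ∀ i, m i (U i)ᶜ = 0)
    (hcomp : ∀ i j A, MeasurableSet A → A ⊆ U i → A ⊆ U j → m i A = m j A) :
    ∃ ν : Measure X, SFinite ν ∧ ∀ i, ν.restrict (U i) = m i := by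
  rcases t.eq_empty_or_nonempty with rfl | hne
  · have : IsEmpty X := by
      rw [← univ_eq_empty_iff, ← hcov]; simp
    exact ⟨0, inferInstance, fun i => by rw [Measure.eq_zero_of_isEmpty (m i)]; simp⟩
  obtain ⟨f, rfl⟩ := ht.exists_eq_range hne
  rw [biUnion_range] at hcov
  have hD := MeasurableSet.disjointed (fun n => hU (f n))
  refine ⟨Measure.sum fun n => (m (f n)).restrict (disjointed (fun n => U (f n)) n), inferInstance,
    fun i => ?_⟩
  ext s hs
  rw [Measure.restrict_apply hs, Measure.sum_apply _ (hs.inter (hU i))]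
  have h1 : m i s = m i (s ∩ U i) := by
    refine le_antisymm ?_ (measure_mono inter_subset_left)
    calc m i s ≤ m i (s ∩ U i ∪ (U i)ᶜ) := measure_mono fun x hx => by
          by_cases h : x ∈ U i
          · exact Or.inl ⟨hx, h⟩
          · exact Or.inr h
      _ ≤ _ := (measure_union_le _ _).trans (by rw [hsupp, add_zero])
  rw [h1, measure_eq_tsum_disjointed (m i) (fun n => hU (f n)) hcov (hs.inter (hU i))]
  refine tsum_congr fun n => ?_
  rw [Measure.restrict_apply (hs.inter (hU i))]
  exact hcomp _ _ _ ((hs.inter (hU i)).inter (hD n))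
    (inter_subset_right.trans (disjointed_subset _ n)) (inter_subset_left.trans inter_subset_right)

end Gluing

section Volume

variable {E : Type*} [NormedAddCommGroup E] [NormedSpace ℝ E] [FiniteDimensional ℝ E]
  [MeasurableSpace E] [BorelSpace E]
  {H : Type*} [TopologicalSpace H] {I : ModelWithCorners ℝ E H} [I.Boundaryless]
  {M : Type*} [TopologicalSpace M] [ChartedSpace H M] [IsManifold I ∞ M]
  [MeasurableSpace M] [BorelSpace M]

lemma det_gram_comp {V F : Type*} [AddCommGroup V] [Module ℝ V] [AddCommGroup F] [Module ℝ F]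
    {g : V → V → ℝ} (hg : IsScalarProduct g) {ι : Type*} [Fintype ι] [DecidableEq ι]
    (f : Module.Basis ι ℝ F) (L : F →ₗ[ℝ] V) (A : F →ₗ[ℝ] F) :
    (gram g fun i => L (A (f i))).det = LinearMap.det A ^ 2 * (gram g fun i => L (f i)).det := by
  have h : (gram g fun i => L (A (f i))) =
      (LinearMap.toMatrix f f A).transpose * (gram g fun i => L (f i)) * LinearMap.toMatrix f f A := by
    ext i j
    have h1 (i : ι) : L (A (f i)) = ∑ k, LinearMap.toMatrix f f A k i • L (f k) := by
      conv_lhs => rw [← f.sum_repr (A (f i)), map_sum]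
      simp [LinearMap.toMatrix_apply]
    simp only [gram, Matrix.of_apply, Matrix.mul_apply, Matrix.transpose_apply]
    rw [h1 i, h1 j, hg.sum_right]
    refine Finset.sum_congr rfl fun k _ => ?_
    rw [hg.sum_left, Finset.sum_mul]
    refine Finset.sum_congr rfl fun l _ => ?_
    rw [hg.smul_left, hg.smul_right]
    ring
  rw [h, Matrix.det_mul, Matrix.det_mul, Matrix.det_transpose, LinearMap.det_toMatrix]
  ring

lemma metricField_congr (g : MetricField I M) {x x' : M} (h : x = x') (v w : E) :
    g x v w = g x' v w := by subst h; rfl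

/-- The Riemannian measure on the domain of a chart, extended by zero. -/
def chartMeasure (g : MetricField I M) (x₀ : M) : Measure M :=
  ((chartLebesgue I x₀).withDensity
    (fun y => ENNReal.ofReal (chartDensity g x₀ y))).map (extChartAt I x₀).symm

lemma riemVolume_eq_iSup (g : MetricField I M) : riemVolume g = ⨆ x₀, chartMeasure g x₀ := rfl

lemma measurableSet_target (x₀ : M) : MeasurableSet (extChartAt I x₀).target :=
  (isOpen_extChartAt_target x₀).measurableSet

lemma measurableSet_source (x₀ : M) : MeasurableSet (extChartAt I x₀).source :=
  (isOpen_extChartAt_source x₀).measurableSet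

open Classical in
/-- A measurable map that coincides with the inverse of the chart on its target. -/
def chartSymm (I : ModelWithCorners ℝ E H) (x₀ : M) : E → M :=
  Set.piecewise (extChartAt I x₀).target (extChartAt I x₀).symm fun _ => x₀

lemma chartSymm_eq {x₀ : M} {y : E} (hy : y ∈ (extChartAt I x₀).target) :
    chartSymm I x₀ y = (extChartAt I x₀).symm y := if_pos hy

lemma measurable_chartSymm (x₀ : M) : Measurable (chartSymm I x₀) := by
  classical
  exact (continuousOn_extChartAt_symm x₀).measurable_piecewise continuousOn_const
    (measurableSet_target x₀)

lemma ae_chartLebesgue_mem (x₀ : M) : ∀ᵐ y ∂(chartLebesgue I x₀), y ∈ (extChartAt I x₀).target :=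
  ae_restrict_mem (measurableSet_target x₀)

lemma chartSymm_ae_eq (x₀ : M) :
    chartSymm I x₀ =ᵐ[chartLebesgue I x₀] (extChartAt I x₀).symm := by
  filter_upwards [ae_chartLebesgue_mem (I := I) x₀] with y hy using chartSymm_eq hy

namespace IsRiemMetric

variable {g : MetricField I M} (hg : IsRiemMetric g)
include hg

lemma aemeasurable_ofReal_chartDensity (x₀ : M) :
    AEMeasurable (fun y => ENNReal.ofReal (chartDensity g x₀ y)) (chartLebesgue I x₀) :=
  ((hg.continuousOn_chartDensity x₀).aemeasurable (measurableSet_target x₀)).ennreal_ofReal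

lemma chartMeasure_eq_map (x₀ : M) : chartMeasure g x₀ = ((chartLebesgue I x₀).withDensity
    (fun y => ENNReal.ofReal (chartDensity g x₀ y))).map (chartSymm I x₀) :=
  Measure.map_congr ((withDensity_absolutelyContinuous _ _).ae_eq (chartSymm_ae_eq x₀).symm)

lemma chartMeasure_apply (x₀ : M) {A : Set M} (hA : MeasurableSet A) :
    chartMeasure g x₀ A = ∫⁻ y in (extChartAt I x₀).target ∩ chartSymm I x₀ ⁻¹' A,
      ENNReal.ofReal (chartDensity g x₀ y) ∂(Module.finBasis ℝ E).addHaar := by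
  rw [hg.chartMeasure_eq_map, Measure.map_apply (measurable_chartSymm x₀) hA,
    withDensity_apply _ (measurable_chartSymm x₀ hA), chartLebesgue,
    Measure.restrict_restrict (measurable_chartSymm x₀ hA), inter_comm]

lemma chartMeasure_compl_source (x₀ : M) : chartMeasure g x₀ (extChartAt I x₀).sourceᶜ = 0 := by
  rw [hg.chartMeasure_apply x₀ (measurableSet_source x₀).compl]
  have : (extChartAt I x₀).target ∩ chartSymm I x₀ ⁻¹' (extChartAt I x₀).sourceᶜ = ∅ := by
    ext y
    simp only [mem_inter_iff, mem_preimage, mem_compl_iff, mem_empty_iff_false, iff_false, not_and,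
      not_not]
    intro hy
    rw [chartSymm_eq hy]
    exact (extChartAt I x₀).map_target hy
  rw [this]
  simp

omit hg in
lemma sFinite_chartMeasure (g : MetricField I M) (x₀ : M) : SFinite (chartMeasure g x₀) := by
  unfold chartMeasure chartLebesgue
  infer_instance

/-- The derivative of a change of charts. -/
lemma hasFDerivAt_transition {x₀ x₁ : M} {y : E} (hy : y ∈ (extChartAt I x₁).target)
    (hy' : (extChartAt I x₁).symm y ∈ (extChartAt I x₀).source) :
    ∃ A : E →L[ℝ] E, HasFDerivAt (extChartAt I x₀ ∘ (extChartAt I x₁).symm) A y ∧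
      ∀ v : E, (dchart I x₁ y v : E) =
        (dchart I x₀ ((extChartAt I x₀) ((extChartAt I x₁).symm y)) (A v) : E) := by
  have h1 : MDifferentiableAt 𝓘(ℝ, E) 𝓘(ℝ, E) (extChartAt I x₀ ∘ (extChartAt I x₁).symm) y :=
    (mdifferentiableAt_extChartAt (by rwa [extChartAt_source] at hy')).comp y
      (mdifferentiableAt_chart_symm hy)
  refine ⟨fderiv ℝ (extChartAt I x₀ ∘ (extChartAt I x₁).symm) y,
    h1.differentiableAt.hasFDerivAt, fun v => ?_⟩
  have hev : (extChartAt I x₁).symm =ᶠ[𝓝 y]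
      (extChartAt I x₀).symm ∘ (extChartAt I x₀ ∘ (extChartAt I x₁).symm) := by
    have hc : ContinuousAt (extChartAt I x₁).symm y := continuousAt_extChartAt_symm'' hy
    filter_upwards [hc.preimage_mem_nhds ((isOpen_extChartAt_source x₀).mem_nhds hy')] with z hz
    exact ((extChartAt I x₀).left_inv hz).symm
  have h2 : mfderiv 𝓘(ℝ, E) I (extChartAt I x₁).symm y = mfderiv 𝓘(ℝ, E) I
      ((extChartAt I x₀).symm ∘ (extChartAt I x₀ ∘ (extChartAt I x₁).symm)) y :=
    hev.mfderiv_eq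
  have h3 := mfderiv_comp y (I' := 𝓘(ℝ, E)) (mdifferentiableAt_chart_symm
    (y := (extChartAt I x₀ ∘ (extChartAt I x₁).symm) y) ((extChartAt I x₀).map_source hy')) h1
  rw [mfderiv_eq_fderiv] at h3
  exact congrArg (fun L : E →L[ℝ] E => L v) (h2.trans h3)

lemma chartDensity_transition {x₀ x₁ : M} {y : E}
    (hy' : (extChartAt I x₁).symm y ∈ (extChartAt I x₀).source) {A : E →L[ℝ] E}
    (hA : ∀ v : E, (dchart I x₁ y v : E) =
        (dchart I x₀ ((extChartAt I x₀) ((extChartAt I x₁).symm y)) (A v) : E)) :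
    chartDensity g x₁ y =
      |A.det| * chartDensity g x₀ ((extChartAt I x₀) ((extChartAt I x₁).symm y)) := by
  set z := (extChartAt I x₀) ((extChartAt I x₁).symm y) with hz
  have hzy : (extChartAt I x₀).symm z = (extChartAt I x₁).symm y := (extChartAt I x₀).left_inv hy'
  have h1 : chartGram g (Module.finBasis ℝ E) x₁ y = gram (g ((extChartAt I x₀).symm z))
      fun i => dchart I x₀ z (A (Module.finBasis ℝ E i)) := by
    ext i j
    simp only [chartGram, gram, Matrix.of_apply]
    refine Eq.trans ?_ (metricField_congr g hzy _ _).symm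
    exact congrArg₂ (g ((extChartAt I x₁).symm y)) (hA _) (hA _)
  have h2 := det_gram_comp (hg.scalar ((extChartAt I x₀).symm z)) (Module.finBasis ℝ E)
    (dchart I x₀ z : E →ₗ[ℝ] TangentSpace I ((extChartAt I x₀).symm z)) (A : E →ₗ[ℝ] E)
  rw [chartDensity_eq, chartDensity_eq, h1]
  refine (congrArg Real.sqrt h2).trans ?_
  rw [Real.sqrt_mul (sq_nonneg _), Real.sqrt_sq_eq_abs]
  rfl

lemma chartMeasure_apply_eq {x₀ x₁ : M} {A : Set M} (hA : MeasurableSet A)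
    (h₀ : A ⊆ (extChartAt I x₀).source) (h₁ : A ⊆ (extChartAt I x₁).source) :
    chartMeasure g x₀ A = chartMeasure g x₁ A := by
  rw [hg.chartMeasure_apply x₀ hA, hg.chartMeasure_apply x₁ hA]
  set S := (extChartAt I x₁).target ∩ chartSymm I x₁ ⁻¹' A with hS
  have hSm : MeasurableSet S := (measurableSet_target x₁).inter (measurable_chartSymm x₁ hA)
  have hSy {y : E} (hy : y ∈ S) : (extChartAt I x₁).symm y ∈ A := by
    have := hy.2
    rwa [mem_preimage, chartSymm_eq hy.1] at this
  have himg : (extChartAt I x₀).target ∩ chartSymm I x₀ ⁻¹' A =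
      (extChartAt I x₀ ∘ (extChartAt I x₁).symm) '' S := by
    ext z
    constructor
    · rintro ⟨hz, hzA⟩
      rw [mem_preimage, chartSymm_eq hz] at hzA
      refine ⟨extChartAt I x₁ ((extChartAt I x₀).symm z),
        ⟨(extChartAt I x₁).map_source (h₁ hzA), ?_⟩, ?_⟩
      · rw [mem_preimage, chartSymm_eq ((extChartAt I x₁).map_source (h₁ hzA)),
          (extChartAt I x₁).left_inv (h₁ hzA)]
        exact hzA
      · rw [Function.comp_apply, (extChartAt I x₁).left_inv (h₁ hzA),
          (extChartAt I x₀).right_inv hz]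
    · rintro ⟨y, hy, rfl⟩
      have h := (extChartAt I x₀).map_source (h₀ (hSy hy))
      refine ⟨h, ?_⟩
      rw [mem_preimage, Function.comp_apply, chartSymm_eq h,
        (extChartAt I x₀).left_inv (h₀ (hSy hy))]
      exact hSy hy
  have hinj : InjOn (extChartAt I x₀ ∘ (extChartAt I x₁).symm) S := by
    intro y hy y' hy' h
    have h2 := (extChartAt I x₀).injOn (h₀ (hSy hy)) (h₀ (hSy hy')) h
    exact (extChartAt I x₁).symm.injOn hy.1 hy'.1 h2
  have hex : ∀ y : E, ∃ L : E →L[ℝ] E, y ∈ S →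
      HasFDerivAt (extChartAt I x₀ ∘ (extChartAt I x₁).symm) L y ∧
      chartDensity g x₁ y =
        |L.det| * chartDensity g x₀ ((extChartAt I x₀) ((extChartAt I x₁).symm y)) := by
    intro y
    by_cases hy : y ∈ S
    · obtain ⟨L, hL, hL'⟩ := hg.hasFDerivAt_transition hy.1 (h₀ (hSy hy))
      exact ⟨L, fun _ => ⟨hL, hg.chartDensity_transition (h₀ (hSy hy)) hL'⟩⟩
    · exact ⟨0, fun h => absurd h hy⟩
  choose L hL using hex
  rw [himg, lintegral_image_eq_lintegral_abs_det_fderiv_mul _ hSm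
    (fun y hy => (hL y hy).1.hasFDerivWithinAt) hinj]
  refine setLIntegral_congr_fun hSm fun y hy => ?_
  simp only [Function.comp_apply]
  rw [(hL y hy).2, ENNReal.ofReal_mul (abs_nonneg _)]

variable [SecondCountableTopology M]

lemma exists_restrict_eq_chartMeasure : ∃ ν : Measure M, SFinite ν ∧
    (∀ x₀, ν.restrict (extChartAt I x₀).source = chartMeasure g x₀) ∧ riemVolume g = ν := by
  obtain ⟨t, ht, hcov⟩ := TopologicalSpace.countable_cover_nhds
    (f := fun x : M => (extChartAt I x).source) fun x => extChartAt_source_mem_nhds x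
  obtain ⟨ν, h1, h2⟩ := exists_measure_restrict_eq (m := chartMeasure g)
    (U := fun x₀ : M => (extChartAt I x₀).source) measurableSet_source ht hcov
    (sFinite_chartMeasure g) hg.chartMeasure_compl_source
    fun i j A hA hi hj => hg.chartMeasure_apply_eq hA hi hj
  exact ⟨ν, h1, h2, iSup_measure_eq measurableSet_source ht hcov h2⟩

lemma sFinite_riemVolume : SFinite (riemVolume g) := by
  obtain ⟨ν, h1, -, h3⟩ := hg.exists_restrict_eq_chartMeasure
  rwa [h3]

/-- The Riemannian measure is given by the density in each chart. -/
lemma riemVolume_restrict (x₀ : M) :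
    (riemVolume g).restrict (extChartAt I x₀).source = chartMeasure g x₀ := by
  obtain ⟨ν, -, h2, h3⟩ := hg.exists_restrict_eq_chartMeasure
  rw [h3, h2]

end IsRiemMetric

end Volume


section Transfer

variable {E : Type*} [NormedAddCommGroup E] [NormedSpace ℝ E] [FiniteDimensional ℝ E]
  [MeasurableSpace E] [BorelSpace E]
  {H : Type*} [TopologicalSpace H] {I : ModelWithCorners ℝ E H} [I.Boundaryless]
  {M : Type*} [TopologicalSpace M] [ChartedSpace H M] [IsManifold I ∞ M]
  [MeasurableSpace M] [BorelSpace M] [SecondCountableTopology M]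

open Classical in
/-- A measurable map that coincides with the chart on its source. -/
def chartMap (I : ModelWithCorners ℝ E H) (x₀ : M) : M → E :=
  Set.piecewise (extChartAt I x₀).source (extChartAt I x₀) fun _ => 0

lemma measurable_chartMap (x₀ : M) : Measurable (chartMap I x₀) := by
  classical
  exact (continuousOn_extChartAt x₀).measurable_piecewise continuousOn_const
    (measurableSet_source x₀)

lemma chartMap_chartSymm {x₀ : M} {y : E} (hy : y ∈ (extChartAt I x₀).target) :
    chartMap I x₀ (chartSymm I x₀ y) = y := by
  rw [chartSymm_eq hy]
  exact (if_pos ((extChartAt I x₀).map_target hy)).trans ((extChartAt I x₀).right_inv hy)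

lemma chartSymm_chartMap {x₀ x : M} (hx : x ∈ (extChartAt I x₀).source) :
    chartSymm I x₀ (chartMap I x₀ x) = x := by
  have h : chartMap I x₀ x = extChartAt I x₀ x := if_pos hx
  rw [h, chartSymm_eq ((extChartAt I x₀).map_source hx), (extChartAt I x₀).left_inv hx]

lemma exists_countable_cover (I : ModelWithCorners ℝ E H) (M : Type*) [TopologicalSpace M]
    [ChartedSpace H M] [SecondCountableTopology M] :
    ∃ t : Set M, t.Countable ∧ ⋃ x ∈ t, (extChartAt I x).source = univ :=
  TopologicalSpace.countable_cover_nhds (f := fun x : M => (extChartAt I x).source)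
    fun x => extChartAt_source_mem_nhds x

namespace IsRiemMetric

variable {g : MetricField I M} (hg : IsRiemMetric g)
include hg

lemma ae_chart {P : M → Prop} (h : ∀ᵐ x ∂(riemVolume g), P x) (x₀ : M) :
    ∀ᵐ y ∂(chartLebesgue I x₀), P ((extChartAt I x₀).symm y) := by
  have h1 : ∀ᵐ x ∂(chartMeasure g x₀), P x := by
    rw [← hg.riemVolume_restrict]
    exact ae_restrict_of_ae h
  rw [hg.chartMeasure_eq_map] at h1
  have h2 := ae_of_ae_map (measurable_chartSymm x₀).aemeasurable h1
  rw [ae_withDensity_iff' (hg.aemeasurable_ofReal_chartDensity x₀)] at h2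
  filter_upwards [h2, ae_chartLebesgue_mem (I := I) x₀] with y hy hyt
  rw [← chartSymm_eq hyt]
  exact hy (ENNReal.ofReal_pos.2 (hg.chartDensity_pos hyt)).ne'

lemma map_chartMap (x₀ : M) : (chartMeasure g x₀).map (chartMap I x₀) =
    (chartLebesgue I x₀).withDensity fun y => ENNReal.ofReal (chartDensity g x₀ y) := by
  rw [hg.chartMeasure_eq_map, Measure.map_map (measurable_chartMap x₀) (measurable_chartSymm x₀)]
  conv_rhs => rw [← Measure.map_id (μ := (chartLebesgue I x₀).withDensity
    fun y => ENNReal.ofReal (chartDensity g x₀ y))]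
  refine Measure.map_congr ((withDensity_absolutelyContinuous _ _).ae_eq ?_)
  filter_upwards [ae_chartLebesgue_mem (I := I) x₀] with y hy using chartMap_chartSymm hy

lemma ae_of_chart {P : M → Prop}
    (h : ∀ x₀ : M, ∀ᵐ y ∂(chartLebesgue I x₀), P ((extChartAt I x₀).symm y)) :
    ∀ᵐ x ∂(riemVolume g), P x := by
  obtain ⟨t, ht, hcov⟩ := exists_countable_cover I M
  have h1 : ∀ᵐ x ∂(riemVolume g), ∀ x₀ ∈ t, x ∈ (extChartAt I x₀).source → P x := by
    refine (ae_ball_iff ht).2 fun x₀ _ => ?_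
    have h2 : ∀ᵐ y ∂((chartMeasure g x₀).map (chartMap I x₀)), P (chartSymm I x₀ y) := by
      rw [hg.map_chartMap]
      refine withDensity_absolutelyContinuous _ _ ?_
      filter_upwards [h x₀, chartSymm_ae_eq (I := I) x₀] with y hy hy' using by rwa [hy']
    have h3 := ae_of_ae_map (measurable_chartMap x₀).aemeasurable h2
    rw [← hg.riemVolume_restrict, ae_restrict_iff' (measurableSet_source x₀)] at h3
    filter_upwards [h3] with x hx hxs
    have := hx hxs
    rwa [chartSymm_chartMap hxs] at this
  filter_upwards [h1] with x hx
  obtain ⟨x₀, hx₀, hxs⟩ := mem_iUnion₂.1 (hcov.symm ▸ mem_univ x : x ∈ ⋃ x ∈ t, _)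
  exact hx x₀ hx₀ hxs

lemma aestronglyMeasurable_chartMeasure {F : Type*} [TopologicalSpace F]
    [TopologicalSpace.PseudoMetrizableSpace F] {f : M → F} {x₀ : M}
    (h : AEStronglyMeasurable (fun y => f ((extChartAt I x₀).symm y)) (chartLebesgue I x₀)) :
    AEStronglyMeasurable f (chartMeasure g x₀) := by
  have h1 : AEStronglyMeasurable (fun y => f (chartSymm I x₀ y)) (chartLebesgue I x₀) :=
    h.congr (by filter_upwards [chartSymm_ae_eq (I := I) x₀] with y hy using by rw [hy])
  have h2 := h1.mono_ac (withDensity_absolutelyContinuous (chartLebesgue I x₀)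
    fun y => ENNReal.ofReal (chartDensity g x₀ y))
  rw [← hg.map_chartMap] at h2
  refine (h2.comp_measurable (measurable_chartMap x₀)).congr ?_
  rw [← hg.riemVolume_restrict]
  filter_upwards [ae_restrict_mem (measurableSet_source x₀)] with x hx
  rw [Function.comp_apply, chartSymm_chartMap hx]

lemma aestronglyMeasurable_of_chart {F : Type*} [TopologicalSpace F]
    [TopologicalSpace.PseudoMetrizableSpace F] {f : M → F}
    (h : ∀ x₀ : M, AEStronglyMeasurable (fun y => f ((extChartAt I x₀).symm y))
      (chartLebesgue I x₀)) : AEStronglyMeasurable f (riemVolume g) := by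
  obtain ⟨t, ht, hcov⟩ := exists_countable_cover I M
  have : Countable t := ht.to_subtype
  have h1 : AEStronglyMeasurable f
      ((riemVolume g).restrict (⋃ x : t, (extChartAt I (x : M)).source)) := by
    refine AEStronglyMeasurable.iUnion fun x => ?_
    rw [hg.riemVolume_restrict]
    exact hg.aestronglyMeasurable_chartMeasure (h x)
  rwa [iUnion_coe_set, hcov, Measure.restrict_univ] at h1

/-- The integral of a function that vanishes outside of the domain of a chart. -/
lemma integral_riemVolume_eq {f : M → ℝ} (hf : AEStronglyMeasurable f (riemVolume g)) {x₀ : M}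
    (h0 : ∀ x, x ∉ (extChartAt I x₀).source → f x = 0) :
    ∫ x, f x ∂(riemVolume g) =
      ∫ y, chartDensity g x₀ y * f ((extChartAt I x₀).symm y) ∂(chartLebesgue I x₀) := by
  rw [← setIntegral_eq_integral_of_forall_compl_eq_zero h0, hg.riemVolume_restrict,
    hg.chartMeasure_eq_map, integral_map (measurable_chartSymm x₀).aemeasurable ?_,
    integral_withDensity_eq_integral_toReal_smul₀ (hg.aemeasurable_ofReal_chartDensity x₀)
      (by simp)]
  · refine integral_congr_ae ?_
    filter_upwards [chartSymm_ae_eq (I := I) x₀, ae_chartLebesgue_mem (I := I) x₀] with y hy hyt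
    rw [hy, ENNReal.toReal_ofReal (hg.chartDensity_pos hyt).le, smul_eq_mul]
  · rw [← hg.chartMeasure_eq_map, ← hg.riemVolume_restrict]
    exact hf.restrict

/-- The entries of the inverse Gram matrix are continuous. -/
lemma continuousOn_chartGram_inv (x₀ : M) (i j : Fin (Module.finrank ℝ E)) :
    ContinuousOn (fun y => (chartGram g (Module.finBasis ℝ E) x₀ y)⁻¹ i j)
      (extChartAt I x₀).target := by
  have h1 := hg.continuousOn_chartGram (Module.finBasis ℝ E) x₀
  have h2 : ContinuousOn (fun y => (chartGram g (Module.finBasis ℝ E) x₀ y).det)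
      (extChartAt I x₀).target := (Continuous.matrix_det continuous_id).comp_continuousOn h1
  have h3 : ContinuousOn (fun y => (chartGram g (Module.finBasis ℝ E) x₀ y).adjugate i j)
      (extChartAt I x₀).target :=
    ((Continuous.matrix_adjugate continuous_id).matrix_elem i j).comp_continuousOn h1
  refine ((h2.inv₀ fun y hy => (hg.det_chartGram_pos _ hy).ne').mul h3).congr fun y hy => ?_
  simp [Matrix.inv_def]

/-- The coefficients of a form are measurable in the charts. -/
lemma aestronglyMeasurable_formNorm {k : ℕ} {θ : DiffForm I M k}
    (h : ∀ (x₀ : M) (v : Fin k → E),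
      AEStronglyMeasurable (fun y => inChart x₀ θ y v) (chartLebesgue I x₀)) :
    AEStronglyMeasurable (fun x => formNorm (V := TangentSpace I x) (g x) (θ x)) (riemVolume g) := by
  refine hg.aestronglyMeasurable_of_chart fun x₀ => ?_
  refine AEStronglyMeasurable.congr ?_ (f := fun y =>
    √((∑ S : Fin k → Fin (Module.finrank ℝ E), ∑ T : Fin k → Fin (Module.finrank ℝ E),
      (∏ a, (chartGram g (Module.finBasis ℝ E) x₀ y)⁻¹ (S a) (T a)) *
        (inChart x₀ θ y (fun i => Module.finBasis ℝ E (S i)) *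
          inChart x₀ θ y (fun i => Module.finBasis ℝ E (T i)))) / (k.factorial : ℝ))) ?_
  · refine (Real.continuous_sqrt.comp_aestronglyMeasurable ?_)
    simp only [div_eq_mul_inv]
    refine AEStronglyMeasurable.mul_const ?_ _
    refine Finset.aestronglyMeasurable_fun_sum _ fun S _ =>
      Finset.aestronglyMeasurable_fun_sum _ fun T _ => ?_
    refine AEStronglyMeasurable.mul (Finset.aestronglyMeasurable_fun_prod _ fun a _ => ?_)
      ((h _ _).mul (h _ _))
    exact (hg.continuousOn_chartGram_inv x₀ _ _).aestronglyMeasurable (measurableSet_target x₀)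
  · filter_upwards [ae_chartLebesgue_mem (I := I) x₀] with y hy
    exact (hg.formNorm_chart θ hy).symm

lemma exists_restrict_le_smul {x₀ : M} {K : Set E} (hK : IsCompact K)
    (hKt : K ⊆ (extChartAt I x₀).target) :
    ∃ c : ℝ≥0∞, c ≠ ⊤ ∧ (Module.finBasis ℝ E).addHaar.restrict K ≤
      c • (chartLebesgue I x₀).withDensity fun y => ENNReal.ofReal (chartDensity g x₀ y) := by
  rcases K.eq_empty_or_nonempty with rfl | hne
  · exact ⟨0, by simp, by simp⟩
  obtain ⟨y₀, hy₀, hmin⟩ := hK.exists_isMinOn hne ((hg.continuousOn_chartDensity x₀).mono hKt)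
  have hc : 0 < chartDensity g x₀ y₀ := hg.chartDensity_pos (hKt hy₀)
  refine ⟨(ENNReal.ofReal (chartDensity g x₀ y₀))⁻¹, by simpa using hc, Measure.le_iff.2
    fun s hs => ?_⟩
  rw [Measure.smul_apply, withDensity_apply _ hs, chartLebesgue, Measure.restrict_restrict hs,
    Measure.restrict_apply hs, smul_eq_mul, mul_comm, ← div_eq_mul_inv, ENNReal.le_div_iff_mul_le
      (Or.inl (by simpa using hc)) (Or.inl (by simp)), mul_comm]
  calc ENNReal.ofReal (chartDensity g x₀ y₀) * (Module.finBasis ℝ E).addHaar (s ∩ K)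
      = ∫⁻ _ in s ∩ K, ENNReal.ofReal (chartDensity g x₀ y₀) ∂(Module.finBasis ℝ E).addHaar := by
        rw [setLIntegral_const]
    _ ≤ ∫⁻ y in s ∩ K, ENNReal.ofReal (chartDensity g x₀ y) ∂(Module.finBasis ℝ E).addHaar :=
        setLIntegral_mono' (hs.inter hK.measurableSet) fun y hy =>
          ENNReal.ofReal_le_ofReal (hmin hy.2)
    _ ≤ _ := lintegral_mono_set (inter_subset_inter_right _ hKt)

lemma memLp_formNorm {p : ℝ} {k : ℕ} {θ : DiffForm I M k} (hθ : IsLpForm g p θ) :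
    MemLp (fun x => formNorm (V := TangentSpace I x) (g x) (θ x)) (ENNReal.ofReal p)
      (riemVolume g) := ⟨hg.aestronglyMeasurable_formNorm hθ.1, hθ.2⟩

/-- The coefficients of an `L^p` form in a chart are locally `L^p`. -/
lemma memLp_inChart {p : ℝ} {k : ℕ} {θ : DiffForm I M k} (hθ : IsLpForm g p θ) {x₀ : M}
    {K : Set E} (hK : IsCompact K) (hKt : K ⊆ (extChartAt I x₀).target) (v : Fin k → E) :
    MemLp (fun y => inChart x₀ θ y v) (ENNReal.ofReal p)
      ((Module.finBasis ℝ E).addHaar.restrict K) := by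
  have h1 : MemLp (fun x => formNorm (V := TangentSpace I x) (g x) (θ x)) (ENNReal.ofReal p)
      (chartMeasure g x₀) := by
    rw [← hg.riemVolume_restrict]
    exact (hg.memLp_formNorm hθ).restrict _
  rw [hg.chartMeasure_eq_map] at h1
  have h2 := (memLp_map_measure_iff h1.1 (measurable_chartSymm x₀).aemeasurable).1 h1
  obtain ⟨c, hc, hle⟩ := hg.exists_restrict_le_smul hK hKt
  have h3 := h2.of_measure_le_smul hc hle
  have hcont : ContinuousOn (fun y => (Module.finrank ℝ E : ℝ) ^ k * √(k.factorial : ℝ) *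
      (∏ i, √(g ((extChartAt I x₀).symm y) (dchart I x₀ y (v i)) (dchart I x₀ y (v i))))) K := by
    refine continuousOn_const.mul (continuousOn_finsetProd _ fun i _ => ?_)
    exact Real.continuous_sqrt.comp_continuousOn ((hg.continuousOn x₀ _ _).mono hKt)
  obtain ⟨C, hC⟩ := hK.exists_bound_of_continuousOn hcont
  refine h3.of_le_mul (c := C) ((hθ.1 x₀ v).mono_measure (Measure.restrict_mono hKt le_rfl)) ?_
  filter_upwards [ae_restrict_mem hK.measurableSet] with y hy
  simp only [Function.comp_apply]
  rw [chartSymm_eq (hKt hy)]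
  refine (hg.abs_inChart_le θ x₀ y v).trans ?_
  have h4 := (hg.scalar ((extChartAt I x₀).symm y)).formNorm_nonneg (θ ((extChartAt I x₀).symm y))
  rw [Real.norm_of_nonneg h4]
  exact mul_le_mul_of_nonneg_right ((Real.le_norm_self _).trans (hC y hy)) h4

end IsRiemMetric

end Transfer


section DiagonalKernel

variable {E : Type*} [NormedAddCommGroup E] [NormedSpace ℝ E] [FiniteDimensional ℝ E]
  [MeasurableSpace E] [BorelSpace E] {μ : Measure E} [μ.IsAddHaarMeasure]

/-- A kernel that is integrable, and whose integral over the translates of the diagonal makes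
sense and depends continuously on the translation. -/
def IsDiagKernel (μ : Measure E) (B : E → E → ℝ) : Prop :=
  Integrable (fun z : E × E => B z.1 z.2) (μ.prod μ) ∧
    (∀ z, Integrable (fun y => B (y + z) y) μ) ∧ Continuous fun z => ∫ y, B (y + z) y ∂μ

namespace IsDiagKernel

lemma add {B B' : E → E → ℝ} (h : IsDiagKernel μ B) (h' : IsDiagKernel μ B') :
    IsDiagKernel μ fun x y => B x y + B' x y := by
  refine ⟨h.1.add h'.1, fun z => (h.2.1 z).add (h'.2.1 z), ?_⟩
  simp only [integral_add (h.2.1 _) (h'.2.1 _)]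
  exact h.2.2.add h'.2.2

lemma const_mul {B : E → E → ℝ} (h : IsDiagKernel μ B) (c : ℝ) :
    IsDiagKernel μ fun x y => c * B x y := by
  refine ⟨h.1.const_mul c, fun z => (h.2.1 z).const_mul c, ?_⟩
  simp only [integral_const_mul]
  exact h.2.2.const_mul c

lemma sum {ι : Type*} (s : Finset ι) {B : ι → E → E → ℝ} (h : ∀ i ∈ s, IsDiagKernel μ (B i)) :
    IsDiagKernel μ fun x y => ∑ i ∈ s, B i x y := by
  refine ⟨integrable_finsetSum s fun i hi => (h i hi).1,
    fun z => integrable_finsetSum s fun i hi => (h i hi).2.1 z, ?_⟩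
  have : (fun z => ∫ y, ∑ i ∈ s, B i (y + z) y ∂μ) =
      fun z => ∑ i ∈ s, ∫ y, B i (y + z) y ∂μ := by
    funext z
    exact integral_finsetSum s fun i hi => (h i hi).2.1 z
  rw [this]
  exact continuous_finsetSum s fun i hi => (h i hi).2.2

lemma mul {p q : ℝ≥0∞} [hpq : ENNReal.HolderConjugate p q] (hp : p ≠ ⊤) {f h : E → ℝ}
    (hf : MemLp f p μ) (hf1 : Integrable f μ) (hh : MemLp h q μ) (hh1 : Integrable h μ) :
    IsDiagKernel μ fun x y => f x * h y := by
  have hsub (z : E) : MeasurePreserving (fun y => y + z) μ μ := measurePreserving_add_right μ z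
  have : Fact (1 ≤ p) := ⟨hpq.one_le⟩
  have : Fact (1 ≤ q) := ⟨hpq.symm.one_le⟩
  refine ⟨hf1.mul_prod hh1, fun z =>
    (hh.comp_measurePreserving (MeasurePreserving.id μ)).integrable_mul
      (hf.comp_measurePreserving (hsub z)) |>.congr (by
        filter_upwards with y using by simp [mul_comm]), ?_⟩
  let T (z : E) : C(E, E) := ⟨fun y => y + z, by fun_prop⟩
  have hT : Continuous T := ContinuousMap.continuous_of_continuous_uncurry _ (by
    simp only [T, Function.uncurry_def, ContinuousMap.coe_mk]; fun_prop)
  have h1 : Continuous fun z => Lp.compMeasurePreserving (T z) (hsub z) (hf.toLp f) :=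
    continuous_const.compMeasurePreservingLp hT hsub hp
  have h2 : Continuous fun z => (ContinuousLinearMap.mul ℝ ℝ).lpPairing μ p q
      (Lp.compMeasurePreserving (T z) (hsub z) (hf.toLp f)) (hh.toLp h) :=
    (((ContinuousLinearMap.mul ℝ ℝ).lpPairing μ p q).flip (hh.toLp h)).continuous.comp h1
  convert h2 using 2 with z
  rw [ContinuousLinearMap.lpPairing_eq_integral]
  refine integral_congr_ae ?_
  have h3 := Lp.coeFn_compMeasurePreserving (hf.toLp f) (hsub z)
  have h4 := (hsub z).quasiMeasurePreserving.ae_eq_comp hf.coeFn_toLp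
  filter_upwards [h3, h4, hh.coeFn_toLp] with y hy hy' hy''
  have h5 : (Lp.compMeasurePreserving (T z) (hsub z) (hf.toLp f) : E → ℝ) y = f (y + z) :=
    hy.trans hy'
  rw [h5, hy'', ContinuousLinearMap.mul_apply']

/-- If a kernel vanishes near the diagonal in the sense of convolutions, then its integral over
the diagonal is zero. -/
lemma integral_diag_eq_zero {B : E → E → ℝ} (hB : IsDiagKernel μ B) {r : ℝ} (hr : 0 < r)
    (h : ∀ ρ : E → ℝ, ContDiff ℝ ∞ ρ → HasCompactSupport ρ → tsupport ρ ⊆ Metric.ball 0 r →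
      ∫ z : E × E, ρ (z.1 - z.2) * B z.1 z.2 ∂(μ.prod μ) = 0) : ∫ y, B y y ∂μ = 0 := by
  have hmp : MeasurePreserving (fun z : E × E => (z.2 + z.1, z.2)) (μ.prod μ) (μ.prod μ) := by
    have h1 := (measurePreserving_prod_add μ μ)
    have h2 := (Measure.measurePreserving_swap (μ := μ) (ν := μ)).comp
      (h1.comp (Measure.measurePreserving_swap (μ := μ) (ν := μ)))
    exact h2
  have hae : ∀ᵐ z ∂μ, z ∈ Metric.ball (0 : E) r → ∫ y, B (y + z) y ∂μ = 0 := by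
    refine Metric.isOpen_ball.ae_eq_zero_of_integral_contDiff_smul_eq_zero
      (hB.2.2.locallyIntegrable.locallyIntegrableOn _) fun ρ h1 h2 h3 => ?_
    rw [← h ρ h1 h2 h3]
    obtain ⟨C, hC⟩ := h1.continuous.bounded_above_of_compact_support h2
    have hint : Integrable (fun z : E × E => ρ (z.1 - z.2) * B z.1 z.2) (μ.prod μ) :=
      hB.1.bdd_mul (c := C)
        (h1.continuous.comp (continuous_fst.sub continuous_snd)).aestronglyMeasurable
        (Eventually.of_forall fun z => hC _)
    have h4 := hmp.integrable_comp_of_integrable hint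
    have h5 : ∫ z : E × E, ρ (z.1 - z.2) * B z.1 z.2 ∂(μ.prod μ) =
        ∫ z : E × E, ρ z.1 * B (z.2 + z.1) z.2 ∂(μ.prod μ) := by
      have h6 : AEStronglyMeasurable (fun z : E × E => ρ (z.1 - z.2) * B z.1 z.2)
          ((μ.prod μ).map (fun z : E × E => (z.2 + z.1, z.2))) := by
        rw [hmp.map_eq]; exact hint.1
      conv_lhs => rw [← hmp.map_eq]
      rw [integral_map hmp.measurable.aemeasurable h6]
      simp
    rw [h5, integral_prod]
    · simp [integral_const_mul]
    · simpa [Function.comp_def] using h4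
  have := Measure.eqOn_open_of_ae_eq (μ := μ) (U := Metric.ball (0 : E) r)
    ((ae_restrict_iff' measurableSet_ball).2 hae) Metric.isOpen_ball
    hB.2.2.continuousOn continuousOn_const (Metric.mem_ball_self hr)
  simpa using this

end IsDiagKernel

end DiagonalKernel

lemma wedge_smul_left {V : Type*} [AddCommGroup V] [Module ℝ V] {k l : ℕ} (c : ℝ)
    (α : V [⋀^Fin k]→ₗ[ℝ] ℝ) (β : V [⋀^Fin l]→ₗ[ℝ] ℝ) : wedge (c • α) β = c • wedge α β := by
  ext v
  simp only [wedge_apply, AlternatingMap.smul_apply, smul_eq_mul, Finset.mul_sum]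
  exact Finset.sum_congr rfl fun σ _ => by ring

lemma wedge_smul_right {V : Type*} [AddCommGroup V] [Module ℝ V] {k l : ℕ} (c : ℝ)
    (α : V [⋀^Fin k]→ₗ[ℝ] ℝ) (β : V [⋀^Fin l]→ₗ[ℝ] ℝ) : wedge α (c • β) = c • wedge α β := by
  ext v
  simp only [wedge_apply, AlternatingMap.smul_apply, smul_eq_mul, Finset.mul_sum]
  exact Finset.sum_congr rfl fun σ _ => by ring

lemma wedge_neg_left {V : Type*} [AddCommGroup V] [Module ℝ V] {k l : ℕ}
    (α : V [⋀^Fin k]→ₗ[ℝ] ℝ) (β : V [⋀^Fin l]→ₗ[ℝ] ℝ) : wedge (-α) β = -wedge α β := by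
  ext v
  simp [wedge_apply]

lemma wedge_add_right {V : Type*} [AddCommGroup V] [Module ℝ V] {k l : ℕ}
    (α : V [⋀^Fin k]→ₗ[ℝ] ℝ) (β β' : V [⋀^Fin l]→ₗ[ℝ] ℝ) :
    wedge α (β + β') = wedge α β + wedge α β' := by
  ext v
  simp only [wedge_apply, AlternatingMap.add_apply, ← Finset.sum_add_distrib]
  exact Finset.sum_congr rfl fun σ _ => by ring

section LocalLeibniz

variable {E : Type*} [NormedAddCommGroup E] [NormedSpace ℝ E]
  [MeasurableSpace E] (μ : Measure E) (U : Set E)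

/-- `dθ = η` in the sense of distributions, for forms on the open set `U`. -/
def IsLocalWeakDeriv {k : ℕ} (θ : E → E [⋀^Fin k]→ₗ[ℝ] ℝ) (η : E → E [⋀^Fin (k + 1)]→ₗ[ℝ] ℝ) :
    Prop :=
  ∀ φ : E → ℝ, ContDiff ℝ ∞ φ → HasCompactSupport φ → tsupport φ ⊆ U → ∀ v : Fin (k + 1) → E,
    ∫ y, φ y * η y v ∂μ = -∫ y, lwedge (fderiv ℝ φ y).toLinearMap (θ y) v ∂μ

/-- Forms on `U` whose coefficients are locally `L^p`. -/
def IsLocLp (p : ℝ≥0∞) {k : ℕ} (θ : E → E [⋀^Fin k]→ₗ[ℝ] ℝ) : Prop :=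
  ∀ K : Set E, IsCompact K → K ⊆ U → ∀ v, MemLp (fun y => θ y v) p (μ.restrict K)

variable {μ U}

lemma integral_wedge_left {k l : ℕ} {F : E → E [⋀^Fin k]→ₗ[ℝ] ℝ}
    (hF : ∀ w, Integrable (fun x => F x w) μ) (B : E [⋀^Fin l]→ₗ[ℝ] ℝ) (v : Fin (k + l) → E) :
    ∫ x, wedge (F x) B v ∂μ = ∑ σ : Equiv.Perm (Fin (k + l)),
      ((Equiv.Perm.sign σ : ℤ) : ℝ) / (k.factorial * l.factorial) *
        ((∫ x, F x (fun i => v (σ (Fin.castAdd l i))) ∂μ) *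
          B (fun j => v (σ (Fin.natAdd k j)))) := by
  simp only [wedge_apply]
  rw [integral_finsetSum _ fun σ _ => ((hF _).mul_const _).const_mul _]
  simp only [integral_const_mul, integral_mul_const]

lemma integral_wedge_right {k l : ℕ} {F : E → E [⋀^Fin l]→ₗ[ℝ] ℝ}
    (hF : ∀ w, Integrable (fun x => F x w) μ) (B : E [⋀^Fin k]→ₗ[ℝ] ℝ) (v : Fin (k + l) → E) :
    ∫ x, wedge B (F x) v ∂μ = ∑ σ : Equiv.Perm (Fin (k + l)),
      ((Equiv.Perm.sign σ : ℤ) : ℝ) / (k.factorial * l.factorial) *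
        (B (fun i => v (σ (Fin.castAdd l i))) *
          (∫ x, F x (fun j => v (σ (Fin.natAdd k j))) ∂μ)) := by
  simp only [wedge_apply]
  rw [integral_finsetSum _ fun σ _ => ((hF _).const_mul _).const_mul _]
  simp only [integral_const_mul]

lemma integral_wedge_left_congr {k l : ℕ} {F G : E → E [⋀^Fin k]→ₗ[ℝ] ℝ}
    (hF : ∀ w, Integrable (fun x => F x w) μ) (hG : ∀ w, Integrable (fun x => G x w) μ)
    (h : ∀ w, ∫ x, F x w ∂μ = ∫ x, G x w ∂μ) (B : E [⋀^Fin l]→ₗ[ℝ] ℝ) (v : Fin (k + l) → E) :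
    ∫ x, wedge (F x) B v ∂μ = ∫ x, wedge (G x) B v ∂μ := by
  rw [integral_wedge_left hF, integral_wedge_left hG]
  simp only [h]

lemma integral_wedge_right_congr {k l : ℕ} {F G : E → E [⋀^Fin l]→ₗ[ℝ] ℝ}
    (hF : ∀ w, Integrable (fun x => F x w) μ) (hG : ∀ w, Integrable (fun x => G x w) μ)
    (h : ∀ w, ∫ x, F x w ∂μ = ∫ x, G x w ∂μ) (B : E [⋀^Fin k]→ₗ[ℝ] ℝ) (v : Fin (k + l) → E) :
    ∫ x, wedge B (F x) v ∂μ = ∫ x, wedge B (G x) v ∂μ := by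
  rw [integral_wedge_right hF, integral_wedge_right hG]
  simp only [h]

variable [FiniteDimensional ℝ E] [BorelSpace E] [μ.IsAddHaarMeasure]

lemma isDiagKernel_wedge {p q : ℝ≥0∞} [hpq : ENNReal.HolderConjugate p q] (hp : p ≠ ⊤)
    {k l : ℕ} {F : E → E [⋀^Fin k]→ₗ[ℝ] ℝ} {G : E → E [⋀^Fin l]→ₗ[ℝ] ℝ}
    (hF : ∀ w, MemLp (fun x => F x w) p μ ∧ Integrable (fun x => F x w) μ)
    (hG : ∀ w, MemLp (fun x => G x w) q μ ∧ Integrable (fun x => G x w) μ)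
    (v : Fin (k + l) → E) : IsDiagKernel μ fun x y => wedge (F x) (G y) v := by
  simp only [wedge_apply]
  exact IsDiagKernel.sum _ fun σ _ => (IsDiagKernel.mul (p := p) (q := q) hp
    (hF _).1 (hF _).2 (hG _).1 (hG _).2).const_mul _

lemma bounded_fderiv_apply {φ : E → ℝ} (h : ContDiff ℝ ∞ φ) (hc : HasCompactSupport φ) (w : E) :
    (Continuous fun y => fderiv ℝ φ y w) ∧ ∃ C, ∀ y, ‖fderiv ℝ φ y w‖ ≤ C := by
  have h1 : Continuous fun y => fderiv ℝ φ y w :=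
    (h.continuous_fderiv (by simp)).clm_apply continuous_const
  exact ⟨h1, h1.bounded_above_of_compact_support
    ((hc.fderiv (𝕜 := ℝ)).mono' fun y hy => subset_tsupport _ fun h0 => hy (by simp [h0]))⟩

lemma fderiv_const_sub_comp {ρ : E → ℝ} (hρ : ContDiff ℝ ∞ ρ) {x y : E} :
    fderiv ℝ (fun y => ρ (x - y)) y = -fderiv ℝ ρ (x - y) := by
  have h1 : HasFDerivAt ρ (fderiv ℝ ρ (x - y)) (x - y) :=
    (hρ.differentiable (by simp) _).hasFDerivAt
  have h2 := h1.comp y ((hasFDerivAt_id y).const_sub x)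
  rw [HasFDerivAt.fderiv (f := fun y => ρ (x - y)) h2]
  ext w
  simp

set_option maxHeartbeats 800000 in
/-- The Leibniz rule for the distributional exterior derivative of `β ∧ γ`, where `β` and `dβ`
are locally `L^p`, and `γ` and `dγ` are locally `L^q` for the conjugate exponent. -/
theorem IsLocalWeakDeriv.wedge {p q : ℝ≥0∞} [hpq : ENNReal.HolderConjugate p q] (hp : p ≠ ⊤)
    (hU : IsOpen U) {k l : ℕ} {β : E → E [⋀^Fin k]→ₗ[ℝ] ℝ} {θ : E → E [⋀^Fin (k + 1)]→ₗ[ℝ] ℝ}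
    {γ : E → E [⋀^Fin l]→ₗ[ℝ] ℝ} {η : E → E [⋀^Fin (l + 1)]→ₗ[ℝ] ℝ}
    (hβ : IsLocLp μ U p β) (hθ : IsLocLp μ U p θ) (hγ : IsLocLp μ U q γ) (hη : IsLocLp μ U q η)
    (hd : IsLocalWeakDeriv μ U β θ) (hd' : IsLocalWeakDeriv μ U γ η)
    (h : k + 1 + l = k + l + 1) {ε : ℝ}
    (hε : ∀ (ℓ : E →ₗ[ℝ] ℝ) (b : E [⋀^Fin k]→ₗ[ℝ] ℝ) (c : E [⋀^Fin l]→ₗ[ℝ] ℝ),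
      lwedge ℓ (LpForms.wedge b c) = ε • LpForms.wedge b (lwedge ℓ c)) :
    IsLocalWeakDeriv μ U (fun y => LpForms.wedge (β y) (γ y))
      (fun y => castDeg h (LpForms.wedge (θ y) (γ y)) + ε • LpForms.wedge (β y) (η y)) := by
  intro φ hφ hφc hφU v
  obtain ⟨r, hr, hrU⟩ := hφc.isCompact.exists_cthickening_subset_open hU hφU
  set K := Metric.cthickening r (tsupport φ) with hKdef
  have hK : IsCompact K := hφc.isCompact.cthickening
  have hφK : tsupport φ ⊆ K := Metric.self_subset_cthickening _
  have hKm : MeasurableSet K := hK.isClosed.measurableSet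
  have : IsFiniteMeasure (μ.restrict K) := ⟨by simpa using hK.measure_lt_top⟩
  -- the forms extended by zero outside of `K`
  have key : ∀ {m : ℕ} {s : ℝ≥0∞} {F : E → E [⋀^Fin m]→ₗ[ℝ] ℝ}, 1 ≤ s → IsLocLp μ U s F → ∀ w,
      MemLp (fun x => K.indicator F x w) s μ ∧ Integrable (fun x => K.indicator F x w) μ := by
    intro m s F hs hF w
    have h1 : (fun x => K.indicator F x w) = K.indicator fun x => F x w := by
      funext x
      by_cases hx : x ∈ K <;> simp [hx]
    rw [h1]
    exact ⟨(memLp_indicator_iff_restrict hKm).2 (hF K hK hrU w),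
      (integrable_indicator_iff hKm).2 ((hF K hK hrU w).integrable hs)⟩
  have key2 : ∀ {m : ℕ} {ψ : E → ℝ} {F : E → E [⋀^Fin m]→ₗ[ℝ] ℝ}, tsupport ψ ⊆ K → ∀ w,
      ∫ y, ψ y * K.indicator F y w ∂μ = ∫ y, ψ y * F y w ∂μ := by
    intro m ψ F hψ w
    refine integral_congr_ae (Eventually.of_forall fun y => ?_)
    by_cases hy : y ∈ K
    · simp [hy]
    · simp [image_eq_zero_of_notMem_tsupport fun h => hy (hψ h)]
  have key3 : ∀ {m : ℕ} {ψ : E → ℝ} {F : E → E [⋀^Fin m]→ₗ[ℝ] ℝ}, tsupport ψ ⊆ K → ∀ w,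
      ∫ y, lwedge (fderiv ℝ ψ y).toLinearMap (K.indicator F y) w ∂μ =
        ∫ y, lwedge (fderiv ℝ ψ y).toLinearMap (F y) w ∂μ := by
    intro m ψ F hψ w
    refine integral_congr_ae (Eventually.of_forall fun y => ?_)
    by_cases hy : y ∈ K
    · simp [hy]
    · simp [lwedge_apply, image_eq_zero_of_notMem_tsupport
        (fun h => hy (hψ (tsupport_fderiv_subset ℝ h)))]
  set β' := K.indicator β with hβ'
  set θ' := K.indicator θ with hθ'
  set γ' := K.indicator γ with hγ'
  set η' := K.indicator η with hη'
  have gβ : ∀ w, MemLp (fun x => β' x w) p μ ∧ Integrable (fun x => β' x w) μ :=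
    key hpq.one_le hβ
  have gθ : ∀ w, MemLp (fun x => θ' x w) p μ ∧ Integrable (fun x => θ' x w) μ :=
    key hpq.one_le hθ
  have gγ : ∀ w, MemLp (fun x => γ' x w) q μ ∧ Integrable (fun x => γ' x w) μ :=
    key hpq.symm.one_le hγ
  have gη : ∀ w, MemLp (fun x => η' x w) q μ ∧ Integrable (fun x => η' x w) μ :=
    key hpq.symm.one_le hη
  have key4 : ∀ {s : ℝ≥0∞} {ψ f : E → ℝ} {C : ℝ}, Continuous ψ → (∀ y, ‖ψ y‖ ≤ C) →
      (MemLp f s μ ∧ Integrable f μ) →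
      MemLp (fun y => ψ y * f y) s μ ∧ Integrable (fun y => ψ y * f y) μ := by
    intro s ψ f C hψ hC hf
    refine ⟨hf.1.of_le_mul (c := C) (hψ.aestronglyMeasurable.mul hf.1.1)
      (Eventually.of_forall fun y => ?_), hf.2.bdd_mul (c := C) hψ.aestronglyMeasurable
        (Eventually.of_forall hC)⟩
    rw [norm_mul]
    gcongr
    exact hC y
  obtain ⟨Cφ, hCφ⟩ := hφ.continuous.bounded_above_of_compact_support hφc
  set G₁ : E → E [⋀^Fin l]→ₗ[ℝ] ℝ := fun y => φ y • γ' y with hG₁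
  set G₂ : E → E [⋀^Fin (l + 1)]→ₗ[ℝ] ℝ := fun y => φ y • η' y with hG₂
  set G₃ : E → E [⋀^Fin (l + 1)]→ₗ[ℝ] ℝ := fun y => lwedge (fderiv ℝ φ y).toLinearMap (γ' y)
    with hG₃
  have gG₁ : ∀ w, MemLp (fun x => G₁ x w) q μ ∧ Integrable (fun x => G₁ x w) μ :=
    fun w => key4 hφ.continuous hCφ (gγ w)
  have gG₂ : ∀ w, MemLp (fun x => G₂ x w) q μ ∧ Integrable (fun x => G₂ x w) μ :=
    fun w => key4 hφ.continuous hCφ (gη w)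
  have gG₃ : ∀ w, MemLp (fun x => G₃ x w) q μ ∧ Integrable (fun x => G₃ x w) μ := by
    intro w
    have h1 : ∀ i, MemLp (fun y => fderiv ℝ φ y (w i) * γ' y (fun j => w (i.succAbove j))) q μ ∧
        Integrable (fun y => fderiv ℝ φ y (w i) * γ' y (fun j => w (i.succAbove j))) μ :=
      fun i => (key4 (bounded_fderiv_apply hφ hφc (w i)).1
        (bounded_fderiv_apply hφ hφc (w i)).2.choose_spec (gγ _))
    simp only [hG₃, lwedge_apply]
    exact ⟨memLp_finsetSum _ fun i _ => (h1 i).1.const_mul _,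
      integrable_finsetSum _ fun i _ => (h1 i).2.const_mul _⟩
  set v' : Fin (k + 1 + l) → E := fun i => v (Fin.cast h i) with hv'
  have hB₁ := isDiagKernel_wedge (p := p) (q := q) hp gθ gG₁ v'
  have hB₂ := isDiagKernel_wedge (p := p) (q := q) hp gβ gG₂ v
  have hB₃ := isDiagKernel_wedge (p := p) (q := q) hp gβ gG₃ v
  have hB₂₃ := hB₂.add hB₃
  have hB := hB₁.add (hB₂₃.const_mul ε)
  have hzero := hB.integral_diag_eq_zero hr fun ρ hρ hρc hρr => ?_
  · rw [eq_neg_iff_add_eq_zero, ← hzero, ← integral_add]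
    · refine integral_congr_ae (Eventually.of_forall fun y => ?_)
      by_cases hy : y ∈ K
      · have e1 : lwedge (fderiv ℝ φ y).toLinearMap (LpForms.wedge (β y) (γ y)) v =
            ε * LpForms.wedge (β y) (lwedge (fderiv ℝ φ y).toLinearMap (γ y)) v := by
          rw [hε]; rfl
        simp only [hG₁, hG₂, hG₃, hβ', hθ', hγ', hη', indicator_of_mem hy, e1, wedge_smul_right,
          AlternatingMap.smul_apply, AlternatingMap.add_apply, smul_eq_mul, castDeg_apply, hv']
        ring
      · have e1 : φ y = 0 := image_eq_zero_of_notMem_tsupport fun h => hy (hφK h)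
        have e2 : fderiv ℝ φ y = 0 := image_eq_zero_of_notMem_tsupport
          (fun h => hy (hφK (tsupport_fderiv_subset ℝ h)))
        simp [e1, e2, hG₁, hG₂, hG₃, wedge_apply, lwedge_apply]
    · have e := (hB₁.2.1 0).add ((hB₂.2.1 0).const_mul ε)
      refine e.congr (Eventually.of_forall fun y => ?_)
      by_cases hy : y ∈ K
      · simp only [hG₁, hG₂, hβ', hθ', hγ', hη', indicator_of_mem hy, wedge_smul_right, add_zero,
          AlternatingMap.smul_apply, AlternatingMap.add_apply, smul_eq_mul, castDeg_apply, hv',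
          Pi.add_apply]
        ring
      · have e1 : φ y = 0 := image_eq_zero_of_notMem_tsupport fun h => hy (hφK h)
        simp [e1, hG₁, hG₂, wedge_apply]
    · refine ((hB₃.2.1 0).const_mul ε).congr (Eventually.of_forall fun y => ?_)
      by_cases hy : y ∈ K
      · simp only [hG₃, hβ', hγ', indicator_of_mem hy, add_zero, hε]
        rfl
      · have e2 : fderiv ℝ φ y = 0 := image_eq_zero_of_notMem_tsupport
          (fun h => hy (hφK (tsupport_fderiv_subset ℝ h)))
        simp [e2, hG₃, wedge_apply, lwedge_apply]
  · obtain ⟨Cρ, hCρ⟩ := hρ.continuous.bounded_above_of_compact_support hρc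
    have hρint : ∀ {B : E → E → ℝ}, IsDiagKernel μ B →
        Integrable (fun z : E × E => ρ (z.1 - z.2) * B z.1 z.2) (μ.prod μ) := fun hB =>
      hB.1.bdd_mul (c := Cρ)
        (hρ.continuous.comp (continuous_fst.sub continuous_snd)).aestronglyMeasurable
        (Eventually.of_forall fun z => hCρ _)
    have hK₃ : Integrable (fun z : E × E => LpForms.wedge (β' z.1)
        (lwedge (fderiv ℝ ρ (z.1 - z.2)).toLinearMap (G₁ z.2)) v) (μ.prod μ) := by
      simp only [wedge_apply, lwedge_apply, Finset.mul_sum]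
      refine integrable_finsetSum _ fun σ _ => (integrable_finsetSum _ fun i _ => ?_)
      have e := ((gβ (fun i => v (σ (Fin.castAdd (l + 1) i)))).2.mul_prod
        (gG₁ (fun j => v (σ (Fin.natAdd k (i.succAbove j))))).2).bdd_mul
        (f := fun z : E × E => fderiv ℝ ρ (z.1 - z.2) (v (σ (Fin.natAdd k i))))
        (c := (bounded_fderiv_apply hρ hρc (v (σ (Fin.natAdd k i)))).2.choose)
        ((bounded_fderiv_apply hρ hρc _).1.comp
          (continuous_fst.sub continuous_snd)).aestronglyMeasurable
        (Eventually.of_forall fun z =>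
          (bounded_fderiv_apply hρ hρc _).2.choose_spec (z.1 - z.2))
      refine (e.const_mul (((Equiv.Perm.sign σ : ℤ) : ℝ) / (k.factorial * (l + 1).factorial) *
        (-1) ^ (i : ℕ))).congr (Eventually.of_forall fun z => ?_)
      simp only [ContinuousLinearMap.coe_coe]
      ring
    have hleft : ∀ y, ∫ x, ρ (x - y) * LpForms.wedge (θ' x) (G₁ y) v' ∂μ =
        -(ε * ∫ x, LpForms.wedge (β' x)
          (lwedge (fderiv ℝ ρ (x - y)).toLinearMap (G₁ y)) v ∂μ) := by
      intro y
      by_cases hy : φ y = 0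
      · simp [hG₁, hy, wedge_apply, lwedge_apply]
      have hyK : y ∈ tsupport φ := subset_tsupport _ hy
      have hsup : tsupport (fun x => ρ (x - y)) ⊆ K := fun x hx => by
        have h1 : x - y ∈ tsupport ρ :=
          tsupport_comp_subset_preimage ρ (f := fun x => x - y) (by fun_prop) hx
        have h2 := hρr h1
        rw [mem_ball_zero_iff] at h2
        exact Metric.mem_cthickening_of_dist_le x y r _ hyK (by rw [dist_eq_norm]; exact h2.le)
      have hcs : HasCompactSupport fun x => ρ (x - y) :=
        hρc.comp_homeomorph (Homeomorph.subRight y)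
      have hsm : ContDiff ℝ ∞ fun x => ρ (x - y) := hρ.comp (contDiff_id.sub contDiff_const)
      have hI : ∀ w, Integrable (fun x => lwedge (fderiv ℝ ρ (x - y)).toLinearMap (β' x) w) μ := by
        intro w
        simp only [lwedge_apply]
        exact integrable_finsetSum _ fun i _ => ((key4 (s := p)
          ((bounded_fderiv_apply hρ hρc (w i)).1.comp (continuous_id.sub continuous_const))
          (fun x => (bounded_fderiv_apply hρ hρc (w i)).2.choose_spec (x - y)) (gβ _)).2).const_mul _
      have h1 := integral_wedge_left_congr (μ := μ) (F := fun x => ρ (x - y) • θ' x)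
        (G := fun x => -lwedge (fderiv ℝ ρ (x - y)).toLinearMap (β' x))
        (fun w => (key4 (s := p) hsm.continuous (fun x => hCρ _) (gθ w)).2) (fun w => (hI w).neg)
        (fun w => ?_) (G₁ y) v'
      · simp only [wedge_smul_left, wedge_neg_left, AlternatingMap.smul_apply,
          AlternatingMap.neg_apply, smul_eq_mul, integral_neg] at h1
        rw [h1, ← integral_const_mul]
        congr 1
        refine integral_congr_ae (Eventually.of_forall fun x => ?_)
        have h2 := hε (fderiv ℝ ρ (x - y)).toLinearMap (β' x) (G₁ y)
        rw [← lwedge_wedge_left h] at h2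
        exact congrArg (fun a => a v) h2
      · have h1 := hd _ hsm hcs (hsup.trans hrU) w
        rw [← key2 hsup, ← key3 hsup, ← hθ', ← hβ'] at h1
        simp only [fderiv_comp_sub] at h1
        simp only [AlternatingMap.smul_apply, AlternatingMap.neg_apply, smul_eq_mul, integral_neg]
        exact h1
    have hright : ∀ x, ∫ y, ρ (x - y) * (LpForms.wedge (β' x) (G₂ y) v +
        LpForms.wedge (β' x) (G₃ y) v) ∂μ =
        ∫ y, LpForms.wedge (β' x) (lwedge (fderiv ℝ ρ (x - y)).toLinearMap (G₁ y)) v ∂μ := by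
      intro x
      have hsup : tsupport (fun y => ρ (x - y) * φ y) ⊆ K :=
        (tsupport_mul_subset_right).trans hφK
      have hcs : HasCompactSupport fun y => ρ (x - y) * φ y := hφc.mul_left
      have hsm' : ContDiff ℝ ∞ fun y => ρ (x - y) := hρ.comp (contDiff_const.sub contDiff_id)
      have hsm : ContDiff ℝ ∞ fun y => ρ (x - y) * φ y := hsm'.mul hφ
      have hI2 : ∀ w, Integrable (fun y => ρ (x - y) * G₂ y w) μ := fun w =>
        (key4 (s := q) hsm'.continuous (fun x => hCρ _) (gG₂ w)).2
      have hI3 : ∀ w, Integrable (fun y => ρ (x - y) * G₃ y w) μ := fun w =>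
        (key4 (s := q) hsm'.continuous (fun x => hCρ _) (gG₃ w)).2
      have hI1 : ∀ w, Integrable (fun y =>
          lwedge (fderiv ℝ ρ (x - y)).toLinearMap (G₁ y) w) μ := by
        intro w
        simp only [lwedge_apply]
        exact integrable_finsetSum _ fun i _ => ((key4 (s := q)
          ((bounded_fderiv_apply hρ hρc (w i)).1.comp (continuous_const.sub continuous_id))
          (fun y => (bounded_fderiv_apply hρ hρc (w i)).2.choose_spec (x - y)) (gG₁ _)).2).const_mul _
      have h1 := integral_wedge_right_congr (μ := μ) (F := fun y => ρ (x - y) • (G₂ y + G₃ y))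
        (G := fun y => lwedge (fderiv ℝ ρ (x - y)).toLinearMap (G₁ y))
        (fun w => ?_) hI1 (fun w => ?_) (β' x) v
      · simp only [wedge_smul_right, wedge_add_right, AlternatingMap.smul_apply,
          AlternatingMap.add_apply, smul_eq_mul] at h1
        exact h1
      · refine ((hI2 w).add (hI3 w)).congr (Eventually.of_forall fun y => ?_)
        simp
      · have h1 := hd' _ hsm hcs (hsup.trans hrU) w
        rw [← key2 hsup, ← key3 hsup, ← hη', ← hγ'] at h1
        have h2 : ∀ y, lwedge (fderiv ℝ (fun y => ρ (x - y) * φ y) y).toLinearMap (γ' y) w =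
            ρ (x - y) * G₃ y w - lwedge (fderiv ℝ ρ (x - y)).toLinearMap (G₁ y) w := by
          intro y
          have h3 : fderiv ℝ (fun y => ρ (x - y) * φ y) y =
              ρ (x - y) • fderiv ℝ φ y - φ y • fderiv ℝ ρ (x - y) := by
            rw [fderiv_fun_mul (hsm'.differentiable (by simp) _) (hφ.differentiable (by simp) _),
              fderiv_const_sub_comp hρ, smul_neg, ← sub_eq_add_neg]
          simp only [h3, hG₃, hG₁, lwedge_apply, Finset.mul_sum, ← Finset.sum_sub_distrib,
            ContinuousLinearMap.coe_coe, _root_.sub_apply, _root_.smul_apply, smul_eq_mul,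
            AlternatingMap.smul_apply]
          exact Finset.sum_congr rfl fun i _ => by ring
        simp only [h2] at h1
        rw [integral_sub (hI3 w) (hI1 w)] at h1
        have h4 : ∫ y, (ρ (x - y) • (G₂ y + G₃ y)) w ∂μ =
            ∫ y, ρ (x - y) * G₂ y w ∂μ + ∫ y, ρ (x - y) * G₃ y w ∂μ := by
          rw [← integral_add (hI2 w) (hI3 w)]
          simp
        have h5 : ∫ y, ρ (x - y) * G₂ y w ∂μ = ∫ y, ρ (x - y) * φ y * η' y w ∂μ := by
          simp [hG₂, mul_assoc]
        rw [h4, h5, h1]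
        ring
    have hsplit : ∫ z : E × E, ρ (z.1 - z.2) * (LpForms.wedge (θ' z.1) (G₁ z.2) v' +
        ε * (LpForms.wedge (β' z.1) (G₂ z.2) v + LpForms.wedge (β' z.1) (G₃ z.2) v)) ∂(μ.prod μ) =
        (∫ z : E × E, ρ (z.1 - z.2) * LpForms.wedge (θ' z.1) (G₁ z.2) v' ∂(μ.prod μ)) +
        ε * ∫ z : E × E, ρ (z.1 - z.2) * (LpForms.wedge (β' z.1) (G₂ z.2) v +
          LpForms.wedge (β' z.1) (G₃ z.2) v) ∂(μ.prod μ) := by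
      rw [← integral_const_mul, ← integral_add (hρint hB₁) ((hρint hB₂₃).const_mul ε)]
      exact integral_congr_ae (Eventually.of_forall fun z => by simp only; ring)
    rw [hsplit, integral_prod_symm _ (hρint hB₁), integral_prod _ (hρint hB₂₃)]
    simp only [hleft, hright]
    have hswap := integral_integral_swap (f := fun x y => LpForms.wedge (β' x)
      (lwedge (fderiv ℝ ρ (x - y)).toLinearMap (G₁ y)) v) hK₃
    rw [integral_neg, integral_const_mul, hswap, neg_add_cancel]

end LocalLeibniz


section HopfRinow

variable {E : Type*} [NormedAddCommGroup E] [NormedSpace ℝ E]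
  {H : Type*} [TopologicalSpace H] (I : ModelWithCorners ℝ E H)
  (M : Type*) [EMetricSpace M] [ChartedSpace H M]
  [RiemannianBundle (fun x : M => TangentSpace I x)] [IsRiemannianManifold I M]

include I

/-- A Riemannian manifold is a length space. -/
lemma exists_edist_le_of_edist_lt {x y : M} {a b : ℝ≥0∞} (ha : a ≠ ⊤) (hb : 0 < b)
    (h : edist x y < a + b) : ∃ z : M, edist x z ≤ a ∧ edist z y < b := by
  rcases lt_or_ge (edist x y) a with h1 | h1
  · exact ⟨y, h1.le, by simpa using hb⟩
  rw [IsRiemannianManifold.out (I := I) x y] at h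
  obtain ⟨γ, h0, h1', hγ, hL⟩ := Manifold.exists_lt_of_riemannianEDist_lt h
  have hcont : ContinuousOn (fun t => edist x (γ t)) (Icc 0 1) :=
    continuous_edist.comp_continuousOn (continuousOn_const.prodMk hγ.continuousOn)
  obtain ⟨t, ht, hta⟩ := intermediate_value_Icc zero_le_one hcont
    (show a ∈ Icc _ _ from ⟨by simp [h0], by simpa [h1'] using h1⟩)
  refine ⟨γ t, hta.le, ?_⟩
  have e1 : a ≤ Manifold.pathELength I γ 0 t := by
    rw [← hta]
    beta_reduce
    rw [IsRiemannianManifold.out (I := I)]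
    exact Manifold.riemannianEDist_le_pathELength (hγ.mono (Icc_subset_Icc le_rfl ht.2)) h0 rfl ht.1
  have e2 : edist (γ t) y ≤ Manifold.pathELength I γ t 1 := by
    rw [IsRiemannianManifold.out (I := I)]
    exact Manifold.riemannianEDist_le_pathELength (hγ.mono (Icc_subset_Icc ht.1 le_rfl)) rfl h1' ht.2
  rw [← Manifold.pathELength_add ht.1 ht.2] at hL
  have e3 : a + Manifold.pathELength I γ t 1 < a + b := lt_of_le_of_lt (by gcongr) hL
  exact e2.trans_lt ((ENNReal.add_lt_add_iff_left ha).1 e3)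

variable [FiniteDimensional ℝ E] [I.Boundaryless] [CompleteSpace M]

/-- **Hopf–Rinow**: closed balls of finite radius in a complete Riemannian manifold are compact. -/
theorem isCompact_closedBall_of_complete (x : M) (r : ℝ) :
    IsCompact {y : M | edist x y ≤ ENNReal.ofReal r} := by
  have hlc : LocallyCompactSpace M := Manifold.locallyCompact_of_finiteDimensional I
  have hclosed (r : ℝ) : IsClosed {y : M | edist x y ≤ ENNReal.ofReal r} :=
    isClosed_le (continuous_const.edist continuous_id) continuous_const
  have hmono {r s : ℝ} (h : r ≤ s) : {y : M | edist x y ≤ ENNReal.ofReal r} ⊆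
      {y : M | edist x y ≤ ENNReal.ofReal s} := fun y hy =>
    hy.trans (ENNReal.ofReal_le_ofReal h)
  set T := {r : ℝ | ¬ IsCompact {y : M | edist x y ≤ ENNReal.ofReal r}} with hT
  by_contra hr
  have hTr : r ∈ T := hr
  have hT0 : ∀ s ∈ T, 0 ≤ s := by
    intro s hs
    by_contra! h
    refine hs ?_
    rw [ENNReal.ofReal_of_nonpos h.le]
    simp
  have hbdd : BddBelow T := ⟨0, hT0⟩
  set R := sInf T
  have hlt : ∀ s, s < R → IsCompact {y : M | edist x y ≤ ENNReal.ofReal s} := by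
    intro s hs
    by_contra h
    exact (csInf_le hbdd h).not_gt hs
  have hR : IsCompact {y : M | edist x y ≤ ENNReal.ofReal R} := by
    refine TotallyBounded.isCompact_of_isClosed ?_ (hclosed R)
    rw [EMetric.totallyBounded_iff]
    intro ε hε
    obtain ⟨δ, hδ, hδε⟩ : ∃ δ : ℝ, 0 < δ ∧ ENNReal.ofReal δ + ENNReal.ofReal δ ≤ ε := by
      rcases eq_or_ne ε ⊤ with rfl | hε'
      · exact ⟨1, one_pos, le_top⟩
      · have := ENNReal.toReal_pos hε.ne' hε'
        refine ⟨ε.toReal / 2, by positivity, ?_⟩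
        rw [← ENNReal.ofReal_add (by positivity) (by positivity), add_halves,
          ENNReal.ofReal_toReal hε']
    obtain ⟨t, ht, hcov⟩ := EMetric.totallyBounded_iff.1
      (hlt (R - δ / 2) (by linarith)).totallyBounded (ENNReal.ofReal δ) (by simpa using hδ)
    refine ⟨t, ht, fun y hy => ?_⟩
    have h1 : edist x y < ENNReal.ofReal (R - δ / 2) + ENNReal.ofReal δ := by
      refine lt_of_lt_of_le ?_ ENNReal.ofReal_add_le
      refine lt_of_le_of_lt hy ?_
      have hR0 : 0 ≤ R := Real.sInf_nonneg hT0
      rw [ENNReal.ofReal_lt_ofReal_iff (by linarith)]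
      linarith
    obtain ⟨z, hz, hzy⟩ := exists_edist_le_of_edist_lt I M ENNReal.ofReal_ne_top
      (by simpa using hδ) h1
    have h2 := hcov hz
    simp only [mem_iUnion, Metric.mem_eball, exists_prop] at h2 ⊢
    obtain ⟨w, hw, hzw⟩ := h2
    refine ⟨w, hw, lt_of_lt_of_le ?_ hδε⟩
    calc edist y w ≤ edist y z + edist z w := edist_triangle _ _ _
      _ < _ := ENNReal.add_lt_add (by rwa [edist_comm]) hzw
  obtain ⟨K, hK, hRK⟩ := exists_compact_superset hR
  obtain ⟨δ, hδ, hδK⟩ := hR.exists_cthickening_subset_open isOpen_interior hRK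
  have hR0 : 0 ≤ R := Real.sInf_nonneg hT0
  have hcomp : IsCompact {y : M | edist x y ≤ ENNReal.ofReal (R + δ / 2)} := by
    refine hK.of_isClosed_subset (hclosed _) fun y hy => interior_subset (hδK ?_)
    have h1 : edist x y < ENNReal.ofReal R + ENNReal.ofReal δ := by
      rw [← ENNReal.ofReal_add hR0 hδ.le]
      refine lt_of_le_of_lt hy ?_
      rw [ENNReal.ofReal_lt_ofReal_iff (by linarith)]
      linarith
    obtain ⟨z, hz, hzy⟩ := exists_edist_le_of_edist_lt I M ENNReal.ofReal_ne_top
      (by simpa using hδ) h1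
    exact (Metric.infEDist_le_edist_of_mem (s := {y : M | edist x y ≤ ENNReal.ofReal R}) hz).trans (by rw [edist_comm]; exact hzy.le)
  obtain ⟨s, hs, hsR⟩ := exists_lt_of_csInf_lt ⟨r, hTr⟩ (show R < R + δ / 2 by linarith)
  exact hs (hcomp.of_isClosed_subset (hclosed s) (hmono hsR.le))

end HopfRinow

section Cutoff

variable {E : Type*} [NormedAddCommGroup E] [NormedSpace ℝ E]
  {H : Type*} [TopologicalSpace H] {I : ModelWithCorners ℝ E H}
  {M : Type*} [TopologicalSpace M] [ChartedSpace H M]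

/-- A function `u` on `M` whose gradient for the metric `g` is at most `ε`, in the sense that in
all charts the increments of `u` are bounded at first order. -/
def HasGradBound (g : MetricField I M) (ε : ℝ) (u : M → ℝ) : Prop :=
  ∀ x₀ : M, ∀ y ∈ (extChartAt I x₀).target, ∀ δ : ℝ, 0 < δ →
    ∀ᶠ z : E × E in 𝓝 (y, y), |u ((extChartAt I x₀).symm z.1) - u ((extChartAt I x₀).symm z.2)| ≤
      ε * (√(g ((extChartAt I x₀).symm y) (dchart I x₀ y (z.1 - z.2))
        (dchart I x₀ y (z.1 - z.2))) + δ * ‖z.1 - z.2‖)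

/-- Compactly supported functions that converge to one and whose gradients converge uniformly to
zero. -/
def HasCutoffs (g : MetricField I M) : Prop :=
  ∃ (u : ℕ → M → ℝ) (ε : ℕ → ℝ), Tendsto ε atTop (𝓝 0) ∧
    (∀ n, 0 ≤ ε n ∧ Continuous (u n) ∧ HasCompactSupport (u n) ∧ (∀ x, |u n x| ≤ 1) ∧
      HasGradBound g (ε n) (u n)) ∧ ∀ x, Tendsto (fun n => u n x) atTop (𝓝 1)

/-- The metric varies little near a point of a chart. -/
lemma IsRiemMetric.eventually_sqrt_le [I.Boundaryless] [IsManifold I ∞ M] [FiniteDimensional ℝ E]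
    {g : MetricField I M} (hg : IsRiemMetric g) {x₀ : M} {y : E}
    (hy : y ∈ (extChartAt I x₀).target) {δ : ℝ} (hδ : 0 < δ) : ∀ᶠ z in 𝓝 y, ∀ w : E,
      √(g ((extChartAt I x₀).symm z) (dchart I x₀ z w) (dchart I x₀ z w)) ≤
        √(g ((extChartAt I x₀).symm y) (dchart I x₀ y w) (dchart I x₀ y w)) + δ * ‖w‖ := by
  set e := Module.finBasis ℝ E
  obtain ⟨C, hC, hCw⟩ : ∃ C : ℝ, 0 < C ∧ ∀ (i) (w : E), |e.repr w i| ≤ C * ‖w‖ := by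
    have h1 (i : Fin (Module.finrank ℝ E)) : ∃ C : ℝ, 0 < C ∧ ∀ w : E, |e.repr w i| ≤ C * ‖w‖ := by
      obtain ⟨C, hC, h⟩ := (LinearMap.toContinuousLinearMap (e.coord i)).isBoundedLinearMap.bound
      exact ⟨C, hC, h⟩
    choose C hC h using h1
    refine ⟨1 + ∑ i, C i, by have := Finset.sum_nonneg fun i (_ : i ∈ Finset.univ) => (hC i).le
                             positivity, fun i w => (h i w).trans ?_⟩
    gcongr
    have := Finset.single_le_sum (fun i _ => (hC i).le) (Finset.mem_univ i)
    linarith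
  have hexp (z : E) (w : E) : g ((extChartAt I x₀).symm z) (dchart I x₀ z w) (dchart I x₀ z w) =
      ∑ i, ∑ j, e.repr w i * e.repr w j * g ((extChartAt I x₀).symm z) (dchart I x₀ z (e i))
        (dchart I x₀ z (e j)) := by
    have hs := hg.scalar ((extChartAt I x₀).symm z)
    conv_lhs => rw [← e.sum_repr w, map_sum]
    rw [hs.sum_left]
    refine Finset.sum_congr rfl fun i _ => ?_
    rw [hs.sum_right]
    refine Finset.sum_congr rfl fun j _ => ?_
    rw [map_smul, map_smul, hs.smul_left, hs.smul_right, mul_assoc]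
  set N : ℝ := (Module.finrank ℝ E : ℝ) ^ 2 * C ^ 2 + 1 with hN
  have hNpos : 0 < N := by positivity
  have hev : ∀ᶠ z in 𝓝 y, ∀ i j,
      |g ((extChartAt I x₀).symm z) (dchart I x₀ z (e i)) (dchart I x₀ z (e j)) -
        g ((extChartAt I x₀).symm y) (dchart I x₀ y (e i)) (dchart I x₀ y (e j))| ≤ δ ^ 2 / N := by
    rw [eventually_all]
    intro i
    rw [eventually_all]
    intro j
    have h1 := ((hg.continuousOn x₀ (e i) (e j)).continuousAt
      ((isOpen_extChartAt_target x₀).mem_nhds hy))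
    have h2 := Metric.tendsto_nhds.1 h1 (δ ^ 2 / N) (by positivity)
    filter_upwards [h2] with z hz
    rw [Real.dist_eq] at hz
    exact hz.le
  filter_upwards [hev] with z hz w
  have h1 : g ((extChartAt I x₀).symm z) (dchart I x₀ z w) (dchart I x₀ z w) ≤
      g ((extChartAt I x₀).symm y) (dchart I x₀ y w) (dchart I x₀ y w) + (δ * ‖w‖) ^ 2 := by
    rw [← sub_le_iff_le_add', hexp, hexp, ← Finset.sum_sub_distrib]
    simp only [← Finset.sum_sub_distrib, ← mul_sub]
    calc _ ≤ ∑ i : Fin (Module.finrank ℝ E), ∑ j : Fin (Module.finrank ℝ E),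
          (C * ‖w‖) * (C * ‖w‖) * (δ ^ 2 / N) := by
          refine Finset.sum_le_sum fun i _ => Finset.sum_le_sum fun j _ => ?_
          refine (le_abs_self _).trans ?_
          rw [abs_mul, abs_mul]
          gcongr
          · exact hCw i w
          · exact hCw j w
          · exact hz i j
      _ = (Module.finrank ℝ E : ℝ) ^ 2 * C ^ 2 / N * (δ * ‖w‖) ^ 2 := by
          simp only [Finset.sum_const, Finset.card_univ, Fintype.card_fin, nsmul_eq_mul]
          ring
      _ ≤ 1 * (δ * ‖w‖) ^ 2 := by
          gcongr
          rw [div_le_one hNpos, hN]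
          linarith
      _ = _ := one_mul _
  refine (Real.sqrt_le_sqrt h1).trans ?_
  refine Real.sqrt_le_iff.2 ⟨by positivity, ?_⟩
  have h3 := Real.sq_sqrt (x := g ((extChartAt I x₀).symm y) (dchart I x₀ y w) (dchart I x₀ y w))
    ((hg.scalar _).nonneg _)
  have h4 := Real.sqrt_nonneg (g ((extChartAt I x₀).symm y) (dchart I x₀ y w) (dchart I x₀ y w))
  have : 0 ≤ δ * ‖w‖ := by positivity
  nlinarith

end Cutoff

section Existence

variable {E : Type*} [NormedAddCommGroup E] [NormedSpace ℝ E] [FiniteDimensional ℝ E]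
  {H : Type*} [TopologicalSpace H] (I : ModelWithCorners ℝ E H) [I.Boundaryless]
  (M : Type*) [EMetricSpace M] [ChartedSpace H M] [IsManifold I ∞ M]
  [RiemannianBundle (fun x : M => TangentSpace I x)]
  [IsContMDiffRiemannianBundle I ∞ E (fun x : M => TangentSpace I x)] [IsRiemannianManifold I M]

/-- The distance in a chart is bounded at first order by the metric at a point. -/
lemma eventually_edist_chart_le {x₀ : M} {y : E} (hy : y ∈ (extChartAt I x₀).target) {δ : ℝ}
    (hδ : 0 < δ) : ∀ᶠ z : E × E in 𝓝 (y, y),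
      edist ((extChartAt I x₀).symm z.1) ((extChartAt I x₀).symm z.2) ≤
        ENNReal.ofReal (√(metricOf I M ((extChartAt I x₀).symm y) (dchart I x₀ y (z.1 - z.2))
          (dchart I x₀ y (z.1 - z.2))) + δ * ‖z.1 - z.2‖) := by
  have h1 := (isRiemMetric_metricOf (I := I) (M := M)).eventually_sqrt_le hy hδ
  obtain ⟨r, hr, hball⟩ := Metric.eventually_nhds_iff_ball.1
    (h1.and ((isOpen_extChartAt_target (I := I) x₀).mem_nhds hy))
  have h2 : Metric.ball y r ×ˢ Metric.ball y r ∈ 𝓝 (y, y) :=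
    prod_mem_nhds (Metric.ball_mem_nhds y hr) (Metric.ball_mem_nhds y hr)
  filter_upwards [h2] with z hz
  set w := z.1 - z.2 with hw
  let η : ℝ → E := fun t => z.2 + t • w
  have hη (t : ℝ) (ht : t ∈ Icc (0 : ℝ) 1) : η t ∈ Metric.ball y r := by
    have := (convex_ball y r).add_smul_sub_mem hz.2 hz.1 ht
    exact this
  have hηd (t : ℝ) : HasDerivAt η w t := by
    have h := ((hasDerivAt_id t).smul_const w).const_add z.2
    rw [one_smul] at h
    exact h
  have hηc : ContMDiff 𝓘(ℝ, ℝ) 𝓘(ℝ, E) 1 η := by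
    rw [contMDiff_iff_contDiff]
    fun_prop
  have hγ : ContMDiffOn 𝓘(ℝ, ℝ) I 1 ((extChartAt I x₀).symm ∘ η) (Icc 0 1) :=
    (contMDiffOn_extChartAt_symm (n := 1) x₀).comp hηc.contMDiffOn
      fun t ht => (hball _ (hη t ht)).2
  rw [edist_comm, IsRiemannianManifold.out (I := I)]
  refine (Manifold.riemannianEDist_le_pathELength hγ (by simp [η]) (by simp [η, hw])
    zero_le_one).trans ?_
  rw [Manifold.pathELength_eq_lintegral_mfderiv_Icc]
  calc _ ≤ ∫⁻ t in Icc (0 : ℝ) 1, ENNReal.ofReal (√(metricOf I M ((extChartAt I x₀).symm y)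
          (dchart I x₀ y w) (dchart I x₀ y w)) + δ * ‖w‖) := by
        refine setLIntegral_mono measurable_const fun t ht => ?_
        obtain ⟨hle, hmem⟩ := hball _ (hη t ht)
        have h3 : mfderiv 𝓘(ℝ, ℝ) I ((extChartAt I x₀).symm ∘ η) t =
            (dchart I x₀ (η t)).comp (mfderiv 𝓘(ℝ, ℝ) 𝓘(ℝ, E) η t) :=
          mfderiv_comp t (mdifferentiableAt_chart_symm hmem)
            (hηd t).differentiableAt.mdifferentiableAt
        have h4 : mfderiv 𝓘(ℝ, ℝ) 𝓘(ℝ, E) η t 1 = w := by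
          rw [mfderiv_eq_fderiv]
          exact (hηd t).deriv
        have h5 : mfderiv 𝓘(ℝ, ℝ) I ((extChartAt I x₀).symm ∘ η) t 1 = dchart I x₀ (η t) w := by
          rw [h3]
          exact congrArg (dchart I x₀ (η t)) h4
        have h6 : ‖dchart I x₀ (η t) w‖ = √(metricOf I M ((extChartAt I x₀).symm (η t))
            (dchart I x₀ (η t) w) (dchart I x₀ (η t) w)) := norm_eq_sqrt_real_inner _
        rw [h5, ← ofReal_norm, h6]
        exact ENNReal.ofReal_le_ofReal (hle w)
    _ = _ := by simp

variable [CompleteSpace M] [SecondCountableTopology M]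

/-- A complete Riemannian manifold has cut-off functions with small gradients. -/
theorem hasCutoffs_metricOf : HasCutoffs (metricOf I M) := by
  rcases isEmpty_or_nonempty M with hM | hM
  · exact ⟨fun _ _ => 0, fun _ => 0, tendsto_const_nhds, fun n => ⟨le_rfl, continuous_const,
      HasCompactSupport.of_support_subset_isCompact isCompact_empty (fun x => hM.elim x),
      fun x => hM.elim x, fun x => hM.elim x⟩, fun x => hM.elim x⟩
  have hdense := TopologicalSpace.denseRange_denseSeq M
  set z := TopologicalSpace.denseSeq M
  let F (n : ℕ) : Set M := z '' Set.Iic n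
  let c (n : ℕ) : ℝ≥0∞ := ((n : ℝ≥0∞) + 1)⁻¹
  have hc0 (n : ℕ) : c n ≠ 0 := by simp [c]
  have hct (n : ℕ) : c n ≠ ⊤ := by simp [c]
  let u (n : ℕ) (x : M) : ℝ≥0∞ := 1 - c n * Metric.infEDist x (F n)
  have hu1 (n : ℕ) (x : M) : u n x ≤ 1 := tsub_le_self
  have hut (n : ℕ) (x : M) : u n x ≠ ⊤ := ((hu1 n x).trans_lt ENNReal.one_lt_top).ne
  have hu (n : ℕ) (x y : M) : u n x ≤ u n y + c n * edist x y := by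
    refine tsub_le_iff_right.2 ?_
    have h1 : Metric.infEDist y (F n) ≤ Metric.infEDist x (F n) + edist x y := by
      rw [edist_comm]
      exact Metric.infEDist_le_infEDist_add_edist
    calc (1 : ℝ≥0∞) ≤ u n y + c n * Metric.infEDist y (F n) := le_tsub_add
      _ ≤ u n y + c n * (Metric.infEDist x (F n) + edist x y) := by gcongr
      _ = _ := by ring
  have hlip (n : ℕ) (x y : M) (d : ℝ) (hd : 0 ≤ d) (h : edist x y ≤ ENNReal.ofReal d) :
      |(u n x).toReal - (u n y).toReal| ≤ (c n).toReal * d := by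
    have aux (x y : M) (h : edist x y ≤ ENNReal.ofReal d) :
        (u n x).toReal ≤ (u n y).toReal + (c n).toReal * d := by
      have h1 : u n x ≤ u n y + c n * ENNReal.ofReal d := (hu n x y).trans (by gcongr)
      have h2 : c n * ENNReal.ofReal d ≠ ⊤ := ENNReal.mul_ne_top (hct n) ENNReal.ofReal_ne_top
      have h3 := ENNReal.toReal_mono (ENNReal.add_ne_top.2 ⟨hut n y, h2⟩) h1
      rwa [ENNReal.toReal_add (hut n y) h2, ENNReal.toReal_mul, ENNReal.toReal_ofReal hd] at h3
    rw [abs_sub_le_iff]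
    have h1 := aux x y h
    have h2 := aux y x (by rwa [edist_comm])
    constructor <;> linarith
  have hcreal (n : ℕ) : (c n).toReal = 1 / ((n : ℝ) + 1) := by
    simp only [c]
    rw [ENNReal.toReal_inv, one_div, ENNReal.toReal_add (by simp) (by simp)]
    simp
  refine ⟨fun n x => (u n x).toReal, fun n => (c n).toReal, ?_, fun n => ⟨ENNReal.toReal_nonneg,
    ?_, ?_, fun x => ?_, ?_⟩, fun x => ?_⟩
  · simp only [hcreal]
    exact tendsto_one_div_add_atTop_nhds_zero_nat
  · exact ENNReal.continuousOn_toReal.comp_continuous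
      ((ENNReal.continuous_sub_left ENNReal.one_ne_top).comp
        ((ENNReal.continuous_const_mul (hct n)).comp Metric.continuous_infEDist)) (hut n)
  · refine HasCompactSupport.of_support_subset_isCompact
      ((Set.finite_Iic n).isCompact_biUnion fun i _ =>
        isCompact_closedBall_of_complete I M (z i) (n + 1)) fun x hx => ?_
    have h1 : u n x ≠ 0 := fun h0 => hx (by simp [h0])
    have h2 : c n * Metric.infEDist x (F n) < 1 := tsub_pos_iff_lt.1 (pos_iff_ne_zero.2 h1)
    have h3 : Metric.infEDist x (F n) < (n : ℝ≥0∞) + 1 := by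
      have h4 := (ENNReal.mul_lt_mul_iff_right (a := (n : ℝ≥0∞) + 1) (by simp) (by simp)).2 h2
      rwa [← mul_assoc, ENNReal.mul_inv_cancel (by simp) (by simp), one_mul, mul_one] at h4
    obtain ⟨_, ⟨i, hi, rfl⟩, hlt⟩ := Metric.infEDist_lt_iff.1 h3
    refine mem_biUnion hi ?_
    rw [mem_ofPred_eq, edist_comm]
    refine hlt.le.trans_eq ?_
    rw [ENNReal.ofReal_add (by positivity) (by positivity)]
    simp
  · rw [abs_of_nonneg ENNReal.toReal_nonneg]
    exact ENNReal.toReal_mono ENNReal.one_ne_top (hu1 n x)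
  · intro x₀ y hy δ hδ
    filter_upwards [eventually_edist_chart_le I M hy hδ] with w hw
    exact hlip n _ _ _ (by positivity) hw
  · obtain ⟨_, ⟨i, rfl⟩, hi⟩ := EMetric.mem_closure_iff.1 (hdense x) 1 one_pos
    have h1 : ∀ᶠ n : ℕ in atTop, 1 - 1 / ((n : ℝ) + 1) ≤ (u n x).toReal := by
      filter_upwards [eventually_ge_atTop i] with n hn
      have h2 : 1 ≤ u n x + c n := by
        have h3 : Metric.infEDist x (F n) ≤ 1 :=
          (Metric.infEDist_le_edist_of_mem
            (show z i ∈ F n from mem_image_of_mem z (Set.mem_Iic.2 hn))).trans hi.le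
        calc (1 : ℝ≥0∞) ≤ u n x + c n * Metric.infEDist x (F n) := le_tsub_add
          _ ≤ u n x + c n * 1 := by gcongr
          _ = _ := by rw [mul_one]
      have h4 := ENNReal.toReal_mono (ENNReal.add_ne_top.2 ⟨hut n x, hct n⟩) h2
      rw [ENNReal.toReal_add (hut n x) (hct n), hcreal, ENNReal.toReal_one] at h4
      linarith
    have h2 : Tendsto (fun n : ℕ => 1 - 1 / ((n : ℝ) + 1)) atTop (𝓝 1) := by
      simpa using tendsto_const_nhds.sub (tendsto_one_div_add_atTop_nhds_zero_nat (𝕜 := ℝ))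
        (a := (1 : ℝ))
    exact tendsto_of_tendsto_of_tendsto_of_le_of_le' h2 tendsto_const_nhds h1
      (Eventually.of_forall fun n => ENNReal.toReal_mono ENNReal.one_ne_top (hu1 n x))

end Existence


section LipschitzTest

variable {E : Type*} [NormedAddCommGroup E] [NormedSpace ℝ E] [FiniteDimensional ℝ E]
  [MeasurableSpace E] [BorelSpace E] {μ : Measure E} [μ.IsAddHaarMeasure] {U : Set E}

open scoped Convolution NNReal

lemma fderiv_convolution_lipschitz {ρ W : E → ℝ} (hρ : ContDiff ℝ ∞ ρ) (hρc : HasCompactSupport ρ)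
    {K : ℝ≥0} (hW : LipschitzWith K W) (y v : E) :
    fderiv ℝ (ρ ⋆[ContinuousLinearMap.lsmul ℝ ℝ, μ] W) y v =
      (ρ ⋆[ContinuousLinearMap.lsmul ℝ ℝ, μ] fun z => lineDeriv ℝ W z v) y := by
  have hρ1 : ContDiff ℝ 1 ρ := hρ.of_le (by simp)
  have hloc : LocallyIntegrable W μ := hW.continuous.locallyIntegrable
  rw [(hρc.hasFDerivAt_convolution_left (ContinuousLinearMap.lsmul ℝ ℝ) hρ1 hloc y).fderiv]
  have hex : ConvolutionExistsAt (fderiv ℝ ρ) W y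
      ((ContinuousLinearMap.lsmul ℝ ℝ).precompL E) μ :=
    (hρc.fderiv (𝕜 := ℝ)).convolutionExists_left _ (hρ1.continuous_fderiv (by simp)) hloc y
  obtain ⟨D, hD⟩ := ContDiff.lipschitzWith_of_hasCompactSupport hρc hρ (by simp)
  have hW' : LipschitzWith K fun s => W (y - s) :=
    LipschitzWith.of_dist_le_mul fun a b => (hW.dist_le_mul _ _).trans_eq (by rw [dist_sub_left])
  have hparts := LipschitzWith.integral_lineDeriv_mul_eq (μ := μ) hW' hD hρc v
  rw [convolution_def, convolution_def, ContinuousLinearMap.integral_apply hex]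
  have e1 : ∀ s, lineDeriv ℝ (fun s => W (y - s)) s v = -lineDeriv ℝ W (y - s) v := by
    intro s
    rw [← lineDeriv_neg]
    simp only [lineDeriv]
    congr 1
    funext t
    congr 1
    rw [smul_neg]
    abel
  have e2 : ∀ s, lineDeriv ℝ ρ s (-v) = -fderiv ℝ ρ s v := fun s => by
    rw [lineDeriv_neg, ((hρ.differentiable (by simp)) s).lineDeriv_eq_fderiv]
  simp only [e1, e2, neg_mul, integral_neg, neg_inj] at hparts
  calc _ = ∫ s, fderiv ℝ ρ s v * W (y - s) ∂μ := by
        refine integral_congr_ae (Eventually.of_forall fun s => ?_)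
        simp [ContinuousLinearMap.precompL_apply]
    _ = ∫ s, lineDeriv ℝ W (y - s) v * ρ s ∂μ := hparts.symm
    _ = _ := integral_congr_ae (Eventually.of_forall fun s => by simp [mul_comm])

lemma norm_convolution_le_of_bound {ρ f : E → ℝ} (hρ : Integrable ρ μ) (h0 : ∀ y, 0 ≤ ρ y)
    (h1 : ∫ y, ρ y ∂μ = 1) {C : ℝ} (hf : ∀ y, ‖f y‖ ≤ C) (y : E) :
    ‖(ρ ⋆[ContinuousLinearMap.lsmul ℝ ℝ, μ] f) y‖ ≤ C := by
  rw [convolution_def]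
  calc _ ≤ ∫ s, C * ρ s ∂μ := norm_integral_le_of_norm_le (hρ.const_mul C)
        (Eventually.of_forall fun s => by
          simp only [ContinuousLinearMap.lsmul_apply, smul_eq_mul, norm_mul]
          rw [mul_comm, Real.norm_of_nonneg (h0 s)]
          exact mul_le_mul_of_nonneg_right (hf _) (h0 s))
    _ = C := by rw [integral_const_mul, h1, mul_one]

/-- Approximation of a compactly supported Lipschitz function by smooth functions. -/
lemma exists_smooth_approx_lipschitz (μ : Measure E) [μ.IsAddHaarMeasure] (hU : IsOpen U)
    {W : E → ℝ} {K : ℝ≥0} (hW : LipschitzWith K W)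
    (hc : HasCompactSupport W) (hs : tsupport W ⊆ U) :
    ∃ (Q : Set E) (C : ℝ) (w : ℕ → E → ℝ), IsCompact Q ∧ Q ⊆ U ∧ tsupport W ⊆ Q ∧
      (∀ n, ContDiff ℝ ∞ (w n) ∧ tsupport (w n) ⊆ Q ∧ (∀ y, ‖w n y‖ ≤ C) ∧
        ∀ y v, ‖fderiv ℝ (w n) y v‖ ≤ K * ‖v‖) ∧
      (∀ y, Tendsto (fun n => w n y) atTop (𝓝 (W y))) ∧
      ∀ v, ∀ᵐ y ∂μ, Tendsto (fun n => fderiv ℝ (w n) y v) atTop (𝓝 (fderiv ℝ W y v)) := by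
  obtain ⟨r, hr, hrU⟩ := hc.isCompact.exists_cthickening_subset_open hU hs
  obtain ⟨C, hC⟩ := hW.continuous.bounded_above_of_compact_support hc
  let φ (n : ℕ) : ContDiffBump (0 : E) :=
    { rIn := r / (n + 1) / 2
      rOut := r / (n + 1)
      rIn_pos := by positivity
      rIn_lt_rOut := half_lt_self (by positivity) }
  have hφ : Tendsto (fun n => (φ n).rOut) atTop (𝓝 0) := by
    have := (tendsto_one_div_add_atTop_nhds_zero_nat (𝕜 := ℝ)).const_mul r
    simp only [mul_zero, mul_one_div] at this
    exact this
  have hφ' : ∀ᶠ n in atTop, (φ n).rOut ≤ 2 * (φ n).rIn := Eventually.of_forall fun n => by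
    simp only [φ]; linarith
  refine ⟨Metric.cthickening r (tsupport W), C,
    fun n => (φ n).normed μ ⋆[ContinuousLinearMap.lsmul ℝ ℝ, μ] W, hc.isCompact.cthickening, hrU,
    Metric.self_subset_cthickening _, fun n => ⟨?_, ?_, ?_, fun y v => ?_⟩, fun y => ?_,
    fun v => ?_⟩
  · exact (φ n).hasCompactSupport_normed.contDiff_convolution_left _ (φ n).contDiff_normed
      hW.continuous.locallyIntegrable
  · refine closure_minimal (fun x hx => ?_) Metric.isClosed_cthickening
    obtain ⟨a, ha, b, hb, rfl⟩ := support_convolution_subset_swap _ hx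
    rw [(φ n).support_normed_eq, mem_ball_zero_iff] at hb
    refine Metric.mem_cthickening_of_dist_le _ a r _ (subset_tsupport _ ha) ?_
    rw [dist_eq_norm, add_sub_cancel_left]
    refine hb.le.trans ?_
    simp only [φ]
    exact div_le_self hr.le (by linarith [(Nat.cast_nonneg n : (0 : ℝ) ≤ n)])
  · exact norm_convolution_le_of_bound (φ n).integrable_normed (φ n).nonneg_normed
      (φ n).integral_normed hC
  · rw [fderiv_convolution_lipschitz (φ n).contDiff_normed (φ n).hasCompactSupport_normed hW]
    exact norm_convolution_le_of_bound (φ n).integrable_normed (φ n).nonneg_normed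
      (φ n).integral_normed (fun z => norm_lineDeriv_le_of_lipschitz ℝ hW) y
  · exact ContDiffBump.convolution_tendsto_right_of_continuous hφ hW.continuous y
  · have hloc : LocallyIntegrable (fun z => lineDeriv ℝ W z v) μ :=
      (hW.memLp_lineDeriv v).locallyIntegrable le_top
    filter_upwards [ContDiffBump.ae_convolution_tendsto_right_of_locallyIntegrable hφ hφ' hloc,
      hW.ae_differentiableAt (μ := μ)] with y hy hd
    rw [hd.lineDeriv_eq_fderiv] at hy
    simpa only [fderiv_convolution_lipschitz (φ _).contDiff_normed
      (φ _).hasCompactSupport_normed hW] using hy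

/-- The distributional exterior derivative may be tested against Lipschitz functions. -/
theorem IsLocalWeakDeriv.lipschitz (hU : IsOpen U) {k : ℕ} {β : E → E [⋀^Fin k]→ₗ[ℝ] ℝ}
    {θ : E → E [⋀^Fin (k + 1)]→ₗ[ℝ] ℝ} (hβ : IsLocLp μ U 1 β) (hθ : IsLocLp μ U 1 θ)
    (hd : IsLocalWeakDeriv μ U β θ) {W : E → ℝ} {K : ℝ≥0} (hW : LipschitzWith K W)
    (hc : HasCompactSupport W) (hs : tsupport W ⊆ U) (v : Fin (k + 1) → E) :
    ∫ y, W y * θ y v ∂μ = -∫ y, lwedge (fderiv ℝ W y).toLinearMap (β y) v ∂μ := by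
  obtain ⟨Q, C, w, hQ, hQU, hWQ, hw, hlim, hlim'⟩ :=
    exists_smooth_approx_lipschitz μ hU hW hc hs
  have hβQ := fun v => (memLp_one_iff_integrable.1 (hβ Q hQ hQU v))
  have hθQ := memLp_one_iff_integrable.1 (hθ Q hQ hQU v)
  have res1 : ∀ {f : E → ℝ}, tsupport f ⊆ Q →
      ∫ y, f y * θ y v ∂μ = ∫ y in Q, f y * θ y v ∂μ := fun hf =>
    (setIntegral_eq_integral_of_forall_compl_eq_zero fun y hy => by
      rw [image_eq_zero_of_notMem_tsupport fun h => hy (hf h), zero_mul]).symm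
  have res2 : ∀ {f : E → ℝ}, tsupport f ⊆ Q →
      ∫ y, lwedge (fderiv ℝ f y).toLinearMap (β y) v ∂μ =
        ∫ y in Q, lwedge (fderiv ℝ f y).toLinearMap (β y) v ∂μ := fun hf =>
    (setIntegral_eq_integral_of_forall_compl_eq_zero fun y hy => by
      simp [lwedge_apply, image_eq_zero_of_notMem_tsupport
        (fun h => hy (hf (tsupport_fderiv_subset ℝ h)))]).symm
  have h1 : Tendsto (fun n => ∫ y in Q, w n y * θ y v ∂μ) atTop
      (𝓝 (∫ y in Q, W y * θ y v ∂μ)) := by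
    refine tendsto_integral_of_dominated_convergence (fun y => C * ‖θ y v‖)
      (fun n => (hw n).1.continuous.aestronglyMeasurable.mul hθQ.1) (hθQ.norm.const_mul C)
      (fun n => Eventually.of_forall fun y => ?_) (Eventually.of_forall fun y =>
        (hlim y).mul_const _)
    rw [norm_mul]
    exact mul_le_mul_of_nonneg_right ((hw n).2.2.1 y) (norm_nonneg _)
  have h2 : Tendsto (fun n => ∫ y in Q, lwedge (fderiv ℝ (w n) y).toLinearMap (β y) v ∂μ) atTop
      (𝓝 (∫ y in Q, lwedge (fderiv ℝ W y).toLinearMap (β y) v ∂μ)) := by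
    simp only [lwedge_apply]
    refine tendsto_integral_of_dominated_convergence
      (fun y => ∑ i, K * ‖v i‖ * ‖β y (fun j => v (i.succAbove j))‖)
      (fun n => ?_) (integrable_finsetSum _ fun i _ => (hβQ _).norm.const_mul _)
      (fun n => Eventually.of_forall fun y => ?_) ?_
    · refine Finset.aestronglyMeasurable_fun_sum _ fun i _ => AEStronglyMeasurable.const_mul ?_ _
      exact (((hw n).1.continuous_fderiv (by simp)).clm_apply
        continuous_const).aestronglyMeasurable.mul (hβQ _).1
    · refine (norm_sum_le _ _).trans (Finset.sum_le_sum fun i _ => ?_)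
      rw [norm_mul, norm_pow, norm_neg, norm_one, one_pow, one_mul, norm_mul]
      exact mul_le_mul_of_nonneg_right ((hw n).2.2.2 y _) (norm_nonneg _)
    · refine ae_restrict_of_ae ?_
      filter_upwards [ae_all_iff.2 fun i => hlim' (v i)] with y hy
      exact tendsto_finsetSum _ fun i _ => ((hy i).mul_const _).const_mul _
  rw [res1 hWQ, res2 hWQ]
  refine tendsto_nhds_unique h1 (h2.neg.congr fun n => ?_)
  rw [← res1 (hw n).2.1, ← res2 (hw n).2.1]
  exact (hd (w n) (hw n).1 (HasCompactSupport.of_support_subset_isCompact hQ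
    ((subset_tsupport _).trans (hw n).2.1)) ((hw n).2.1.trans hQU) v).symm

end LipschitzTest


section TopForms

/-- The quotient of two forms of maximal degree may be computed in any basis. -/
lemma apply_div_apply_eq {V : Type*} [AddCommGroup V] [Module ℝ V] {n : ℕ}
    (e : Module.Basis (Fin n) ℝ V) (α ν : V [⋀^Fin n]→ₗ[ℝ] ℝ) {w : Fin n → V} (hw : ν w ≠ 0) :
    α w / ν w = α e / ν e := by
  have h1 (β : V [⋀^Fin n]→ₗ[ℝ] ℝ) : β w = β e * e.det w := by
    conv_lhs => rw [β.eq_smul_basis_det e]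
    simp
  rw [h1 ν] at hw
  rw [h1 α, h1 ν, mul_div_mul_right _ _ (right_ne_zero_of_mul hw)]

variable {E : Type*} [NormedAddCommGroup E] [NormedSpace ℝ E] [FiniteDimensional ℝ E]
  {H : Type*} [TopologicalSpace H] {I : ModelWithCorners ℝ E H}
  {M : Type*} [TopologicalSpace M] [ChartedSpace H M]

/-- The quotient of two forms of maximal degree. -/
def topRatio (vol τ : DiffForm I M (Module.finrank ℝ E)) (x : M) : ℝ :=
  τ x (Module.finBasis ℝ E) / vol x (Module.finBasis ℝ E)

lemma topRatio_eq_zero (vol : DiffForm I M (Module.finrank ℝ E))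
    {τ : DiffForm I M (Module.finrank ℝ E)} {x : M} (h : τ x = 0) : topRatio vol τ x = 0 := by
  rw [topRatio, h]
  exact zero_div _

omit [FiniteDimensional ℝ E] in
lemma inChart_eq_zero {k : ℕ} {θ : DiffForm I M k} {x₀ : M} {y : E}
    (h : θ ((extChartAt I x₀).symm y) = 0) : inChart x₀ θ y = 0 := by
  rw [inChart, h]
  ext v
  rfl

lemma topRatio_eq (vol τ : DiffForm I M (Module.finrank ℝ E)) {x : M}
    {w : Fin (Module.finrank ℝ E) → TangentSpace I x} (hw : vol x w ≠ 0) :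
    topRatio vol τ x = τ x w / vol x w :=
  (apply_div_apply_eq (V := TangentSpace I x) (Module.finBasis ℝ E) (τ x) (vol x) hw).symm

lemma topRatio_chartSymm (vol τ : DiffForm I M (Module.finrank ℝ E)) {x₀ : M} {y : E}
    (h : inChart x₀ vol y (Module.finBasis ℝ E) ≠ 0) :
    topRatio vol τ ((extChartAt I x₀).symm y) =
      inChart x₀ τ y (Module.finBasis ℝ E) / inChart x₀ vol y (Module.finBasis ℝ E) :=
  topRatio_eq vol τ (w := fun i => dchart I x₀ y (Module.finBasis ℝ E i)) h

variable [I.Boundaryless] [IsManifold I ∞ M] {g : MetricField I M}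

lemma IsVolumeForm.abs_topRatio [MeasurableSpace E] [BorelSpace E] (hg : IsRiemMetric g)
    {vol : DiffForm I M (Module.finrank ℝ E)}
    (hvol : IsVolumeForm g vol) (τ : DiffForm I M (Module.finrank ℝ E)) (x : M) :
    |topRatio vol τ x| = formNorm (V := TangentSpace I x) (g x) (τ x) := by
  have h := (hg.scalar x).abs_apply_basis_eq (V := TangentSpace I x) (Module.finBasis ℝ E)
  have hpos := (hg.scalar x).det_gram_pos (V := TangentSpace I x) (Module.finBasis ℝ E)
  have h1 := h (τ x)
  have h2 := ((h (vol x)).trans (congrArg (· * _) (hvol.1 x))).trans (one_mul _)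
  rw [topRatio, abs_div]
  refine (congrArg₂ (· / ·) h1 h2).trans ?_
  exact mul_div_cancel_right₀ _ (Real.sqrt_pos.2 hpos).ne'

variable [MeasurableSpace E] [BorelSpace E]

lemma IsVolumeForm.abs_inChart (hg : IsRiemMetric g) {vol : DiffForm I M (Module.finrank ℝ E)}
    (hvol : IsVolumeForm g vol) {x₀ : M} {y : E} (hy : y ∈ (extChartAt I x₀).target) :
    |inChart x₀ vol y (Module.finBasis ℝ E)| = chartDensity g x₀ y := by
  rw [hg.abs_inChart_basis vol hy, hvol.1, one_mul]

lemma IsVolumeForm.inChart_ne_zero (hg : IsRiemMetric g)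
    {vol : DiffForm I M (Module.finrank ℝ E)} (hvol : IsVolumeForm g vol) {x₀ : M} {y : E}
    (hy : y ∈ (extChartAt I x₀).target) : inChart x₀ vol y (Module.finBasis ℝ E) ≠ 0 := by
  rw [← abs_pos, hvol.abs_inChart hg hy]
  exact hg.chartDensity_pos hy

variable [MeasurableSpace M] [BorelSpace M] [SecondCountableTopology M]

lemma IsVolumeForm.aestronglyMeasurable_inChart {vol : DiffForm I M (Module.finrank ℝ E)}
    (hvol : IsVolumeForm g vol) (x₀ : M) (v : Fin (Module.finrank ℝ E) → E) :
    AEStronglyMeasurable (fun y => inChart x₀ vol y v) (chartLebesgue I x₀) :=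
  (hvol.2 x₀ v).aestronglyMeasurable (isOpen_extChartAt_target x₀).measurableSet

lemma IsVolumeForm.aestronglyMeasurable_topRatio (hg : IsRiemMetric g)
    {vol : DiffForm I M (Module.finrank ℝ E)}
    (hvol : IsVolumeForm g vol) {τ : DiffForm I M (Module.finrank ℝ E)}
    (hτ : ∀ x₀ : M, AEStronglyMeasurable (fun y => inChart x₀ τ y (Module.finBasis ℝ E))
      (chartLebesgue I x₀)) : AEStronglyMeasurable (topRatio vol τ) (riemVolume g) := by
  refine hg.aestronglyMeasurable_of_chart fun x₀ => ?_
  refine ((hτ x₀).div₀ (hvol.aestronglyMeasurable_inChart x₀ (Module.finBasis ℝ E))).congr ?_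
  filter_upwards [ae_chartLebesgue_mem (I := I) x₀] with y hy
  exact (topRatio_chartSymm vol τ (hvol.inChart_ne_zero hg hy)).symm

lemma IsVolumeForm.integrable_topRatio (hg : IsRiemMetric g)
    {vol : DiffForm I M (Module.finrank ℝ E)} (hvol : IsVolumeForm g vol)
    {τ : DiffForm I M (Module.finrank ℝ E)} (hτ : IsLpForm g 1 τ) :
    Integrable (topRatio vol τ) (riemVolume g) := by
  have h1 := hg.memLp_formNorm hτ
  rw [ENNReal.ofReal_one, memLp_one_iff_integrable] at h1
  refine h1.mono' (hvol.aestronglyMeasurable_topRatio hg fun x₀ => hτ.1 x₀ _)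
    (Eventually.of_forall fun x => ?_)
  rw [Real.norm_eq_abs, hvol.abs_topRatio hg]

/-- Integrability of a function that vanishes outside of the domain of a chart. -/
lemma IsRiemMetric.integrable_riemVolume (hg : IsRiemMetric g) {f : M → ℝ}
    (hf : AEStronglyMeasurable f (riemVolume g)) {x₀ : M}
    (h0 : ∀ x, x ∉ (extChartAt I x₀).source → f x = 0)
    (h : Integrable (fun y => chartDensity g x₀ y * f ((extChartAt I x₀).symm y))
      (chartLebesgue I x₀)) : Integrable f (riemVolume g) := by
  have h1 : IntegrableOn f (extChartAt I x₀).source (riemVolume g) := by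
    have hm := hf.restrict (s := (extChartAt I x₀).source)
    rw [IntegrableOn]
    rw [hg.riemVolume_restrict, hg.chartMeasure_eq_map] at hm ⊢
    rw [integrable_map_measure hm (measurable_chartSymm x₀).aemeasurable,
      integrable_withDensity_iff_integrable_smul₀' (hg.aemeasurable_ofReal_chartDensity x₀)
        (by simp)]
    refine h.congr ?_
    filter_upwards [chartSymm_ae_eq (I := I) x₀, ae_chartLebesgue_mem (I := I) x₀] with y hy hyt
    rw [Function.comp_apply, hy, ENNReal.toReal_ofReal (hg.chartDensity_pos hyt).le, smul_eq_mul]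
  exact h1.integrable_of_forall_notMem_eq_zero h0

/-- Integration in a chart of a form of maximal degree with small support. -/
lemma IsVolumeForm.integral_topRatio_chart (hg : IsRiemMetric g)
    {vol : DiffForm I M (Module.finrank ℝ E)}
    (hvol : IsVolumeForm g vol) {τ : DiffForm I M (Module.finrank ℝ E)} {x₀ : M} {s : ℝ}
    (hs : |s| = 1) (hm : AEStronglyMeasurable (topRatio vol τ) (riemVolume g))
    (h0 : ∀ x, x ∉ (extChartAt I x₀).source → τ x = 0)
    (h1 : ∀ y ∈ (extChartAt I x₀).target, τ ((extChartAt I x₀).symm y) = 0 ∨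
      0 < s * inChart x₀ vol y (Module.finBasis ℝ E)) :
    ∫ x, topRatio vol τ x ∂(riemVolume g) =
        s * ∫ y, inChart x₀ τ y (Module.finBasis ℝ E) ∂(chartLebesgue I x₀) ∧
      (Integrable (fun y => inChart x₀ τ y (Module.finBasis ℝ E)) (chartLebesgue I x₀) →
        Integrable (topRatio vol τ) (riemVolume g)) := by
  have h0' : ∀ x, x ∉ (extChartAt I x₀).source → topRatio vol τ x = 0 := fun x hx => by
    exact topRatio_eq_zero vol (h0 x hx)
  have key : (fun y => chartDensity g x₀ y * topRatio vol τ ((extChartAt I x₀).symm y))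
      =ᵐ[chartLebesgue I x₀] fun y => s * inChart x₀ τ y (Module.finBasis ℝ E) := by
    filter_upwards [ae_chartLebesgue_mem (I := I) x₀] with y hy
    have hne := hvol.inChart_ne_zero hg hy
    rcases h1 y hy with hz | hpos
    · rw [topRatio_eq_zero vol hz, inChart_eq_zero hz, AlternatingMap.zero_apply, mul_zero,
        mul_zero]
    · rw [topRatio_chartSymm vol τ hne, ← hvol.abs_inChart hg hy]
      have h2 : |inChart x₀ vol y (Module.finBasis ℝ E)| =
          s * inChart x₀ vol y (Module.finBasis ℝ E) := by
        rw [← abs_of_pos hpos, abs_mul, hs, one_mul]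
      rw [h2]
      field_simp
  refine ⟨?_, fun hi => hg.integrable_riemVolume hm h0' ((hi.const_mul s).congr key.symm)⟩
  rw [hg.integral_riemVolume_eq hm h0', integral_congr_ae key, integral_const_mul]

end TopForms

section Bridge

variable {E : Type*} [NormedAddCommGroup E] [NormedSpace ℝ E] [FiniteDimensional ℝ E]
  [MeasurableSpace E] [BorelSpace E]
  {H : Type*} [TopologicalSpace H] {I : ModelWithCorners ℝ E H}
  {M : Type*} [TopologicalSpace M] [ChartedSpace H M]

lemma isWeakExtDeriv_iff {k : ℕ} {θ : DiffForm I M k} {η : DiffForm I M (k + 1)} :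
    IsWeakExtDeriv θ η ↔ ∀ x₀ : M, IsLocalWeakDeriv (Module.finBasis ℝ E).addHaar
      (extChartAt I x₀).target (inChart x₀ θ) (inChart x₀ η) := by
  refine forall_congr' fun x₀ => forall_congr' fun φ => forall_congr' fun _ =>
    forall_congr' fun _ => forall_congr' fun hs => forall_congr' fun v => ?_
  have h1 : ∫ y, φ y * inChart x₀ η y v ∂(chartLebesgue I x₀) =
      ∫ y, φ y * inChart x₀ η y v ∂(Module.finBasis ℝ E).addHaar :=
    setIntegral_eq_integral_of_forall_compl_eq_zero fun y hy => by
      rw [image_eq_zero_of_notMem_tsupport fun h => hy (hs h), zero_mul]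
  have h2 : ∫ y, ∑ i : Fin (k + 1), (-1 : ℝ) ^ (i : ℕ) *
      (fderiv ℝ φ y (v i) * inChart x₀ θ y (fun j => v (i.succAbove j))) ∂(chartLebesgue I x₀) =
      ∫ y, lwedge (fderiv ℝ φ y).toLinearMap (inChart x₀ θ y) v ∂(Module.finBasis ℝ E).addHaar := by
    simp only [lwedge_apply]
    exact setIntegral_eq_integral_of_forall_compl_eq_zero fun y hy => by
      simp [image_eq_zero_of_notMem_tsupport
        (fun h => hy (hs (tsupport_fderiv_subset ℝ h)))]
  rw [h1, h2]

variable [I.Boundaryless] [IsManifold I ∞ M] [MeasurableSpace M] [BorelSpace M]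
  [SecondCountableTopology M]

lemma IsRiemMetric.isLocLp_inChart {g : MetricField I M} (hg : IsRiemMetric g) {p : ℝ} {k : ℕ}
    {θ : DiffForm I M k} (hθ : IsLpForm g p θ) (x₀ : M) :
    IsLocLp (Module.finBasis ℝ E).addHaar (extChartAt I x₀).target (ENNReal.ofReal p)
      (inChart x₀ θ) := fun _ hK hKt v => hg.memLp_inChart hθ hK hKt v

end Bridge

section Lipschitz

open scoped NNReal

lemma LocallyLipschitz.exists_lipschitzWith {E : Type*} [NormedAddCommGroup E] [NormedSpace ℝ E]
    [FiniteDimensional ℝ E] {W : E → ℝ} (h : LocallyLipschitz W) (hc : HasCompactSupport W) :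
    ∃ K : ℝ≥0, LipschitzWith K W := by
  have : ProperSpace E := FiniteDimensional.proper_real E
  set Q := tsupport W
  have hQ' : IsCompact (Metric.cthickening 1 Q) := hc.isCompact.cthickening
  obtain ⟨K, hK⟩ := (h.locallyLipschitzOn (s := Metric.cthickening 1 Q)).exists_lipschitzOnWith_of_compact hQ'
  obtain ⟨C, hC⟩ := h.continuous.bounded_above_of_compact_support hc
  have hC0 : 0 ≤ C := (norm_nonneg _).trans (hC 0)
  have aux : ∀ x y, x ∈ Q → y ∉ Metric.cthickening 1 Q →
      dist (W x) (W y) ≤ C * dist x y := by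
    intro x y hx hy
    have h1 : W y = 0 := image_eq_zero_of_notMem_tsupport fun h =>
      hy (Metric.self_subset_cthickening _ h)
    have h2 : 1 < dist y x := by
      by_contra! h
      exact hy (Metric.mem_cthickening_of_dist_le y x 1 Q hx h)
    rw [h1, dist_zero_right, dist_comm x y]
    calc _ ≤ C * 1 := by simpa using hC x
      _ ≤ _ := by gcongr
  refine ⟨K + C.toNNReal, LipschitzWith.of_dist_le_mul fun x y => ?_⟩
  have hxy : 0 ≤ dist x y := dist_nonneg
  have e1 : ((K + C.toNNReal : ℝ≥0) : ℝ) * dist x y = K * dist x y + C * dist x y := by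
    rw [NNReal.coe_add, add_mul, Real.coe_toNNReal C hC0]
  have e2 : 0 ≤ (K : ℝ) * dist x y := by positivity
  have e3 : 0 ≤ C * dist x y := by positivity
  rw [e1]
  by_cases hx : x ∈ Metric.cthickening 1 Q <;> by_cases hy : y ∈ Metric.cthickening 1 Q
  · linarith [hK.dist_le_mul x hx y hy]
  · by_cases hx' : x ∈ Q
    · linarith [aux x y hx' hy]
    · rw [image_eq_zero_of_notMem_tsupport hx', image_eq_zero_of_notMem_tsupport fun h =>
        hy (Metric.self_subset_cthickening _ h), dist_self]
      positivity
  · by_cases hy' : y ∈ Q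
    · rw [dist_comm, dist_comm x y]
      have := aux y x hy' hx
      rw [dist_comm x y] at e2
      linarith
    · rw [image_eq_zero_of_notMem_tsupport hy', image_eq_zero_of_notMem_tsupport fun h =>
        hx (Metric.self_subset_cthickening _ h), dist_self]
      positivity
  · rw [image_eq_zero_of_notMem_tsupport fun h => hx (Metric.self_subset_cthickening _ h),
      image_eq_zero_of_notMem_tsupport fun h => hy (Metric.self_subset_cthickening _ h), dist_self]
    positivity

end Lipschitz


section Gaffney

open scoped NNReal

variable {E : Type*} [NormedAddCommGroup E] [NormedSpace ℝ E] [FiniteDimensional ℝ E]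
  [MeasurableSpace E] [BorelSpace E]
  {H : Type*} [TopologicalSpace H] {I : ModelWithCorners ℝ E H} [I.Boundaryless]
  {M : Type*} [TopologicalSpace M] [ChartedSpace H M] [IsManifold I ∞ M]

/-- The differential of a function. -/
def differential (I : ModelWithCorners ℝ E H) (w : M → ℝ) (x : M) : TangentSpace I x →ₗ[ℝ] ℝ :=
  (mfderiv I 𝓘(ℝ, ℝ) w x).toLinearMap

lemma mdifferentiableAt_of_chart {w : M → ℝ} {x₀ : M} {y : E} (hy : y ∈ (extChartAt I x₀).target)
    (hd : DifferentiableAt ℝ (fun z => w ((extChartAt I x₀).symm z)) y) :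
    MDifferentiableAt I 𝓘(ℝ, ℝ) w ((extChartAt I x₀).symm y) := by
  have hx : (extChartAt I x₀).symm y ∈ (extChartAt I x₀).source := (extChartAt I x₀).map_target hy
  have hy' : extChartAt I x₀ ((extChartAt I x₀).symm y) = y := (extChartAt I x₀).right_inv hy
  have h1 : MDifferentiableAt I 𝓘(ℝ, E) (extChartAt I x₀) ((extChartAt I x₀).symm y) :=
    mdifferentiableAt_extChartAt (by rwa [extChartAt_source] at hx)
  have h2 : MDifferentiableAt I 𝓘(ℝ, ℝ)
      ((fun z => w ((extChartAt I x₀).symm z)) ∘ extChartAt I x₀) ((extChartAt I x₀).symm y) :=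
    MDifferentiableAt.comp _ (by rw [hy']; exact hd.mdifferentiableAt) h1
  refine h2.congr_of_eventuallyEq ?_
  filter_upwards [(isOpen_extChartAt_source (I := I) x₀).mem_nhds hx] with x hx
  exact congrArg w ((extChartAt I x₀).left_inv hx).symm

lemma differential_comp_dchart {w : M → ℝ} {x₀ : M} {y : E} (hy : y ∈ (extChartAt I x₀).target)
    (hd : DifferentiableAt ℝ (fun z => w ((extChartAt I x₀).symm z)) y) (v : E) :
    differential I w ((extChartAt I x₀).symm y) (dchart I x₀ y v) =
      fderiv ℝ (fun z => w ((extChartAt I x₀).symm z)) y v := by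
  have h := mfderiv_comp y (mdifferentiableAt_of_chart hy hd) (mdifferentiableAt_chart_symm hy)
  have h' := congrArg (fun L => L v) h
  rw [mfderiv_eq_fderiv] at h'
  exact h'.symm

lemma differential_eq_zero {w : M → ℝ} {x : M} (hx : x ∉ tsupport w) : differential I w x = 0 := by
  have h1 : w =ᶠ[𝓝 x] fun _ => (0 : ℝ) := notMem_tsupport_iff_eventuallyEq.1 hx
  have h2 : mfderiv I 𝓘(ℝ, ℝ) w x = 0 := by
    rw [h1.mfderiv_eq, mfderiv_const]
    rfl
  rw [differential, h2]
  rfl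

/-- The form `dw ∧ κ`. -/
def dwedge {k : ℕ} (w : M → ℝ) (κ : DiffForm I M k) : DiffForm I M (k + 1) := fun x =>
  lwedge (V := TangentSpace I x) (differential I w x) (κ x)

lemma inChart_dwedge {k : ℕ} {w : M → ℝ} {κ : DiffForm I M k} {x₀ : M} {y : E}
    (hy : y ∈ (extChartAt I x₀).target)
    (hd : DifferentiableAt ℝ (fun z => w ((extChartAt I x₀).symm z)) y) :
    inChart x₀ (dwedge w κ) y =
      lwedge (fderiv ℝ (fun z => w ((extChartAt I x₀).symm z)) y).toLinearMap (inChart x₀ κ y) := by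
  ext v
  rw [lwedge_apply]
  refine (lwedge_apply (V := TangentSpace I ((extChartAt I x₀).symm y)) _ _ _).trans ?_
  refine Finset.sum_congr rfl fun i _ => ?_
  have h := differential_comp_dchart hy hd (v i)
  exact congrArg (fun a => (-1 : ℝ) ^ (i : ℕ) * (a * _)) h

lemma dwedge_eq_zero {k : ℕ} {w : M → ℝ} {κ : DiffForm I M k} {x : M} (hx : x ∉ tsupport w) :
    dwedge w κ x = 0 := by
  rw [dwedge, differential_eq_zero hx]
  ext v
  refine (lwedge_apply (V := TangentSpace I x) _ _ _).trans ?_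
  refine Finset.sum_eq_zero fun i _ => ?_
  exact (congrArg ((-1 : ℝ) ^ (i : ℕ) * ·) (zero_mul _)).trans (mul_zero _)

/-- A change of degree of a differential form. -/
abbrev castForm {k l : ℕ} (h : k = l) (τ : DiffForm I M k) : DiffForm I M l := fun x =>
  castDeg (V := TangentSpace I x) h (τ x)

lemma inChart_castForm {k l : ℕ} (h : k = l) (τ : DiffForm I M k) (x₀ : M) (y : E)
    (v : Fin l → E) : inChart x₀ (castForm h τ) y v = inChart x₀ τ y (fun i => v (Fin.cast h i)) :=
  rfl

variable [T2Space M]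

/-- A function with compact support in the domain of a chart is Lipschitz in this chart as soon
as it is locally. -/
lemma exists_lipschitz_chart {w : M → ℝ} {x₀ : M} (hc : HasCompactSupport w)
    (hs : tsupport w ⊆ (extChartAt I x₀).source)
    (hl : ∀ y ∈ (extChartAt I x₀).target, ∃ K : ℝ≥0, ∃ t ∈ 𝓝 y,
      LipschitzOnWith K (fun z => w ((extChartAt I x₀).symm z)) t) :
    ∃ (W : E → ℝ) (K : ℝ≥0), LipschitzWith K W ∧ HasCompactSupport W ∧
      tsupport W ⊆ (extChartAt I x₀).target ∧
      ∀ y ∈ (extChartAt I x₀).target, W y = w ((extChartAt I x₀).symm y) := by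
  classical
  set σ := (extChartAt I x₀).symm
  set Q := extChartAt I x₀ '' tsupport w with hQdef
  have hQ : IsCompact Q :=
    hc.isCompact.image_of_continuousOn ((continuousOn_extChartAt x₀).mono hs)
  have hQt : Q ⊆ (extChartAt I x₀).target := by
    rintro _ ⟨x, hx, rfl⟩
    exact (extChartAt I x₀).map_source (hs hx)
  set W : E → ℝ := (extChartAt I x₀).target.indicator fun y => w (σ y) with hW
  have hWt : ∀ y ∈ (extChartAt I x₀).target, W y = w (σ y) := fun y hy => indicator_of_mem hy _
  have hsupp : Function.support W ⊆ Q := by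
    intro y hy
    have hyt : y ∈ (extChartAt I x₀).target := by
      by_contra h
      exact hy (indicator_of_notMem h _)
    refine ⟨σ y, subset_tsupport _ ?_, (extChartAt I x₀).right_inv hyt⟩
    rw [Function.mem_support, ← hWt y hyt]
    exact hy
  have hts : tsupport W ⊆ Q := closure_minimal hsupp hQ.isClosed
  have hcW : HasCompactSupport W := HasCompactSupport.of_support_subset_isCompact hQ hsupp
  have hloc : LocallyLipschitz W := by
    intro y
    by_cases hy : y ∈ (extChartAt I x₀).target
    · obtain ⟨K, t, ht, hK⟩ := hl y hy
      refine ⟨K, t ∩ (extChartAt I x₀).target,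
        inter_mem ht ((isOpen_extChartAt_target x₀).mem_nhds hy), ?_⟩
      intro a ha b hb
      rw [hWt a ha.2, hWt b hb.2]
      exact hK ha.1 hb.1
    · refine ⟨0, Qᶜ, hQ.isClosed.isOpen_compl.mem_nhds fun h => hy (hQt h), ?_⟩
      intro a ha b hb
      have h1 : W a = 0 := by by_contra h; exact ha (hsupp h)
      have h2 : W b = 0 := by by_contra h; exact hb (hsupp h)
      simp [h1, h2]
  obtain ⟨K, hK⟩ := LocallyLipschitz.exists_lipschitzWith hloc hcW
  exact ⟨W, K, hK, hcW, hts.trans hQt, hWt⟩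

variable [MeasurableSpace M] [BorelSpace M] [SecondCountableTopology M] {g : MetricField I M}

lemma IsRiemMetric.aestronglyMeasurable_of_support (hg : IsRiemMetric g) {f : M → ℝ} {x₀ : M}
    (h0 : ∀ x, x ∉ (extChartAt I x₀).source → f x = 0)
    (h : AEStronglyMeasurable (fun y => f ((extChartAt I x₀).symm y)) (chartLebesgue I x₀)) :
    AEStronglyMeasurable f (riemVolume g) := by
  have h1 := hg.aestronglyMeasurable_chartMeasure h
  rw [← hg.riemVolume_restrict, ← aestronglyMeasurable_indicator_iff (measurableSet_source x₀)] at h1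
  refine h1.congr (Eventually.of_forall fun x => ?_)
  by_cases hx : x ∈ (extChartAt I x₀).source
  · exact indicator_of_mem hx _
  · rw [h0 x hx]
    exact indicator_of_notMem hx _

/-- Integration by parts in a chart. -/
lemma IsVolumeForm.integral_mul_topRatio (hg : IsRiemMetric g)
    {vol : DiffForm I M (Module.finrank ℝ E)} (hvol : IsVolumeForm g vol) {m : ℕ}
    (h : m + 1 = Module.finrank ℝ E) {κ : DiffForm I M m} {τ : DiffForm I M (m + 1)}
    (hκ : IsLpForm g 1 κ) (hτ : IsLpForm g 1 τ) (hd : IsWeakExtDeriv κ τ) {w : M → ℝ}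
    (hwc : Continuous w) {x₀ : M} {s : ℝ} (hs : |s| = 1) (hc : HasCompactSupport w)
    (hsup : tsupport w ⊆ (extChartAt I x₀).source)
    (hsign : ∀ x ∈ tsupport w, 0 < s * inChart x₀ vol (extChartAt I x₀ x) (Module.finBasis ℝ E))
    (hl : ∀ y ∈ (extChartAt I x₀).target, ∃ K : ℝ≥0, ∃ t ∈ 𝓝 y,
      LipschitzOnWith K (fun z => w ((extChartAt I x₀).symm z)) t) :
    Integrable (topRatio vol (castForm h (dwedge w κ))) (riemVolume g) ∧
    ∫ x, w x * topRatio vol (castForm h τ) x ∂(riemVolume g) =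
      -∫ x, topRatio vol (castForm h (dwedge w κ)) x ∂(riemVolume g) := by
  obtain ⟨W, K, hK, hcW, hWs, hW⟩ := exists_lipschitz_chart hc hsup hl
  have hto : IsOpen (extChartAt I x₀).target := isOpen_extChartAt_target x₀
  set v : Fin (m + 1) → E := fun i => Module.finBasis ℝ E (Fin.cast h i) with hv
  set ν := (Module.finBasis ℝ E).addHaar with hν
  have hκl := hg.isLocLp_inChart hκ x₀
  have hτl := hg.isLocLp_inChart hτ x₀
  rw [ENNReal.ofReal_one] at hκl hτl
  have hparts := (isWeakExtDeriv_iff.1 hd x₀).lipschitz hto hκl hτl hK hcW hWs v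
  have hWd : ∀ y ∈ (extChartAt I x₀).target,
      (fun z => w ((extChartAt I x₀).symm z)) =ᶠ[𝓝 y] W := fun y hy => by
    filter_upwards [hto.mem_nhds hy] with z hz using (hW z hz).symm
  have hdw : ∀ᵐ y ∂(chartLebesgue I x₀),
      inChart x₀ (castForm h (dwedge w κ)) y (Module.finBasis ℝ E) =
        lwedge (fderiv ℝ W y).toLinearMap (inChart x₀ κ y) v := by
    filter_upwards [ae_chartLebesgue_mem (I := I) x₀,
      ae_restrict_of_ae (hK.ae_differentiableAt (μ := ν))] with y hy hdy
    rw [inChart_castForm, inChart_dwedge hy ((hWd y hy).differentiableAt_iff.2 hdy),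
      (hWd y hy).fderiv_eq]
  have hmeas : AEStronglyMeasurable (fun y => lwedge (fderiv ℝ W y).toLinearMap (inChart x₀ κ y) v)
      (chartLebesgue I x₀) := by
    simp only [lwedge_apply]
    exact Finset.aestronglyMeasurable_fun_sum _ fun i _ => AEStronglyMeasurable.const_mul
      ((measurable_fderiv_apply_const ℝ W (v i)).aestronglyMeasurable.mul (hκ.1 x₀ _)) _
  have hint : Integrable (fun y => lwedge (fderiv ℝ W y).toLinearMap (inChart x₀ κ y) v)
      (chartLebesgue I x₀) := by
    have h1 : IntegrableOn (fun y => lwedge (fderiv ℝ W y).toLinearMap (inChart x₀ κ y) v)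
        (tsupport W) ν := by
      simp only [lwedge_apply]
      refine integrable_finsetSum _ fun i _ => Integrable.const_mul ?_ _
      refine Integrable.bdd_mul (c := K * ‖v i‖)
        (memLp_one_iff_integrable.1 (hκl _ hcW.isCompact hWs _))
        (measurable_fderiv_apply_const ℝ W (v i)).aestronglyMeasurable
        (Eventually.of_forall fun y => ?_)
      exact (ContinuousLinearMap.le_opNorm _ _).trans (mul_le_mul_of_nonneg_right
        (norm_fderiv_le_of_lipschitz ℝ hK) (norm_nonneg _))
    refine (h1.integrable_of_forall_notMem_eq_zero fun y hy => ?_).restrict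
    simp [lwedge_apply, image_eq_zero_of_notMem_tsupport
      (fun h => hy (tsupport_fderiv_subset ℝ h))]
  have h0 : ∀ x, x ∉ (extChartAt I x₀).source → castForm h (dwedge w κ) x = 0 := fun x hx => by
    rw [castForm, dwedge_eq_zero fun h => hx (hsup h)]
    rfl
  have hsgn : ∀ y ∈ (extChartAt I x₀).target, (extChartAt I x₀).symm y ∈ tsupport w →
      0 < s * inChart x₀ vol y (Module.finBasis ℝ E) := fun y hy hyw => by
    have := hsign _ hyw
    rwa [(extChartAt I x₀).right_inv hy] at this
  have hm1 : AEStronglyMeasurable (topRatio vol (castForm h (dwedge w κ))) (riemVolume g) := by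
    refine hg.aestronglyMeasurable_of_support (x₀ := x₀)
      (fun x hx => topRatio_eq_zero vol (h0 x hx)) ?_
    refine (hmeas.div₀ (hvol.aestronglyMeasurable_inChart x₀ (Module.finBasis ℝ E))).congr ?_
    filter_upwards [ae_chartLebesgue_mem (I := I) x₀, hdw] with y hy hy'
    rw [topRatio_chartSymm vol _ (hvol.inChart_ne_zero hg hy), hy']
    rfl
  obtain ⟨e1, i1⟩ := hvol.integral_topRatio_chart hg hs hm1 h0 fun y hy => by
    by_cases hyw : (extChartAt I x₀).symm y ∈ tsupport w
    · exact Or.inr (hsgn y hy hyw)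
    · left
      rw [castForm, dwedge_eq_zero hyw]
      rfl
  set τ₁ : DiffForm I M (Module.finrank ℝ E) := fun x => w x • castForm h τ x with hτ₁
  have hr : topRatio vol τ₁ = fun x => w x * topRatio vol (castForm h τ) x := by
    funext x
    exact mul_div_assoc _ _ _
  have hm2 : AEStronglyMeasurable (topRatio vol τ₁) (riemVolume g) := by
    rw [hr]
    exact hwc.aestronglyMeasurable.mul
      (hvol.aestronglyMeasurable_topRatio hg fun x₁ => hτ.1 x₁ _)
  have h0' : ∀ x, x ∉ tsupport w → τ₁ x = 0 := fun x hx => by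
    rw [hτ₁]
    simp only [image_eq_zero_of_notMem_tsupport hx]
    exact zero_smul ℝ _
  obtain ⟨e2, -⟩ := hvol.integral_topRatio_chart hg hs hm2 (fun x hx => h0' x fun h => hx (hsup h))
    fun y hy => by
      by_cases hyw : (extChartAt I x₀).symm y ∈ tsupport w
      · exact Or.inr (hsgn y hy hyw)
      · exact Or.inl (h0' _ hyw)
  refine ⟨i1 (hint.congr (hdw.mono fun y hy => hy.symm)), ?_⟩
  rw [e1, integral_congr_ae hdw, ← integral_congr_ae (Eventually.of_forall fun x => congrFun hr x),
    e2, ← mul_neg]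
  congr 1
  have r1 : ∫ y, inChart x₀ τ₁ y (Module.finBasis ℝ E) ∂(chartLebesgue I x₀) =
      ∫ y, W y * inChart x₀ τ y v ∂ν := by
    rw [← setIntegral_eq_integral_of_forall_compl_eq_zero
      (s := (extChartAt I x₀).target) (μ := ν) fun y hy => by
        rw [image_eq_zero_of_notMem_tsupport fun h => hy (hWs h), zero_mul]]
    refine integral_congr_ae ?_
    filter_upwards [ae_chartLebesgue_mem (I := I) x₀] with y hy
    rw [hW y hy]
    rfl
  have r2 : ∫ y, lwedge (fderiv ℝ W y).toLinearMap (inChart x₀ κ y) v ∂(chartLebesgue I x₀) =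
      ∫ y, lwedge (fderiv ℝ W y).toLinearMap (inChart x₀ κ y) v ∂ν :=
    setIntegral_eq_integral_of_forall_compl_eq_zero fun y hy => by
      simp [lwedge_apply, image_eq_zero_of_notMem_tsupport
        (fun h => hy (hWs (tsupport_fderiv_subset ℝ h)))]
  rw [r1, r2, hparts]

end Gaffney

lemma IsScalarProduct.exists_sqrt_le {V : Type*} [NormedAddCommGroup V] [NormedSpace ℝ V]
    [FiniteDimensional ℝ V] {g : V → V → ℝ} (hg : IsScalarProduct g) :
    ∃ C : ℝ, 0 ≤ C ∧ ∀ w, √(g w w) ≤ C * ‖w‖ := by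
  set e := Module.finBasis ℝ V
  have h1 (i : Fin (Module.finrank ℝ V)) : ∃ C : ℝ, 0 < C ∧ ∀ w : V, |e.repr w i| ≤ C * ‖w‖ := by
    obtain ⟨C, hC, h⟩ := (LinearMap.toContinuousLinearMap (e.coord i)).isBoundedLinearMap.bound
    exact ⟨C, hC, h⟩
  choose C hC h using h1
  set D := ∑ i, ∑ j, C i * C j * |g (e i) (e j)|
  have hD : 0 ≤ D := Finset.sum_nonneg fun i _ => Finset.sum_nonneg fun j _ =>
    mul_nonneg (mul_nonneg (hC i).le (hC j).le) (abs_nonneg _)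
  refine ⟨√D, Real.sqrt_nonneg _, fun w => ?_⟩
  rw [← Real.sqrt_sq (norm_nonneg w), ← Real.sqrt_mul hD]
  refine Real.sqrt_le_sqrt ?_
  have hexp : g w w = ∑ i, ∑ j, e.repr w i * e.repr w j * g (e i) (e j) := by
    conv_lhs => rw [← e.sum_repr w]
    rw [hg.sum_left]
    refine Finset.sum_congr rfl fun i _ => ?_
    rw [hg.sum_right]
    refine Finset.sum_congr rfl fun j _ => ?_
    rw [hg.smul_left, hg.smul_right, mul_assoc]
  rw [hexp, Finset.sum_mul]
  refine Finset.sum_le_sum fun i _ => ?_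
  rw [Finset.sum_mul]
  refine Finset.sum_le_sum fun j _ => (le_abs_self _).trans ?_
  rw [abs_mul, abs_mul]
  calc _ ≤ (C i * ‖w‖) * (C j * ‖w‖) * |g (e i) (e j)| := by
        exact mul_le_mul_of_nonneg_right (mul_le_mul (h i w) (h j w) (abs_nonneg _)
          (mul_nonneg (hC i).le (norm_nonneg _))) (abs_nonneg _)
    _ = _ := by ring

open scoped NNReal in
lemma exists_lipschitzOnWith_mul {E : Type*} [NormedAddCommGroup E] {f f' : E → ℝ} {y : E}
    (h : ∃ K : ℝ≥0, ∃ t ∈ 𝓝 y, LipschitzOnWith K f t)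
    (h' : ∃ K : ℝ≥0, ∃ t ∈ 𝓝 y, LipschitzOnWith K f' t) :
    ∃ K : ℝ≥0, ∃ t ∈ 𝓝 y, LipschitzOnWith K (fun z => f z * f' z) t := by
  obtain ⟨K, t, ht, hK⟩ := h
  obtain ⟨K', t', ht', hK'⟩ := h'
  have b1 : ∀ᶠ z in 𝓝 y, |f z| < |f y| + 1 :=
    ((hK.continuousOn.continuousAt ht).abs).eventually_lt_const (by linarith)
  have b2 : ∀ᶠ z in 𝓝 y, |f' z| < |f' y| + 1 :=
    ((hK'.continuousOn.continuousAt ht').abs).eventually_lt_const (by linarith)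
  refine ⟨(|f y| + 1).toNNReal * K' + (|f' y| + 1).toNNReal * K, _,
    inter_mem (inter_mem ht ht') (b1.and b2), LipschitzOnWith.of_dist_le_mul fun a ha b hb => ?_⟩
  have e1 := hK.dist_le_mul a ha.1.1 b hb.1.1
  have e2 := hK'.dist_le_mul a ha.1.2 b hb.1.2
  rw [Real.dist_eq] at e1 e2 ⊢
  have : f a * f' a - f b * f' b = f a * (f' a - f' b) + f' b * (f a - f b) := by ring
  rw [this]
  push_cast
  rw [Real.coe_toNNReal _ (by positivity), Real.coe_toNNReal _ (by positivity)]
  calc _ ≤ |f a| * |f' a - f' b| + |f' b| * |f a - f b| := by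
        rw [← abs_mul, ← abs_mul]; exact abs_add_le _ _
    _ ≤ (|f y| + 1) * (K' * dist a b) + (|f' y| + 1) * (K * dist a b) := by
        gcongr
        · exact ha.2.1.le
        · exact hb.2.2.le
    _ = _ := by ring

section GradBound

open scoped NNReal

variable {E : Type*} [NormedAddCommGroup E] [NormedSpace ℝ E] [FiniteDimensional ℝ E]
  [MeasurableSpace E] [BorelSpace E]
  {H : Type*} [TopologicalSpace H] {I : ModelWithCorners ℝ E H} [I.Boundaryless]
  {M : Type*} [TopologicalSpace M] [ChartedSpace H M] [IsManifold I ∞ M]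
  {g : MetricField I M} {ε : ℝ} {u : M → ℝ}

lemma HasGradBound.exists_lipschitzOnWith (hg : IsRiemMetric g) (hε : 0 ≤ ε)
    (hu : HasGradBound g ε u) {x₀ : M} {y : E} (hy : y ∈ (extChartAt I x₀).target) :
    ∃ K : ℝ≥0, ∃ t ∈ 𝓝 y, LipschitzOnWith K (fun z => u ((extChartAt I x₀).symm z)) t := by
  have hsc := (hg.scalar ((extChartAt I x₀).symm y)).comp_injective
    (L := (dchart I x₀ y).toLinearMap) fun a b h => (chartEquiv hy).injective (by
      rw [chartEquiv_apply, chartEquiv_apply]; exact h)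
  obtain ⟨C, hC, hCw⟩ := hsc.exists_sqrt_le
  have hev := hu x₀ y hy 1 one_pos
  rw [nhds_prod_eq] at hev
  obtain ⟨t, ht, ht'⟩ := Filter.mem_prod_self_iff.1 hev
  refine ⟨(ε * (C + 1)).toNNReal, t, ht, LipschitzOnWith.of_dist_le_mul fun a ha b hb => ?_⟩
  rw [Real.coe_toNNReal _ (by positivity), Real.dist_eq, dist_eq_norm]
  refine (ht' (show (a, b) ∈ t ×ˢ t from ⟨ha, hb⟩) : _ ≤ _).trans ?_
  have := hCw (a - b)
  calc _ ≤ ε * (C * ‖a - b‖ + 1 * ‖a - b‖) := by gcongr; exact this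
    _ = _ := by ring

lemma HasGradBound.ae_differentiableAt (hg : IsRiemMetric g) (hε : 0 ≤ ε)
    (hu : HasGradBound g ε u) (x₀ : M) : ∀ᵐ y ∂(chartLebesgue I x₀),
      DifferentiableAt ℝ (fun z => u ((extChartAt I x₀).symm z)) y := by
  rw [chartLebesgue, ae_restrict_iff' (isOpen_extChartAt_target x₀).measurableSet]
  refine measure_null_of_locally_null _ fun y hy => ?_
  simp only [mem_compl_iff, mem_ofPred_eq, Classical.not_imp] at hy
  obtain ⟨K, t, ht, hK⟩ := hu.exists_lipschitzOnWith hg hε hy.1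
  refine ⟨_, inter_mem self_mem_nhdsWithin
    (mem_nhdsWithin_of_mem_nhds (interior_mem_nhds.2 ht)), ?_⟩
  refine measure_mono_null ?_ (hK.ae_differentiableWithinAt_of_mem
    (μ := (Module.finBasis ℝ E).addHaar))
  rintro z ⟨hz, hzt⟩ h
  simp only [mem_compl_iff, mem_ofPred_eq, Classical.not_imp] at hz
  exact hz.2 ((h (interior_subset hzt)).differentiableAt (mem_interior_iff_mem_nhds.1 hzt))

lemma HasGradBound.abs_fderiv_le (hg : IsRiemMetric g) (hε : 0 ≤ ε)
    (hu : HasGradBound g ε u) {x₀ : M} {y : E} (hy : y ∈ (extChartAt I x₀).target)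
    (hd : DifferentiableAt ℝ (fun z => u ((extChartAt I x₀).symm z)) y) (v : E) :
    |fderiv ℝ (fun z => u ((extChartAt I x₀).symm z)) y v| ≤
      ε * √(g ((extChartAt I x₀).symm y) (dchart I x₀ y v) (dchart I x₀ y v)) := by
  have hs := hg.scalar ((extChartAt I x₀).symm y)
  have key : ∀ δ : ℝ, 0 < δ → |fderiv ℝ (fun z => u ((extChartAt I x₀).symm z)) y v| ≤
      ε * (√(g ((extChartAt I x₀).symm y) (dchart I x₀ y v) (dchart I x₀ y v)) + δ * ‖v‖) := by
    intro δ hδ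
    have h1 : HasFDerivAt (fun t : ℝ => u ((extChartAt I x₀).symm (y + t • v)))
        ((fderiv ℝ (fun z => u ((extChartAt I x₀).symm z)) y).comp
          (ContinuousLinearMap.toSpanSingleton ℝ v)) 0 := by
      have h2 : HasFDerivAt (fun t : ℝ => y + t • v) (ContinuousLinearMap.toSpanSingleton ℝ v) 0 :=
        ((ContinuousLinearMap.toSpanSingleton ℝ v).hasFDerivAt).const_add y
      refine HasFDerivAt.comp (g := fun z => u ((extChartAt I x₀).symm z)) (0 : ℝ) ?_ h2
      simpa using hd.hasFDerivAt
    have h2 : ∀ᶠ t : ℝ in 𝓝 0, ‖u ((extChartAt I x₀).symm (y + t • v)) -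
        u ((extChartAt I x₀).symm (y + (0 : ℝ) • v))‖ ≤
        (ε * (√(g ((extChartAt I x₀).symm y) (dchart I x₀ y v) (dchart I x₀ y v)) + δ * ‖v‖)) *
          ‖t - 0‖ := by
      have h3 : Tendsto (fun t : ℝ => (y + t • v, y)) (𝓝 0) (𝓝 (y, y)) := by
        have : Continuous fun t : ℝ => (y + t • v, y) := by fun_prop
        simpa using this.tendsto 0
      filter_upwards [h3.eventually (hu x₀ y hy δ hδ)] with t ht
      rw [zero_smul, add_zero, sub_zero, Real.norm_eq_abs, Real.norm_eq_abs]
      refine ht.trans_eq ?_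
      have e1 : (y + t • v, y).1 - (y + t • v, y).2 = t • v := by simp
      rw [e1, map_smul, hs.smul_left, hs.smul_right, ← mul_assoc, ← sq,
        Real.sqrt_mul (sq_nonneg t), Real.sqrt_sq_eq_abs, norm_smul, Real.norm_eq_abs]
      ring
    have h3 := h1.le_of_lip' (by positivity) h2
    have h4 := (ContinuousLinearMap.le_opNorm _ (1 : ℝ)).trans
      (mul_le_mul_of_nonneg_right h3 (norm_nonneg _))
    simpa using h4
  have hlim : Tendsto (fun δ : ℝ => ε * (√(g ((extChartAt I x₀).symm y) (dchart I x₀ y v)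
      (dchart I x₀ y v)) + δ * ‖v‖)) (𝓝[>] 0) (𝓝 (ε * √(g ((extChartAt I x₀).symm y)
      (dchart I x₀ y v) (dchart I x₀ y v)))) := by
    have : Continuous fun δ : ℝ => ε * (√(g ((extChartAt I x₀).symm y) (dchart I x₀ y v)
      (dchart I x₀ y v)) + δ * ‖v‖) := by fun_prop
    have h5 := this.tendsto 0
    simp only [zero_mul, add_zero] at h5
    exact h5.mono_left nhdsWithin_le_nhds
  exact ge_of_tendsto hlim (by filter_upwards [self_mem_nhdsWithin] with δ hδ using key δ hδ)

lemma HasGradBound.abs_differential_le (hg : IsRiemMetric g) (hε : 0 ≤ ε)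
    (hu : HasGradBound g ε u) {x₀ : M} {y : E} (hy : y ∈ (extChartAt I x₀).target)
    (hd : DifferentiableAt ℝ (fun z => u ((extChartAt I x₀).symm z)) y)
    (v : TangentSpace I ((extChartAt I x₀).symm y)) :
    |differential I u ((extChartAt I x₀).symm y) v| ≤
      ε * √(g ((extChartAt I x₀).symm y) v v) := by
  obtain ⟨v, rfl⟩ := (chartEquiv hy).surjective v
  have h := hu.abs_fderiv_le hg hε hy hd v
  rw [← differential_comp_dchart hy hd] at h
  rw [chartEquiv_apply]
  exact h

end GradBound

section Gaffney

open scoped NNReal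

variable {E : Type*} [NormedAddCommGroup E] [NormedSpace ℝ E] [FiniteDimensional ℝ E]
  [MeasurableSpace E] [BorelSpace E]
  {H : Type*} [TopologicalSpace H] {I : ModelWithCorners ℝ E H} [I.Boundaryless]
  {M : Type*} [TopologicalSpace M] [ChartedSpace H M] [IsManifold I ∞ M]
  [T2Space M] [MeasurableSpace M] [BorelSpace M] [SecondCountableTopology M] {g : MetricField I M}

lemma IsVolumeForm.abs_integral_mul_topRatio_le (hg : IsRiemMetric g)
    {vol : DiffForm I M (Module.finrank ℝ E)} (hvol : IsVolumeForm g vol) {m : ℕ}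
    (h : m + 1 = Module.finrank ℝ E) {κ : DiffForm I M m} {τ : DiffForm I M (m + 1)}
    (hκ : IsLpForm g 1 κ) (hτ : IsLpForm g 1 τ) (hd : IsWeakExtDeriv κ τ) {u : M → ℝ} {ε : ℝ}
    (hε : 0 ≤ ε) (huc : Continuous u) (hus : HasCompactSupport u) (hu : HasGradBound g ε u) {C : ℝ}
    (hCw : ∀ (x : M) (ℓ : TangentSpace I x →ₗ[ℝ] ℝ)
      (β : (TangentSpace I x) [⋀^Fin m]→ₗ[ℝ] ℝ) (A : ℝ), 0 ≤ A → (∀ v, |ℓ v| ≤ A * √(g x v v)) →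
        formNorm (V := TangentSpace I x) (g x) (lwedge ℓ β) ≤
          C * (A * formNorm (V := TangentSpace I x) (g x) β)) :
    |∫ x, u x * topRatio vol (castForm h τ) x ∂(riemVolume g)| ≤
      C * ε * ∫ x, formNorm (V := TangentSpace I x) (g x) (κ x) ∂(riemVolume g) := by
  classical
  have : LocallyCompactSpace M := Manifold.locallyCompact_of_finiteDimensional I
  set f := topRatio vol (castForm h τ)
  have hf : Integrable f (riemVolume g) := hvol.integrable_topRatio hg ⟨fun x₀ v => hτ.1 x₀ _, by
    have h1 := hτ.2
    simp only [eLpNormForm] at h1 ⊢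
    simpa only [castForm, formNorm_castDeg] using h1⟩
  have hN := hg.memLp_formNorm hκ
  rw [ENNReal.ofReal_one, memLp_one_iff_integrable] at hN
  -- a partition of unity on the support of `u`
  let e := Module.finBasis ℝ E
  let s (x₀ : M) : ℝ := SignType.sign (inChart x₀ vol (extChartAt I x₀ x₀) e)
  let U (x₀ : M) : Set M := (extChartAt I x₀).source ∩
    {x | 0 < s x₀ * inChart x₀ vol (extChartAt I x₀ x) e}
  have hne (x₀ : M) : inChart x₀ vol (extChartAt I x₀ x₀) e ≠ 0 :=
    hvol.inChart_ne_zero hg (mem_extChartAt_target x₀)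
  have hs (x₀ : M) : |s x₀| = 1 := by
    rcases lt_or_gt_of_ne (hne x₀) with h1 | h1
    · have : s x₀ = -1 := by simp only [s]; rw [sign_neg h1]; simp
      rw [this]; simp
    · have : s x₀ = 1 := by simp only [s]; rw [sign_pos h1]; simp
      rw [this]; simp
  have hUo (x₀ : M) : IsOpen (U x₀) := by
    have h1 : ContinuousOn (fun x => s x₀ * inChart x₀ vol (extChartAt I x₀ x) e)
        (extChartAt I x₀).source :=
      continuousOn_const.mul ((hvol.2 x₀ e).comp (continuousOn_extChartAt x₀)
        fun x hx => (extChartAt I x₀).map_source hx)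
    exact h1.isOpen_inter_preimage (isOpen_extChartAt_source x₀) isOpen_Ioi
  have hUx (x₀ : M) : x₀ ∈ U x₀ := by
    refine ⟨mem_extChartAt_source x₀, ?_⟩
    show 0 < s x₀ * inChart x₀ vol (extChartAt I x₀ x₀) e
    rw [sign_mul_self]
    exact abs_pos.2 (hne x₀)
  obtain ⟨ψ, hψ⟩ := SmoothPartitionOfUnity.exists_isSubordinate I (isClosed_tsupport u) U hUo
    fun x _ => mem_iUnion.2 ⟨x, hUx x⟩
  have hfin := ψ.locallyFinite.finite_nonempty_inter_compact hus.isCompact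
  set T := hfin.toFinset
  have hsum : ∀ x, ∑ i ∈ T, ψ i x * u x = u x := by
    intro x
    by_cases hx : x ∈ tsupport u
    · rw [← Finset.sum_mul]
      have h1 := ψ.sum_eq_one hx
      rw [finsum_eq_sum_of_support_subset (s := T)] at h1
      · rw [h1, one_mul]
      · intro i hi
        simp only [T, Set.Finite.coe_toFinset]
        exact ⟨x, hi, hx⟩
    · rw [image_eq_zero_of_notMem_tsupport hx]
      simp
  set w : M → M → ℝ := fun i x => ψ i x * u x with hw
  have hwc (i : M) : Continuous (w i) := (ψ i).contMDiff.continuous.mul huc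
  have hws (i : M) : HasCompactSupport (w i) := hus.mul_left
  have hwU (i : M) : tsupport (w i) ⊆ U i := (tsupport_mul_subset_left).trans (hψ i)
  have hψd (i x₀ : M) {y : E} (hy : y ∈ (extChartAt I x₀).target) :
      ContDiffAt ℝ 1 (fun z => ψ i ((extChartAt I x₀).symm z)) y := by
    have h1 : ContMDiffOn 𝓘(ℝ, E) 𝓘(ℝ, ℝ) 1 (fun z => ψ i ((extChartAt I x₀).symm z))
        (extChartAt I x₀).target :=
      ((ψ i).contMDiff.of_le (by simp)).comp_contMDiffOn (contMDiffOn_extChartAt_symm x₀)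
    exact (contMDiffOn_iff_contDiffOn.1 h1).contDiffAt ((isOpen_extChartAt_target x₀).mem_nhds hy)
  have hwl (i : M) : ∀ y ∈ (extChartAt I i).target, ∃ K : ℝ≥0, ∃ t ∈ 𝓝 y,
      LipschitzOnWith K (fun z => w i ((extChartAt I i).symm z)) t := fun y hy =>
    exists_lipschitzOnWith_mul (hψd i i hy).exists_lipschitzOnWith
      (hu.exists_lipschitzOnWith hg hε hy)
  have hA (i : M) := hvol.integral_mul_topRatio hg h hκ hτ hd (hwc i) (hs i) (hws i)
    (fun x hx => (hwU i hx).1) (fun x hx => (hwU i hx).2) (hwl i)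
  have hae : ∀ᵐ x ∂(riemVolume g),
      |∑ i ∈ T, topRatio vol (castForm h (dwedge (w i) κ)) x| ≤
        C * ε * formNorm (V := TangentSpace I x) (g x) (κ x) := by
    refine hg.ae_of_chart fun x₀ => ?_
    filter_upwards [ae_chartLebesgue_mem (I := I) x₀, hu.ae_differentiableAt hg hε x₀] with y hy hdy
    have hdw (i : M) : DifferentiableAt ℝ (fun z => w i ((extChartAt I x₀).symm z)) y :=
      ((hψd i x₀ hy).differentiableAt one_ne_zero).mul hdy
    have h1 : ∑ i ∈ T, topRatio vol (castForm h (dwedge (w i) κ)) ((extChartAt I x₀).symm y) =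
        topRatio vol (castForm h (dwedge u κ)) ((extChartAt I x₀).symm y) := by
      have hnz := hvol.inChart_ne_zero hg hy
      simp only [topRatio_chartSymm vol _ hnz]
      rw [← Finset.sum_div]
      congr 1
      simp only [inChart_castForm, inChart_dwedge hy hdy, inChart_dwedge hy (hdw _), lwedge_apply]
      rw [Finset.sum_comm]
      refine Finset.sum_congr rfl fun j _ => ?_
      rw [← Finset.mul_sum, ← Finset.sum_mul]
      congr 2
      have h2 : (fun z => u ((extChartAt I x₀).symm z)) =
          fun z => ∑ i ∈ T, w i ((extChartAt I x₀).symm z) := by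
        funext z
        exact (hsum _).symm
      rw [h2, fderiv_fun_sum fun i _ => hdw i]
      simp
    rw [h1, hvol.abs_topRatio hg, castForm, formNorm_castDeg]
    refine (hCw ((extChartAt I x₀).symm y) _ _ ε hε
      fun v => hu.abs_differential_le hg hε hy hdy v).trans_eq (by ring)
  have hint (i : M) : Integrable (fun x => w i x * f x) (riemVolume g) := by
    obtain ⟨D, hD⟩ := (hwc i).bounded_above_of_compact_support (hws i)
    exact hf.bdd_mul (c := D) (hwc i).aestronglyMeasurable (Eventually.of_forall hD)
  have hmain : ∫ x, u x * f x ∂(riemVolume g) =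
      -∫ x, ∑ i ∈ T, topRatio vol (castForm h (dwedge (w i) κ)) x ∂(riemVolume g) := by
    rw [integral_finsetSum _ fun i _ => (hA i).1, ← Finset.sum_neg_distrib,
      ← Finset.sum_congr rfl fun i _ => (hA i).2, ← integral_finsetSum _ fun i _ => hint i]
    refine integral_congr_ae (Eventually.of_forall fun x => ?_)
    simp only [← Finset.sum_mul]
    rw [hsum]
  rw [hmain, abs_neg, ← integral_const_mul]
  refine (abs_integral_le_integral_abs).trans ?_
  exact integral_mono_ae (integrable_finsetSum _ fun i _ => (hA i).1).abs
    (hN.const_mul _) hae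

/-- **Gaffney's theorem**: on a manifold with cut-off functions, the integral of the differential
of an integrable form is zero if this differential is integrable. -/
theorem IsVolumeForm.integral_eq_zero (hg : IsRiemMetric g) (hcut : HasCutoffs g)
    {vol : DiffForm I M (Module.finrank ℝ E)} (hvol : IsVolumeForm g vol) {m : ℕ}
    (h : m + 1 = Module.finrank ℝ E) {κ : DiffForm I M m} {τ : DiffForm I M (m + 1)}
    (hκ : IsLpForm g 1 κ) (hτ : IsLpForm g 1 τ) (hd : IsWeakExtDeriv κ τ) :
    ∫ x, topRatio vol (castForm h τ) x ∂(riemVolume g) = 0 := by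
  classical
  have : LocallyCompactSpace M := Manifold.locallyCompact_of_finiteDimensional I
  obtain ⟨C, -, hCw⟩ := exists_formNorm_lwedge_le (Module.finrank ℝ E) m
  obtain ⟨u, ε, hε, hu, hlim⟩ := hcut
  set f := topRatio vol (castForm h τ)
  have hf : Integrable f (riemVolume g) := hvol.integrable_topRatio hg ⟨fun x₀ v => hτ.1 x₀ _, by
    have h1 := hτ.2
    simp only [eLpNormForm] at h1 ⊢
    simpa only [castForm, formNorm_castDeg] using h1⟩
  have hN := hg.memLp_formNorm hκ
  rw [ENNReal.ofReal_one, memLp_one_iff_integrable] at hN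
  set B := ∫ x, formNorm (V := TangentSpace I x) (g x) (κ x) ∂(riemVolume g)
  have h1 : Tendsto (fun n => ∫ x, u n x * f x ∂(riemVolume g)) atTop
      (𝓝 (∫ x, f x ∂(riemVolume g))) := by
    refine tendsto_integral_of_dominated_convergence (fun x => ‖f x‖)
      (fun n => (hu n).2.1.aestronglyMeasurable.mul hf.1) hf.norm
      (fun n => Eventually.of_forall fun x => ?_) (Eventually.of_forall fun x => ?_)
    · rw [norm_mul]
      exact mul_le_of_le_one_left (norm_nonneg _) ((hu n).2.2.2.1 x)
    · simpa using (hlim x).mul_const (f x)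
  have h2 : ∀ n, |∫ x, u n x * f x ∂(riemVolume g)| ≤ ε n * (C * B) := fun n => by
    refine (hvol.abs_integral_mul_topRatio_le hg h hκ hτ hd (hu n).1 (hu n).2.1 (hu n).2.2.1
      (hu n).2.2.2.2 fun x => hCw (V := TangentSpace I x) rfl (hg.scalar x)).trans_eq (by ring)
  have h3 : Tendsto (fun n => |∫ x, u n x * f x ∂(riemVolume g)|) atTop (𝓝 0) := by
    refine squeeze_zero (fun n => abs_nonneg _) h2 ?_
    simpa using hε.mul_const (C * B)
  have h4 := tendsto_nhds_unique h1.abs h3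
  exact abs_eq_zero.1 h4

end Gaffney

section LocalForms

variable {E : Type*} [NormedAddCommGroup E] [NormedSpace ℝ E] [MeasurableSpace E] [BorelSpace E]
  {μ : Measure E} {U : Set E}

lemma IsLocLp.one [IsFiniteMeasureOnCompacts μ] {p : ℝ≥0∞} (hp : 1 ≤ p) {k : ℕ}
    {θ : E → E [⋀^Fin k]→ₗ[ℝ] ℝ} (h : IsLocLp μ U p θ) : IsLocLp μ U 1 θ := fun K hK hKU v => by
  have : IsFiniteMeasure (μ.restrict K) :=
    ⟨by rw [Measure.restrict_apply_univ]; exact hK.measure_lt_top⟩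
  exact (h K hK hKU v).mono_exponent hp

lemma IsLocLp.integrable_mul [FiniteDimensional ℝ E] {k : ℕ} {θ : E → E [⋀^Fin k]→ₗ[ℝ] ℝ}
    (h : IsLocLp μ U 1 θ)
    {ψ : E → ℝ} (hψ : Continuous ψ) (hc : HasCompactSupport ψ) (hs : tsupport ψ ⊆ U)
    (v : Fin k → E) : Integrable (fun y => ψ y * θ y v) μ := by
  have h1 := memLp_one_iff_integrable.1 (h _ hc hs v)
  obtain ⟨C, hC⟩ := hψ.bounded_above_of_compact_support hc
  have h2 : IntegrableOn (fun y => ψ y * θ y v) (tsupport ψ) μ :=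
    h1.bdd_mul (c := C) hψ.aestronglyMeasurable (Eventually.of_forall hC)
  refine (integrableOn_iff_integrable_of_support_subset fun y hy => ?_).1 h2
  exact subset_tsupport _ (left_ne_zero_of_mul hy)

lemma tsupport_fderiv_apply_subset_tsupport {φ : E → ℝ} (v : E) :
    tsupport (fun y => fderiv ℝ φ y v) ⊆ tsupport φ := by
  refine closure_minimal (fun y hy => ?_) (isClosed_tsupport φ)
  by_contra h
  exact hy (by
    show fderiv ℝ φ y v = 0
    rw [image_eq_zero_of_notMem_tsupport fun h' => h (tsupport_fderiv_subset ℝ h')]; rfl)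

lemma IsLocLp.integrable_fderiv_mul [FiniteDimensional ℝ E] {k : ℕ}
    {θ : E → E [⋀^Fin k]→ₗ[ℝ] ℝ} (h : IsLocLp μ U 1 θ) {φ : E → ℝ} (hφ : ContDiff ℝ ∞ φ)
    (hc : HasCompactSupport φ) (hs : tsupport φ ⊆ U) (w : E) (v : Fin k → E) :
    Integrable (fun y => fderiv ℝ φ y w * θ y v) μ :=
  h.integrable_mul (bounded_fderiv_apply hφ hc w).1
    (hc.of_isClosed_subset (isClosed_tsupport _) (tsupport_fderiv_apply_subset_tsupport w))
    ((tsupport_fderiv_apply_subset_tsupport w).trans hs) v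

lemma IsLocLp.integrable_lwedge [FiniteDimensional ℝ E] {k : ℕ}
    {θ : E → E [⋀^Fin k]→ₗ[ℝ] ℝ} (h : IsLocLp μ U 1 θ) {φ : E → ℝ} (hφ : ContDiff ℝ ∞ φ)
    (hc : HasCompactSupport φ) (hs : tsupport φ ⊆ U) (v : Fin (k + 1) → E) :
    Integrable (fun y => lwedge (fderiv ℝ φ y).toLinearMap (θ y) v) μ := by
  simp only [lwedge_apply]
  exact integrable_finsetSum _ fun i _ => (h.integrable_fderiv_mul hφ hc hs _ _).const_mul _

lemma lwedge_smul {V : Type*} [AddCommGroup V] [Module ℝ V] {k : ℕ} (c : ℝ) (ℓ : V →ₗ[ℝ] ℝ)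
    (β : V [⋀^Fin k]→ₗ[ℝ] ℝ) : lwedge ℓ (c • β) = c • lwedge ℓ β := by
  ext v
  simp only [lwedge_apply, AlternatingMap.smul_apply, smul_eq_mul, Finset.mul_sum]
  exact Finset.sum_congr rfl fun i _ => by ring

lemma lwedge_add_right {V : Type*} [AddCommGroup V] [Module ℝ V] {k : ℕ} (ℓ : V →ₗ[ℝ] ℝ)
    (β β' : V [⋀^Fin k]→ₗ[ℝ] ℝ) : lwedge ℓ (β + β') = lwedge ℓ β + lwedge ℓ β' := by
  ext v
  simp only [lwedge_apply, AlternatingMap.add_apply, ← Finset.sum_add_distrib]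
  exact Finset.sum_congr rfl fun i _ => by ring

variable [FiniteDimensional ℝ E] {k : ℕ}

lemma IsLocalWeakDeriv.add {θ θ' : E → E [⋀^Fin k]→ₗ[ℝ] ℝ} {η η' : E → E [⋀^Fin (k + 1)]→ₗ[ℝ] ℝ}
    (hθ : IsLocLp μ U 1 θ) (hθ' : IsLocLp μ U 1 θ') (hη : IsLocLp μ U 1 η)
    (hη' : IsLocLp μ U 1 η') (h : IsLocalWeakDeriv μ U θ η) (h' : IsLocalWeakDeriv μ U θ' η') :
    IsLocalWeakDeriv μ U (θ + θ') (η + η') := fun φ h1 h2 h3 v => by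
  simp only [Pi.add_apply, lwedge_add_right, AlternatingMap.add_apply, mul_add]
  rw [integral_add (hη.integrable_mul h1.continuous h2 h3 v)
    (hη'.integrable_mul h1.continuous h2 h3 v), integral_add (hθ.integrable_lwedge h1 h2 h3 v)
    (hθ'.integrable_lwedge h1 h2 h3 v), h φ h1 h2 h3, h' φ h1 h2 h3, neg_add]

lemma IsLocalWeakDeriv.const_smul {θ : E → E [⋀^Fin k]→ₗ[ℝ] ℝ} {η : E → E [⋀^Fin (k + 1)]→ₗ[ℝ] ℝ}
    (h : IsLocalWeakDeriv μ U θ η) (c : ℝ) :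
    IsLocalWeakDeriv μ U (c • θ) (c • η) := fun φ h1 h2 h3 v => by
  simp only [Pi.smul_apply, lwedge_smul, AlternatingMap.smul_apply, smul_eq_mul, mul_left_comm _ c]
  rw [integral_const_mul, integral_const_mul, h φ h1 h2 h3, mul_neg]

end LocalForms

section LpForms

variable {E : Type*} [NormedAddCommGroup E] [NormedSpace ℝ E] [FiniteDimensional ℝ E]
  [MeasurableSpace E] [BorelSpace E]
  {H : Type*} [TopologicalSpace H] {I : ModelWithCorners ℝ E H} [I.Boundaryless]
  {M : Type*} [TopologicalSpace M] [ChartedSpace H M] [IsManifold I ∞ M]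
  [T2Space M] [MeasurableSpace M] [BorelSpace M] [SecondCountableTopology M] {g : MetricField I M}
  {p q : ℝ} {k l : ℕ}

lemma inChart_add (θ θ' : DiffForm I M k) (x₀ : M) (y : E) :
    inChart x₀ (θ + θ') y = inChart x₀ θ y + inChart x₀ θ' y := rfl

lemma inChart_smul (c : ℝ) (θ : DiffForm I M k) (x₀ : M) (y : E) :
    inChart x₀ (c • θ) y = c • inChart x₀ θ y := rfl

lemma eLpNormForm_castForm (h : k = l) (θ : DiffForm I M k) :
    eLpNormForm g p (castForm h θ) = eLpNormForm g p θ := by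
  subst h; rfl

lemma IsLpForm.castForm {θ : DiffForm I M k} (hθ : IsLpForm g p θ) (h : k = l) :
    IsLpForm g p (LpForms.castForm h θ) := by
  subst h; exact hθ

lemma eLpNormForm_smul (hg : IsRiemMetric g) (c : ℝ) (θ : DiffForm I M k) :
    eLpNormForm g p (c • θ) = ENNReal.ofReal |c| * eLpNormForm g p θ := by
  have : (fun x => formNorm (V := TangentSpace I x) (g x) ((c • θ) x)) =
      |c| • fun x => formNorm (V := TangentSpace I x) (g x) (θ x) :=
    funext fun x => (hg.scalar x).formNorm_smul c (θ x)
  rw [eLpNormForm, this, eLpNorm_const_smul, eLpNormForm, Real.enorm_eq_ofReal (abs_nonneg c)]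

lemma eLpNormForm_add_le (hg : IsRiemMetric g) (hp : 1 ≤ p) {θ θ' : DiffForm I M k}
    (hθ : IsLpForm g p θ) (hθ' : IsLpForm g p θ') :
    eLpNormForm g p (θ + θ') ≤ eLpNormForm g p θ + eLpNormForm g p θ' := by
  refine le_trans ?_ (eLpNorm_add_le (hg.memLp_formNorm hθ).1 (hg.memLp_formNorm hθ').1
    (by simpa using ENNReal.ofReal_le_ofReal hp))
  refine eLpNorm_mono_real fun x => ?_
  rw [Real.norm_eq_abs, abs_of_nonneg ((hg.scalar x).formNorm_nonneg _)]
  exact (hg.scalar x).formNorm_add_le (θ x) (θ' x)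

lemma IsLpForm.smul (hg : IsRiemMetric g) {θ : DiffForm I M k} (hθ : IsLpForm g p θ) (c : ℝ) :
    IsLpForm g p (c • θ) :=
  ⟨fun x₀ v => (hθ.1 x₀ v).const_mul c, by
    rw [eLpNormForm_smul hg]; exact ENNReal.mul_lt_top ENNReal.ofReal_lt_top hθ.2⟩

lemma IsLpForm.add (hg : IsRiemMetric g) (hp : 1 ≤ p) {θ θ' : DiffForm I M k}
    (hθ : IsLpForm g p θ) (hθ' : IsLpForm g p θ') : IsLpForm g p (θ + θ') :=
  ⟨fun x₀ v => (hθ.1 x₀ v).add (hθ'.1 x₀ v),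
    (eLpNormForm_add_le hg hp hθ hθ').trans_lt (ENNReal.add_lt_top.2 ⟨hθ.2, hθ'.2⟩)⟩

lemma sub_eq_add_smul (θ θ' : DiffForm I M k) : θ - θ' = θ + (-1 : ℝ) • θ' := by
  funext x
  ext v
  show θ x v - θ' x v = θ x v + (-1) * θ' x v
  ring

lemma IsLpForm.sub (hg : IsRiemMetric g) (hp : 1 ≤ p) {θ θ' : DiffForm I M k}
    (hθ : IsLpForm g p θ) (hθ' : IsLpForm g p θ') : IsLpForm g p (θ - θ') := by
  rw [sub_eq_add_smul]; exact hθ.add hg hp (hθ'.smul hg _)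

lemma isLpForm_zero (hg : IsRiemMetric g) : IsLpForm g p (0 : DiffForm I M k) := by
  refine ⟨fun x₀ v => aestronglyMeasurable_const (b := (0 : ℝ)), ?_⟩
  have : (fun x => formNorm (V := TangentSpace I x) (g x) ((0 : DiffForm I M k) x)) = 0 :=
    funext fun x => (hg.scalar x).formNorm_zero
  rw [eLpNormForm, this, eLpNorm_zero]
  exact ENNReal.zero_lt_top

lemma lpNormForm_add_le (hg : IsRiemMetric g) (hp : 1 ≤ p) {θ θ' : DiffForm I M k}
    (hθ : IsLpForm g p θ) (hθ' : IsLpForm g p θ') :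
    lpNormForm g p (θ + θ') ≤ lpNormForm g p θ + lpNormForm g p θ' :=
  (ENNReal.toReal_mono (ENNReal.add_lt_top.2 ⟨hθ.2, hθ'.2⟩).ne
    (eLpNormForm_add_le hg hp hθ hθ')).trans ENNReal.toReal_add_le

lemma lpNormForm_smul (hg : IsRiemMetric g) (c : ℝ) (θ : DiffForm I M k) :
    lpNormForm g p (c • θ) = |c| * lpNormForm g p θ := by
  rw [lpNormForm, eLpNormForm_smul hg, ENNReal.toReal_mul, ENNReal.toReal_ofReal (abs_nonneg c),
    lpNormForm]

lemma IsLpForm.isLocLp_one (hg : IsRiemMetric g) (hp : 1 ≤ p) {θ : DiffForm I M k}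
    (hθ : IsLpForm g p θ) (x₀ : M) :
    IsLocLp (Module.finBasis ℝ E).addHaar (extChartAt I x₀).target 1 (inChart x₀ θ) :=
  (hg.isLocLp_inChart hθ x₀).one (by simpa using ENNReal.ofReal_le_ofReal hp)

lemma IsWeakExtDeriv.smul {θ : DiffForm I M k} {η : DiffForm I M (k + 1)}
    (h : IsWeakExtDeriv θ η) (c : ℝ) : IsWeakExtDeriv (c • θ) (c • η) :=
  isWeakExtDeriv_iff.2 fun x₀ => (isWeakExtDeriv_iff.1 h x₀).const_smul c

lemma IsWeakExtDeriv.add (hg : IsRiemMetric g) (hp : 1 ≤ p) {θ θ' : DiffForm I M k}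
    {η η' : DiffForm I M (k + 1)} (hθ : IsLpForm g p θ) (hθ' : IsLpForm g p θ')
    (hη : IsLpForm g p η) (hη' : IsLpForm g p η') (h : IsWeakExtDeriv θ η)
    (h' : IsWeakExtDeriv θ' η') : IsWeakExtDeriv (θ + θ') (η + η') :=
  isWeakExtDeriv_iff.2 fun x₀ => (isWeakExtDeriv_iff.1 h x₀).add (hθ.isLocLp_one hg hp x₀)
    (hθ'.isLocLp_one hg hp x₀) (hη.isLocLp_one hg hp x₀) (hη'.isLocLp_one hg hp x₀)
    (isWeakExtDeriv_iff.1 h' x₀)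

lemma isWeakExtDeriv_zero_of_ae (hg : IsRiemMetric g) {η : DiffForm I M (k + 1)}
    (h : ∀ᵐ x ∂(riemVolume g), η x = 0) : IsWeakExtDeriv 0 η := fun x₀ φ h1 h2 h3 v => by
  have e1 : ∫ y, φ y * inChart x₀ η y v ∂(chartLebesgue I x₀) = 0 := by
    refine integral_eq_zero_of_ae ?_
    filter_upwards [hg.ae_chart h x₀] with y hy
    rw [inChart_eq_zero hy]
    simp
  rw [e1]
  have e2 : ∀ y w, inChart x₀ (0 : DiffForm I M k) y w = 0 := fun y w => rfl
  simp [e2]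

/-- The exterior product of differential forms. -/
def wedgeForm (α : DiffForm I M k) (β : DiffForm I M l) : DiffForm I M (k + l) :=
  fun x => wedge (α x) (β x)

lemma inChart_wedgeForm (α : DiffForm I M k) (β : DiffForm I M l) (x₀ : M) (y : E) :
    inChart x₀ (wedgeForm α β) y = wedge (inChart x₀ α y) (inChart x₀ β y) :=
  wedge_compLinearMap _ _ _

lemma aestronglyMeasurable_inChart_wedgeForm {α : DiffForm I M k} {β : DiffForm I M l} {x₀ : M}
    (hα : ∀ v, AEStronglyMeasurable (fun y => inChart x₀ α y v) (chartLebesgue I x₀))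
    (hβ : ∀ v, AEStronglyMeasurable (fun y => inChart x₀ β y v) (chartLebesgue I x₀))
    (v : Fin (k + l) → E) :
    AEStronglyMeasurable (fun y => inChart x₀ (wedgeForm α β) y v) (chartLebesgue I x₀) := by
  simp only [inChart_wedgeForm, wedge_apply]
  exact Finset.aestronglyMeasurable_fun_sum _ fun σ _ => ((hα _).mul (hβ _)).const_mul _

lemma exists_eLpNormForm_wedgeForm_le (hg : IsRiemMetric g) (hpq : p.HolderConjugate q) (k l : ℕ) :
    ∃ C : ℝ, 0 ≤ C ∧ ∀ (α : DiffForm I M k) (β : DiffForm I M l), IsLpForm g p α → IsLpForm g q β →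
      eLpNormForm g 1 (wedgeForm α β) ≤
        ENNReal.ofReal C * (eLpNormForm g p α * eLpNormForm g q β) := by
  obtain ⟨C, hC, hw⟩ := exists_formNorm_wedge_le (Module.finrank ℝ E) k l
  refine ⟨C, hC, fun α β hα hβ => ?_⟩
  have : ENNReal.HolderConjugate (ENNReal.ofReal p) (ENNReal.ofReal q) := hpq.ennrealOfReal
  have h1 := eLpNorm_smul_le_mul_eLpNorm (p := ENNReal.ofReal p) (q := ENNReal.ofReal q) (r := 1)
    (hg.memLp_formNorm hβ).1 (hg.memLp_formNorm hα).1
  refine le_trans ?_ (mul_le_mul_right h1 _)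
  rw [eLpNormForm, ENNReal.ofReal_one]
  refine eLpNorm_le_mul_eLpNorm_of_ae_le_mul (Eventually.of_forall fun x => ?_) 1
  have hn := (hg.scalar x).formNorm_nonneg (wedge (α x) (β x))
  have hα' := (hg.scalar x).formNorm_nonneg (α x)
  have hβ' := (hg.scalar x).formNorm_nonneg (β x)
  rw [Real.norm_eq_abs, Real.norm_eq_abs, Pi.smul_apply', smul_eq_mul,
    abs_of_nonneg (mul_nonneg hα' hβ')]
  exact (abs_of_nonneg hn).trans_le
    (hw (V := TangentSpace I x) (g := g x) (by rfl) (hg.scalar x) (α x) (β x))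

lemma IsLpForm.wedgeForm (hg : IsRiemMetric g) (hpq : p.HolderConjugate q) {α : DiffForm I M k}
    {β : DiffForm I M l} (hα : IsLpForm g p α) (hβ : IsLpForm g q β) :
    IsLpForm g 1 (wedgeForm α β) := by
  obtain ⟨C, hC, h⟩ := exists_eLpNormForm_wedgeForm_le hg hpq k l
  exact ⟨fun x₀ v => aestronglyMeasurable_inChart_wedgeForm (hα.1 x₀) (hβ.1 x₀) v,
    (h α β hα hβ).trans_lt (ENNReal.mul_lt_top ENNReal.ofReal_lt_top
      (ENNReal.mul_lt_top hα.2 hβ.2))⟩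

/-- The Leibniz rule for the exterior product of forms in `Ω^{k,p}` and `Ω^{l,q}`. -/
lemma exists_sign_isWeakExtDeriv_wedgeForm (hg : IsRiemMetric g) (hpq : p.HolderConjugate q)
    (h : k + 1 + l = k + l + 1) : ∃ ε : ℝ, |ε| = 1 ∧ ∀ (φ : DiffForm I M k)
      (θ : DiffForm I M (k + 1)) (γ : DiffForm I M l) (η : DiffForm I M (l + 1)),
      IsLpForm g p φ → IsLpForm g p θ → IsLpForm g q γ → IsLpForm g q η →
      IsWeakExtDeriv φ θ → IsWeakExtDeriv γ η →
      IsWeakExtDeriv (wedgeForm φ γ)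
        (castForm h (wedgeForm θ γ) + ε • (wedgeForm φ η : DiffForm I M (k + (l + 1)))) := by
  obtain ⟨ε, hε, hw⟩ := exists_sign_lwedge_wedge_right k l
  refine ⟨ε, hε, fun φ θ γ η hφ hθ hγ hη h1 h2 => isWeakExtDeriv_iff.2 fun x₀ => ?_⟩
  have : ENNReal.HolderConjugate (ENNReal.ofReal p) (ENNReal.ofReal q) := hpq.ennrealOfReal
  have h3 := IsLocalWeakDeriv.wedge (p := ENNReal.ofReal p) (q := ENNReal.ofReal q)
    ENNReal.ofReal_ne_top (isOpen_extChartAt_target x₀) (hg.isLocLp_inChart hφ x₀)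
    (hg.isLocLp_inChart hθ x₀) (hg.isLocLp_inChart hγ x₀) (hg.isLocLp_inChart hη x₀)
    (isWeakExtDeriv_iff.1 h1 x₀) (isWeakExtDeriv_iff.1 h2 x₀) h fun ℓ b c => hw ℓ b c
  convert h3 using 1
  · funext y
    exact inChart_wedgeForm _ _ _ _
  · funext y
    ext v
    rw [inChart_add, inChart_smul, AlternatingMap.add_apply, AlternatingMap.smul_apply,
      inChart_castForm, inChart_wedgeForm, inChart_wedgeForm]
    rfl

lemma IsVolumeForm.abs_integralForm_le (hg : IsRiemMetric g)
    {vol : DiffForm I M (Module.finrank ℝ E)} (hvol : IsVolumeForm g vol)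
    {τ : DiffForm I M (Module.finrank ℝ E)} (hτ : IsLpForm g 1 τ) :
    |integralForm g vol τ| ≤ lpNormForm g 1 τ := by
  have h1 := hg.memLp_formNorm hτ
  rw [ENNReal.ofReal_one] at h1
  have h2 : lpNormForm g 1 τ = ∫ x, ‖formNorm (V := TangentSpace I x) (g x) (τ x)‖ ∂(riemVolume g) := by
    rw [lpNormForm, eLpNormForm, ENNReal.ofReal_one, integral_norm_eq_lintegral_enorm h1.1,
      eLpNorm_one_eq_lintegral_enorm]
  rw [h2]
  refine abs_integral_le_integral_abs.trans (le_of_eq (integral_congr_ae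
    (Eventually.of_forall fun x => ?_)))
  exact (hvol.abs_topRatio hg τ x).trans (abs_of_nonneg ((hg.scalar x).formNorm_nonneg _)).symm

/-- Integration by parts on a manifold with cut-off functions. -/
lemma IsVolumeForm.exists_abs_integralForm_wedge_le (hg : IsRiemMetric g) (hcut : HasCutoffs g)
    {vol : DiffForm I M (Module.finrank ℝ E)} (hvol : IsVolumeForm g vol)
    (hpq : p.HolderConjugate q) (h : k + 1 + l = Module.finrank ℝ E) :
    ∃ C : ℝ, 0 ≤ C ∧ ∀ (φ : DiffForm I M k)
      (θ : DiffForm I M (k + 1)) (γ : DiffForm I M l) (η : DiffForm I M (l + 1)),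
      IsLpForm g p φ → IsLpForm g p θ → IsLpForm g q γ → IsLpForm g q η →
      IsWeakExtDeriv φ θ → IsWeakExtDeriv γ η →
      |integralForm g vol (castForm h (wedgeForm θ γ))| ≤
        C * (lpNormForm g p φ * lpNormForm g q η) := by
  have h0 : k + 1 + l = k + l + 1 := by omega
  have h' : k + (l + 1) = Module.finrank ℝ E := by omega
  obtain ⟨C, hC, hCw⟩ := exists_eLpNormForm_wedgeForm_le hg hpq k (l + 1)
  obtain ⟨ε, hε, hd⟩ := exists_sign_isWeakExtDeriv_wedgeForm hg hpq h0
  refine ⟨C, hC, fun φ θ γ η hφ hθ hγ hη h1 h2 => ?_⟩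
  have l1 := hφ.wedgeForm hg hpq hγ
  have l2 := hθ.wedgeForm hg hpq hγ
  have l3 := hφ.wedgeForm hg hpq hη
  have hG := hvol.integral_eq_zero hg hcut h' l1 ((l2.castForm h0).add hg le_rfl (l3.smul hg ε))
    (hd φ θ γ η hφ hθ hγ hη h1 h2)
  have e1 : ∀ x, topRatio vol (castForm h' (castForm h0 (wedgeForm θ γ) +
      ε • (wedgeForm φ η : DiffForm I M (k + (l + 1))))) x =
      topRatio vol (castForm h (wedgeForm θ γ)) x + ε * topRatio vol (castForm h' (wedgeForm φ η)) x := by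
    intro x
    simp only [topRatio]
    rw [← mul_div_assoc, ← add_div]
    rfl
  simp only [e1] at hG
  rw [integral_add (hvol.integrable_topRatio hg (l2.castForm h))
    ((hvol.integrable_topRatio hg (l3.castForm h')).const_mul ε), integral_const_mul] at hG
  have e2 : |integralForm g vol (castForm h (wedgeForm θ γ))| =
      |integralForm g vol (castForm h' (wedgeForm φ η))| := by
    have := eq_neg_of_add_eq_zero_left hG
    refine (congrArg abs this).trans ?_
    rw [abs_neg, abs_mul, hε, one_mul]
    rfl
  rw [e2]
  refine (hvol.abs_integralForm_le hg (l3.castForm h')).trans ?_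
  rw [lpNormForm, eLpNormForm_castForm]
  refine (ENNReal.toReal_mono (ENNReal.mul_ne_top ENNReal.ofReal_ne_top
    (ENNReal.mul_ne_top hφ.2.ne hη.2.ne)) (hCw φ η hφ hη)).trans_eq ?_
  rw [ENNReal.toReal_mul, ENNReal.toReal_mul, ENNReal.toReal_ofReal hC]
  rfl

/-- A form with the robustness property is not exact. -/
theorem IsRobustForm.not_isExactLp (hg : IsRiemMetric g) (hcut : HasCutoffs g)
    {vol : DiffForm I M (Module.finrank ℝ E)} (hvol : IsVolumeForm g vol) (hp : 1 < p)
    {θ : DiffForm I M k} (h : IsRobustForm g vol p θ) : ¬ IsExactLp g p θ := by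
  obtain ⟨l, hl, θ', η, h1, ⟨δ, hδ, h2⟩, -, a, ha, h3⟩ := h
  have hpq : p.HolderConjugate (p / (p - 1)) := Real.HolderConjugate.conjExponent hp
  intro he
  cases k with
  | zero =>
    obtain ⟨j, hj⟩ := h2.exists
    have : integralForm g vol (fun x => castDeg hl (wedge (θ x) (θ' j x))) = 0 := by
      refine integral_eq_zero_of_ae ?_
      filter_upwards [he.2] with x hx
      refine topRatio_eq_zero vol (τ := castForm hl (wedgeForm θ (θ' j))) ?_
      show castDeg hl (wedge (θ x) (θ' j x)) = 0
      rw [hx, ← zero_smul ℝ (0 : (TangentSpace I x) [⋀^Fin 0]→ₗ[ℝ] ℝ), wedge_smul_left, zero_smul]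
      rfl
    rw [this, abs_zero] at hj
    linarith
  | succ m =>
    obtain ⟨hθ, φ, hφ, hd⟩ := he
    obtain ⟨C, hC, hst⟩ := hvol.exists_abs_integralForm_wedge_le hg hcut hpq hl
    have h4 : Tendsto (fun j => lpNormForm g (p / (p - 1)) (η j)) atTop (𝓝 0) := by
      refine h3.trans_tendsto ?_
      refine Real.tendsto_exp_atBot.comp ?_
      exact Tendsto.const_mul_atTop_of_neg (by linarith) tendsto_natCast_atTop_atTop
    have h5 : Tendsto (fun j => C * (lpNormForm g p φ * lpNormForm g (p / (p - 1)) (η j))) atTop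
        (𝓝 0) := by
      simpa using (h4.const_mul (lpNormForm g p φ)).const_mul C
    obtain ⟨j, hj, hj'⟩ := (h2.and (h5.eventually (gt_mem_nhds hδ))).exists
    have := hst φ θ (θ' j) (η j) hφ hθ (h1 j).1 (h1 j).2.1 hd (h1 j).2.2
    exact absurd (hj.trans this) (not_le.2 hj')

end LpForms

section ProductCharts

variable {E₁ : Type*} [NormedAddCommGroup E₁] [NormedSpace ℝ E₁]
  {H₁ : Type*} [TopologicalSpace H₁] {I₁ : ModelWithCorners ℝ E₁ H₁} [I₁.Boundaryless]
  {M₁ : Type*} [TopologicalSpace M₁] [ChartedSpace H₁ M₁] [IsManifold I₁ ∞ M₁]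
  {E₂ : Type*} [NormedAddCommGroup E₂] [NormedSpace ℝ E₂]
  {H₂ : Type*} [TopologicalSpace H₂] {I₂ : ModelWithCorners ℝ E₂ H₂} [I₂.Boundaryless]
  {M₂ : Type*} [TopologicalSpace M₂] [ChartedSpace H₂ M₂] [IsManifold I₂ ∞ M₂]
  {g₁ : MetricField I₁ M₁} {g₂ : MetricField I₂ M₂} {k l : ℕ}

lemma extChartAt_prod_target (x₀ : M₁ × M₂) : (extChartAt (I₁.prod I₂) x₀).target =
    (extChartAt I₁ x₀.1).target ×ˢ (extChartAt I₂ x₀.2).target := by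
  rw [extChartAt_prod, PartialEquiv.prod_target]

lemma extChartAt_prod_source (x₀ : M₁ × M₂) : (extChartAt (I₁.prod I₂) x₀).source =
    (extChartAt I₁ x₀.1).source ×ˢ (extChartAt I₂ x₀.2).source := by
  rw [extChartAt_prod, PartialEquiv.prod_source]

lemma extChartAt_prod_symm (x₀ : M₁ × M₂) (y : E₁ × E₂) : (extChartAt (I₁.prod I₂) x₀).symm y =
    ((extChartAt I₁ x₀.1).symm y.1, (extChartAt I₂ x₀.2).symm y.2) := by
  rw [extChartAt_prod]; rfl

lemma dchart_prod {x₀ : M₁ × M₂} {y : E₁ × E₂} (hy : y ∈ (extChartAt (I₁.prod I₂) x₀).target)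
    (v : E₁ × E₂) : (dchart (I₁.prod I₂) x₀ y v : E₁ × E₂) =
      ((dchart I₁ x₀.1 y.1 v.1 : E₁), (dchart I₂ x₀.2 y.2 v.2 : E₂)) := by
  have hy' := hy
  rw [extChartAt_prod_target] at hy'
  have hd := mdifferentiableAt_chart_symm hy
  have h₁ := mdifferentiableAt_chart_symm hy'.1
  have h₂ := mdifferentiableAt_chart_symm hy'.2
  refine Prod.ext ?_ ?_
  · have e1 := mfderiv_comp y (mdifferentiableAt_fst (I := I₁) (I' := I₂)
      (x := (extChartAt (I₁.prod I₂) x₀).symm y)) hd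
    have e2 := mfderiv_comp (I := 𝓘(ℝ, E₁ × E₂)) (I' := 𝓘(ℝ, E₁)) (I'' := I₁) (f := Prod.fst) y h₁
      differentiableAt_fst.mdifferentiableAt
    have e3 : (Prod.fst : M₁ × M₂ → M₁) ∘ (extChartAt (I₁.prod I₂) x₀).symm =
        (extChartAt I₁ x₀.1).symm ∘ Prod.fst := by
      funext z
      exact congrArg Prod.fst (extChartAt_prod_symm x₀ z)
    rw [e3] at e1
    have e4 := DFunLike.congr_fun (e1.symm.trans e2) v
    rw [mfderiv_fst, mfderiv_eq_fderiv, fderiv_fst] at e4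
    exact e4
  · have e1 := mfderiv_comp y (mdifferentiableAt_snd (I := I₁) (I' := I₂)
      (x := (extChartAt (I₁.prod I₂) x₀).symm y)) hd
    have e2 := mfderiv_comp (I := 𝓘(ℝ, E₁ × E₂)) (I' := 𝓘(ℝ, E₂)) (I'' := I₂) (f := Prod.snd) y h₂
      differentiableAt_snd.mdifferentiableAt
    have e3 : (Prod.snd : M₁ × M₂ → M₂) ∘ (extChartAt (I₁.prod I₂) x₀).symm =
        (extChartAt I₂ x₀.2).symm ∘ Prod.snd := by
      funext z
      exact congrArg Prod.snd (extChartAt_prod_symm x₀ z)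
    rw [e3] at e1
    have e4 := DFunLike.congr_fun (e1.symm.trans e2) v
    rw [mfderiv_snd, mfderiv_eq_fderiv, fderiv_snd] at e4
    exact e4

lemma cross_eq (α : DiffForm I₁ M₁ k) (β : DiffForm I₂ M₂ l) (x : M₁ × M₂) :
    cross α β x = vcross (α x.1) (β x.2) := by
  simp only [cross, mfderiv_fst, mfderiv_snd]
  rfl

lemma cross_apply (α : DiffForm I₁ M₁ k) (β : DiffForm I₂ M₂ l) (x : M₁ × M₂)
    (v : Fin (k + l) → E₁ × E₂) :
    cross α β x v = ∑ σ : Equiv.Perm (Fin (k + l)),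
      ((Equiv.Perm.sign σ : ℤ) : ℝ) / (k.factorial * l.factorial) *
        (α x.1 (fun i => (v (σ (Fin.castAdd l i))).1) *
          β x.2 (fun j => (v (σ (Fin.natAdd k j))).2)) :=
  (DFunLike.congr_fun (cross_eq α β x) _).trans (vcross_apply _ _ _)

lemma prodMetric_eq (x : M₁ × M₂) :
    prodMetric g₁ g₂ x = fun v w : TangentSpace I₁ x.1 × TangentSpace I₂ x.2 => g₁ x.1 v.1 w.1 + g₂ x.2 v.2 w.2 := by
  funext v w
  simp only [prodMetric, mfderiv_fst, mfderiv_snd]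
  rfl

lemma inChart_cross (α : DiffForm I₁ M₁ k) (β : DiffForm I₂ M₂ l) {x₀ : M₁ × M₂} {y : E₁ × E₂}
    (hy : y ∈ (extChartAt (I₁.prod I₂) x₀).target) :
    inChart x₀ (cross α β) y = vcross (inChart x₀.1 α y.1) (inChart x₀.2 β y.2) := by
  ext v
  rw [vcross_apply]
  refine (cross_apply α β _ fun i => (dchart (I₁.prod I₂) x₀ y (v i) : E₁ × E₂)).trans ?_
  simp only [dchart_prod hy]
  rw [extChartAt_prod_symm]
  rfl

lemma prodMetric_dchart {x₀ : M₁ × M₂} {y : E₁ × E₂}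
    (hy : y ∈ (extChartAt (I₁.prod I₂) x₀).target) (v w : E₁ × E₂) :
    prodMetric g₁ g₂ ((extChartAt (I₁.prod I₂) x₀).symm y) (dchart (I₁.prod I₂) x₀ y v)
      (dchart (I₁.prod I₂) x₀ y w) =
    g₁ ((extChartAt I₁ x₀.1).symm y.1) (dchart I₁ x₀.1 y.1 v.1) (dchart I₁ x₀.1 y.1 w.1) +
    g₂ ((extChartAt I₂ x₀.2).symm y.2) (dchart I₂ x₀.2 y.2 v.2) (dchart I₂ x₀.2 y.2 w.2) := by
  have h1 : prodMetric g₁ g₂ ((extChartAt (I₁.prod I₂) x₀).symm y) (dchart (I₁.prod I₂) x₀ y v)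
      (dchart (I₁.prod I₂) x₀ y w) = (fun a b : E₁ × E₂ =>
        g₁ ((extChartAt (I₁.prod I₂) x₀).symm y).1 a.1 b.1 +
        g₂ ((extChartAt (I₁.prod I₂) x₀).symm y).2 a.2 b.2)
          (dchart (I₁.prod I₂) x₀ y v : E₁ × E₂) (dchart (I₁.prod I₂) x₀ y w : E₁ × E₂) :=
    congrFun (congrFun (prodMetric_eq _) _) _
  rw [h1, dchart_prod hy, dchart_prod hy, extChartAt_prod_symm]

lemma IsRiemMetric.prod (hg₁ : IsRiemMetric g₁) (hg₂ : IsRiemMetric g₂) :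
    IsRiemMetric (prodMetric g₁ g₂) where
  scalar x := by
    rw [prodMetric_eq]
    exact (hg₁.scalar x.1).prod (hg₂.scalar x.2)
  continuousOn x₀ v w := by
    have h : ContinuousOn (fun y : E₁ × E₂ =>
        g₁ ((extChartAt I₁ x₀.1).symm y.1) (dchart I₁ x₀.1 y.1 v.1) (dchart I₁ x₀.1 y.1 w.1) +
        g₂ ((extChartAt I₂ x₀.2).symm y.2) (dchart I₂ x₀.2 y.2 v.2) (dchart I₂ x₀.2 y.2 w.2))
        (extChartAt (I₁.prod I₂) x₀).target := by
      rw [extChartAt_prod_target]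
      exact ((hg₁.continuousOn x₀.1 v.1 w.1).comp continuousOn_fst fun y hy => hy.1).add
        ((hg₂.continuousOn x₀.2 v.2 w.2).comp continuousOn_snd fun y hy => hy.2)
    exact h.congr fun y hy => prodMetric_dchart hy v w

lemma HasGradBound.prod (hg₁ : IsRiemMetric g₁) (hg₂ : IsRiemMetric g₂) {u₁ : M₁ → ℝ}
    {u₂ : M₂ → ℝ} {ε₁ ε₂ : ℝ} (hε₁ : 0 ≤ ε₁) (hε₂ : 0 ≤ ε₂) (h₁ : HasGradBound g₁ ε₁ u₁)
    (h₂ : HasGradBound g₂ ε₂ u₂) (hu₁ : ∀ x, |u₁ x| ≤ 1) (hu₂ : ∀ x, |u₂ x| ≤ 1) :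
    HasGradBound (prodMetric g₁ g₂) (ε₁ + ε₂) fun x => u₁ x.1 * u₂ x.2 := by
  intro x₀ y hy δ hδ
  have hy' := hy
  rw [extChartAt_prod_target] at hy'
  have c₁ : Tendsto (fun z : (E₁ × E₂) × (E₁ × E₂) => (z.1.1, z.2.1)) (𝓝 (y, y))
      (𝓝 (y.1, y.1)) := by
    have : Continuous (fun z : (E₁ × E₂) × (E₁ × E₂) => (z.1.1, z.2.1)) := by fun_prop
    exact this.tendsto (y, y)
  have c₂ : Tendsto (fun z : (E₁ × E₂) × (E₁ × E₂) => (z.1.2, z.2.2)) (𝓝 (y, y))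
      (𝓝 (y.2, y.2)) := by
    have : Continuous (fun z : (E₁ × E₂) × (E₁ × E₂) => (z.1.2, z.2.2)) := by fun_prop
    exact this.tendsto (y, y)
  filter_upwards [c₁.eventually (h₁ x₀.1 y.1 hy'.1 δ hδ), c₂.eventually (h₂ x₀.2 y.2 hy'.2 δ hδ)]
    with z hz₁ hz₂
  rw [prodMetric_dchart hy, extChartAt_prod_symm, extChartAt_prod_symm]
  set a := u₁ ((extChartAt I₁ x₀.1).symm z.1.1)
  set a' := u₁ ((extChartAt I₁ x₀.1).symm z.2.1)
  set b := u₂ ((extChartAt I₂ x₀.2).symm z.1.2)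
  set b' := u₂ ((extChartAt I₂ x₀.2).symm z.2.2)
  set G₁ := g₁ ((extChartAt I₁ x₀.1).symm y.1) (dchart I₁ x₀.1 y.1 (z.1 - z.2).1)
    (dchart I₁ x₀.1 y.1 (z.1 - z.2).1)
  set G₂ := g₂ ((extChartAt I₂ x₀.2).symm y.2) (dchart I₂ x₀.2 y.2 (z.1 - z.2).2)
    (dchart I₂ x₀.2 y.2 (z.1 - z.2).2)
  have n₁ : 0 ≤ G₁ := (hg₁.scalar _).nonneg _
  have n₂ : 0 ≤ G₂ := (hg₂.scalar _).nonneg _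
  have d₁ : |a - a'| ≤ ε₁ * (√(G₁ + G₂) + δ * ‖z.1 - z.2‖) := by
    refine (hz₁ : |a - a'| ≤ ε₁ * (√G₁ + δ * ‖z.1.1 - z.2.1‖)).trans ?_
    exact mul_le_mul_of_nonneg_left (add_le_add (Real.sqrt_le_sqrt (le_add_of_nonneg_right n₂))
      (mul_le_mul_of_nonneg_left (norm_fst_le (z.1 - z.2)) hδ.le)) hε₁
  have d₂ : |b - b'| ≤ ε₂ * (√(G₁ + G₂) + δ * ‖z.1 - z.2‖) := by
    refine (hz₂ : |b - b'| ≤ ε₂ * (√G₂ + δ * ‖z.1.2 - z.2.2‖)).trans ?_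
    exact mul_le_mul_of_nonneg_left (add_le_add (Real.sqrt_le_sqrt (le_add_of_nonneg_left n₁))
      (mul_le_mul_of_nonneg_left (norm_snd_le (z.1 - z.2)) hδ.le)) hε₂
  have e : a * b - a' * b' = (a - a') * b + a' * (b - b') := by ring
  show |a * b - a' * b'| ≤ _
  rw [e, add_mul]
  refine (abs_add_le _ _).trans (add_le_add ?_ ?_)
  · rw [abs_mul]
    exact (mul_le_of_le_one_right (abs_nonneg _) (hu₂ _)).trans d₁
  · rw [abs_mul]
    exact (mul_le_of_le_one_left (abs_nonneg _) (hu₁ _)).trans d₂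

lemma HasCutoffs.prod [T2Space M₁] [T2Space M₂] (hg₁ : IsRiemMetric g₁) (hg₂ : IsRiemMetric g₂) (h₁ : HasCutoffs g₁)
    (h₂ : HasCutoffs g₂) : HasCutoffs (prodMetric g₁ g₂) := by
  obtain ⟨u₁, ε₁, hε₁, hu₁, hl₁⟩ := h₁
  obtain ⟨u₂, ε₂, hε₂, hu₂, hl₂⟩ := h₂
  refine ⟨fun n x => u₁ n x.1 * u₂ n x.2, fun n => ε₁ n + ε₂ n, by simpa using hε₁.add hε₂,
    fun n => ⟨add_nonneg (hu₁ n).1 (hu₂ n).1, ?_, ?_, fun x => ?_, ?_⟩, fun x => ?_⟩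
  · exact ((hu₁ n).2.1.comp continuous_fst).mul ((hu₂ n).2.1.comp continuous_snd)
  · refine HasCompactSupport.of_support_subset_isCompact
      ((hu₁ n).2.2.1.isCompact.prod (hu₂ n).2.2.1.isCompact) fun x hx => ?_
    exact ⟨subset_tsupport _ (left_ne_zero_of_mul hx), subset_tsupport _ (right_ne_zero_of_mul hx)⟩
  · rw [abs_mul]
    exact mul_le_one₀ ((hu₁ n).2.2.2.1 _) (abs_nonneg _) ((hu₂ n).2.2.2.1 _)
  · exact (hu₁ n).2.2.2.2.prod hg₁ hg₂ (hu₁ n).1 (hu₂ n).1 (hu₂ n).2.2.2.2 (hu₁ n).2.2.2.1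
      (hu₂ n).2.2.2.1
  · simpa using (hl₁ x.1).mul (hl₂ x.2)

/-- An orthonormal frame of a product, from orthonormal frames of the factors. -/
lemma exists_prod_frame {V W : Type*} [AddCommGroup V] [Module ℝ V] [FiniteDimensional ℝ V]
    [AddCommGroup W] [Module ℝ W] [FiniteDimensional ℝ W] {g : V → V → ℝ} {g' : W → W → ℝ}
    (hg : IsScalarProduct g) (hg' : IsScalarProduct g') (b : OrthonormalFrame g)
    (b' : OrthonormalFrame g') :
    ∃ B : OrthonormalFrame (fun v w : V × W => g v.1 w.1 + g' v.2 w.2),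
      ∀ i, B.1 (Fin.cast Module.finrank_prod.symm i) =
        Fin.append (fun i => (b.1 i, 0)) (fun j => (0, b'.1 j)) i := by
  refine ⟨⟨fun i => Fin.append (fun i => (b.1 i, (0 : W))) (fun j => ((0 : V), b'.1 j))
    (Fin.cast Module.finrank_prod i), fun i j => ?_⟩, fun i => rfl⟩
  obtain ⟨i, rfl⟩ := (finCongr (Module.finrank_prod (R := ℝ) (M := V) (M' := W))).symm.surjective i
  obtain ⟨j, rfl⟩ := (finCongr (Module.finrank_prod (R := ℝ) (M := V) (M' := W))).symm.surjective j
  have hz (v : V) : g v 0 = 0 := by rw [hg.symm, hg.zero_left]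
  have hz' (v : W) : g' v 0 = 0 := by rw [hg'.symm, hg'.zero_left]
  refine Fin.addCases (fun i => ?_) (fun i => ?_) i <;>
  refine Fin.addCases (fun j => ?_) (fun j => ?_) j
  · simp [hg'.zero_left, b.2]
  · simp [hz, hg'.zero_left, Fin.ext_iff]
    omega
  · simp [hg.zero_left, hz', Fin.ext_iff]
    omega
  · simp [hg.zero_left, b'.2, Fin.ext_iff]

lemma IsScalarProduct.abs_apply_frame_top {U : Type*} [AddCommGroup U] [Module ℝ U]
    [FiniteDimensional ℝ U] {h : U → U → ℝ} (hh : IsScalarProduct h) (b : OrthonormalFrame h)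
    (α : U [⋀^Fin (Module.finrank ℝ U)]→ₗ[ℝ] ℝ) : |α b.1| = formNorm h α := by
  have h1 := hh.abs_apply_basis_eq (hh.frameBasis b) α
  have h2 : gram h (hh.frameBasis b) = 1 := by
    ext i j
    rw [hh.coe_frameBasis]
    exact (b.2 i j).trans (Matrix.one_apply).symm
  rw [h2, Matrix.det_one, Real.sqrt_one, mul_one, hh.coe_frameBasis] at h1
  exact h1

lemma formNorm_vcross_top {V W : Type*} [AddCommGroup V] [Module ℝ V] [FiniteDimensional ℝ V]
    [AddCommGroup W] [Module ℝ W] [FiniteDimensional ℝ W] {g : V → V → ℝ} {g' : W → W → ℝ}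
    (hg : IsScalarProduct g) (hg' : IsScalarProduct g')
    (α : V [⋀^Fin (Module.finrank ℝ V)]→ₗ[ℝ] ℝ) (β : W [⋀^Fin (Module.finrank ℝ W)]→ₗ[ℝ] ℝ) :
    formNorm (fun v w : V × W => g v.1 w.1 + g' v.2 w.2) (vcross α β) =
      formNorm g α * formNorm g' β := by
  obtain ⟨b⟩ := hg.nonempty_frame
  obtain ⟨b'⟩ := hg'.nonempty_frame
  obtain ⟨B, hB⟩ := exists_prod_frame hg hg' b b'
  rw [← formNorm_castDeg Module.finrank_prod.symm, ← (hg.prod hg').abs_apply_frame_top B, castDeg_apply]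
  simp only [hB]
  rw [vcross_append, abs_mul, hg.abs_apply_frame_top, hg'.abs_apply_frame_top]

variable [FiniteDimensional ℝ E₁] [FiniteDimensional ℝ E₂]

lemma IsVolumeForm.prod (hg₁ : IsRiemMetric g₁) (hg₂ : IsRiemMetric g₂)
    {vol₁ : DiffForm I₁ M₁ (Module.finrank ℝ E₁)} {vol₂ : DiffForm I₂ M₂ (Module.finrank ℝ E₂)}
    (h₁ : IsVolumeForm g₁ vol₁) (h₂ : IsVolumeForm g₂ vol₂) :
    IsVolumeForm (prodMetric g₁ g₂) (prodVolumeForm vol₁ vol₂) := by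
  refine ⟨fun x => ?_, fun x₀ v => ?_⟩
  · rw [prodVolumeForm, formNorm_castDeg, prodMetric_eq, cross_eq]
    refine (formNorm_vcross_top (hg₁.scalar x.1) (hg₂.scalar x.2) (vol₁ x.1) (vol₂ x.2)).trans ?_
    exact (congrArg₂ (· * ·) (h₁.1 x.1) (h₂.1 x.2)).trans (one_mul 1)
  · have h : ContinuousOn (fun y : E₁ × E₂ => vcross (inChart x₀.1 vol₁ y.1) (inChart x₀.2 vol₂ y.2)
        fun i => v (Fin.cast Module.finrank_prod.symm i)) (extChartAt (I₁.prod I₂) x₀).target := by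
      rw [extChartAt_prod_target]
      simp only [vcross_apply]
      refine continuousOn_finsetSum _ fun σ _ => continuousOn_const.mul (ContinuousOn.mul ?_ ?_)
      · exact (h₁.2 x₀.1 _).comp continuousOn_fst fun y hy => hy.1
      · exact (h₂.2 x₀.2 _).comp continuousOn_snd fun y hy => hy.2
    refine h.congr fun y hy => ?_
    exact DFunLike.congr_fun (inChart_cross vol₁ vol₂ hy) _

end ProductCharts

section ProductMeasure

lemma exists_addHaar_prod (E₁ E₂ : Type*) [NormedAddCommGroup E₁] [NormedSpace ℝ E₁]
    [FiniteDimensional ℝ E₁] [MeasurableSpace E₁] [BorelSpace E₁] [NormedAddCommGroup E₂]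
    [NormedSpace ℝ E₂] [FiniteDimensional ℝ E₂] [MeasurableSpace E₂] [BorelSpace E₂] :
    ∃ c : ℝ, 0 < c ∧ (Module.finBasis ℝ E₁).addHaar.prod (Module.finBasis ℝ E₂).addHaar =
        ENNReal.ofReal c • (Module.finBasis ℝ (E₁ × E₂)).addHaar ∧
      ∀ {g : E₁ × E₂ → E₁ × E₂ → ℝ}, IsScalarProduct g →
        √(gram g fun i => Module.finBasis ℝ (E₁ × E₂) i).det =
          c * √(gram g fun i => (Module.finBasis ℝ E₁).prod (Module.finBasis ℝ E₂) i).det := by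
  set b := Module.finBasis ℝ (E₁ × E₂)
  set B := (Module.finBasis ℝ E₁).prod (Module.finBasis ℝ E₂)
  let σ := b.indexEquiv B
  let b' := b.reindex σ
  let A : (E₁ × E₂) ≃ₗ[ℝ] (E₁ × E₂) := B.equiv b' (Equiv.refl _)
  have hA (i) : A (B i) = b' i := by simp [A]
  have hdet : LinearMap.det (A : (E₁ × E₂) →ₗ[ℝ] (E₁ × E₂)) ≠ 0 := A.isUnit_det'.ne_zero
  refine ⟨|LinearMap.det (A : (E₁ × E₂) →ₗ[ℝ] (E₁ × E₂))|, abs_pos.2 hdet, ?_,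
    fun {g} hg => ?_⟩
  · rw [← Module.Basis.prod_addHaar]
    change B.addHaar = _
    have h1 : b.addHaar = Measure.map A B.addHaar := by
      rw [← Module.Basis.addHaar_reindex b σ]
      change b'.addHaar = _
      have h2 : b' = B.map A := by
        refine Module.Basis.eq_of_apply_eq fun i => ?_
        rw [Module.Basis.map_apply, hA]
      have h3 := B.map_addHaar A.toContinuousLinearEquiv
      rw [h2]
      exact h3.symm
    have h4 := Measure.map_linearMap_addHaar_eq_smul_addHaar B.addHaar hdet
    have h5 : Measure.map A B.addHaar =
        ENNReal.ofReal |(LinearMap.det (A : (E₁ × E₂) →ₗ[ℝ] (E₁ × E₂)))⁻¹| • B.addHaar := h4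
    rw [h1, h5, smul_smul, ← ENNReal.ofReal_mul (abs_nonneg _), ← abs_mul, mul_inv_cancel₀ hdet]
    simp
  · have h1 := det_gram_comp hg B LinearMap.id (A : (E₁ × E₂) →ₗ[ℝ] (E₁ × E₂))
    have h2 : (gram g fun i => b i) =
        (gram g fun i => LinearMap.id (R := ℝ) ((A : (E₁ × E₂) →ₗ[ℝ] (E₁ × E₂)) (B i))).submatrix σ σ := by
      ext i j
      simp [gram, hA, b']
    rw [h2, Matrix.det_submatrix_equiv_self, h1, Real.sqrt_mul (sq_nonneg _),
      Real.sqrt_sq_eq_abs]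
    rfl

variable {E₁ : Type*} [NormedAddCommGroup E₁] [NormedSpace ℝ E₁] [FiniteDimensional ℝ E₁]
  [MeasurableSpace E₁] [BorelSpace E₁]
  {H₁ : Type*} [TopologicalSpace H₁] {I₁ : ModelWithCorners ℝ E₁ H₁} [I₁.Boundaryless]
  {M₁ : Type*} [TopologicalSpace M₁] [ChartedSpace H₁ M₁] [IsManifold I₁ ∞ M₁]
  {E₂ : Type*} [NormedAddCommGroup E₂] [NormedSpace ℝ E₂] [FiniteDimensional ℝ E₂]
  [MeasurableSpace E₂] [BorelSpace E₂]
  {H₂ : Type*} [TopologicalSpace H₂] {I₂ : ModelWithCorners ℝ E₂ H₂} [I₂.Boundaryless]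
  {M₂ : Type*} [TopologicalSpace M₂] [ChartedSpace H₂ M₂] [IsManifold I₂ ∞ M₂]
  {g₁ : MetricField I₁ M₁} {g₂ : MetricField I₂ M₂}

lemma gram_prod {V W ι κ : Type*} [AddCommGroup V] [Module ℝ V] [AddCommGroup W] [Module ℝ W]
    [Fintype ι] [Fintype κ] [DecidableEq ι] [DecidableEq κ] {g : V → V → ℝ} {g' : W → W → ℝ}
    (hg : IsScalarProduct g) (hg' : IsScalarProduct g') (a : ι → V) (b : κ → W) :
    (gram (fun v w : V × W => g v.1 w.1 + g' v.2 w.2)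
      (Sum.elim (fun i => (a i, 0)) fun j => (0, b j))).det = (gram g a).det * (gram g' b).det := by
  have hz (v : V) : g v 0 = 0 := by rw [hg.symm, hg.zero_left]
  have hz' (v : W) : g' v 0 = 0 := by rw [hg'.symm, hg'.zero_left]
  have : gram (fun v w : V × W => g v.1 w.1 + g' v.2 w.2)
      (Sum.elim (fun i => (a i, 0)) fun j => (0, b j)) =
      Matrix.fromBlocks (gram g a) 0 0 (gram g' b) := by
    ext i j
    rcases i with i | i <;> rcases j with j | j <;>
      simp [gram, hg.zero_left, hg'.zero_left, hz, hz']
  rw [this, Matrix.det_fromBlocks_zero₂₁]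

/-- The chart densities and the Lebesgue measures of a product. -/
lemma exists_chartDensity_prod (hg₁ : IsRiemMetric g₁) (hg₂ : IsRiemMetric g₂) :
    ∃ c : ℝ, 0 < c ∧ (Module.finBasis ℝ E₁).addHaar.prod (Module.finBasis ℝ E₂).addHaar =
        ENNReal.ofReal c • (Module.finBasis ℝ (E₁ × E₂)).addHaar ∧
      ∀ (x₀ : M₁ × M₂), ∀ y ∈ (extChartAt (I₁.prod I₂) x₀).target,
        chartDensity (prodMetric g₁ g₂) x₀ y =
          c * (chartDensity g₁ x₀.1 y.1 * chartDensity g₂ x₀.2 y.2) := by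
  obtain ⟨c, hc, h1, h2⟩ := exists_addHaar_prod E₁ E₂
  refine ⟨c, hc, h1, fun x₀ y hy => ?_⟩
  have hy' := hy
  rw [extChartAt_prod_target] at hy'
  have hs₁ := (hg₁.scalar ((extChartAt I₁ x₀.1).symm y.1)).comp_injective
    (L := (dchart I₁ x₀.1 y.1).toLinearMap) fun a b h => (chartEquiv hy'.1).injective (by
      rw [chartEquiv_apply, chartEquiv_apply]; exact h)
  have hs₂ := (hg₂.scalar ((extChartAt I₂ x₀.2).symm y.2)).comp_injective
    (L := (dchart I₂ x₀.2 y.2).toLinearMap) fun a b h => (chartEquiv hy'.2).injective (by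
      rw [chartEquiv_apply, chartEquiv_apply]; exact h)
  have h3 := h2 (hs₁.prod hs₂)
  have h4 : chartDensity (prodMetric g₁ g₂) x₀ y = √(gram (fun v w : E₁ × E₂ =>
      (fun a b : E₁ => g₁ ((extChartAt I₁ x₀.1).symm y.1) (dchart I₁ x₀.1 y.1 a)
        (dchart I₁ x₀.1 y.1 b)) v.1 w.1 + (fun a b : E₂ => g₂ ((extChartAt I₂ x₀.2).symm y.2)
          (dchart I₂ x₀.2 y.2 a) (dchart I₂ x₀.2 y.2 b)) v.2 w.2) fun i =>
            Module.finBasis ℝ (E₁ × E₂) i).det := by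
    rw [chartDensity_eq]
    congr 2
    ext i j
    exact prodMetric_dchart hy _ _
  have h5 : (fun i => (Module.finBasis ℝ E₁).prod (Module.finBasis ℝ E₂) i) =
      Sum.elim (fun i => (Module.finBasis ℝ E₁ i, 0)) fun j => (0, Module.finBasis ℝ E₂ j) := by
    funext i
    rw [Module.Basis.prod_apply]
    rfl
  rw [h4]
  refine h3.trans ?_
  rw [h5, gram_prod hs₁ hs₂, Real.sqrt_mul]
  · rfl
  · exact (hg₁.det_chartGram_pos (Module.finBasis ℝ E₁) hy'.1).le

instance sFinite_chartLebesgue (x₀ : M₁) : SFinite (chartLebesgue I₁ x₀) := by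
  unfold chartLebesgue; infer_instance

lemma chartLebesgue_prod {c : ℝ}
    (h : (Module.finBasis ℝ E₁).addHaar.prod (Module.finBasis ℝ E₂).addHaar =
        ENNReal.ofReal c • (Module.finBasis ℝ (E₁ × E₂)).addHaar) (x₀ : M₁ × M₂) :
    (chartLebesgue I₁ x₀.1).prod (chartLebesgue I₂ x₀.2) =
      ENNReal.ofReal c • chartLebesgue (I₁.prod I₂) x₀ := by
  rw [chartLebesgue, chartLebesgue, Measure.prod_restrict, h, chartLebesgue,
    extChartAt_prod_target, Measure.restrict_smul]

variable [MeasurableSpace M₁] [BorelSpace M₁] [SecondCountableTopology M₁]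
  [MeasurableSpace M₂] [BorelSpace M₂] [SecondCountableTopology M₂]

lemma chartMeasure_prod (hg₁ : IsRiemMetric g₁) (hg₂ : IsRiemMetric g₂) (x₀ : M₁ × M₂) :
    chartMeasure (prodMetric g₁ g₂) x₀ = (chartMeasure g₁ x₀.1).prod (chartMeasure g₂ x₀.2) := by
  obtain ⟨c, hc, h1, h2⟩ := exists_chartDensity_prod hg₁ hg₂
  have hl := chartLebesgue_prod (I₁ := I₁) (I₂ := I₂) h1 x₀
  rw [(hg₁.prod hg₂).chartMeasure_eq_map, hg₁.chartMeasure_eq_map, hg₂.chartMeasure_eq_map,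
    Measure.map_prod_map _ _ (measurable_chartSymm _) (measurable_chartSymm _),
    prod_withDensity₀ (hg₁.aemeasurable_ofReal_chartDensity _)
      (hg₂.aemeasurable_ofReal_chartDensity _), hl, withDensity_smul_measure]
  have h3 : (chartLebesgue (I₁.prod I₂) x₀).withDensity (fun y =>
      ENNReal.ofReal (chartDensity (prodMetric g₁ g₂) x₀ y)) =
      ENNReal.ofReal c • (chartLebesgue (I₁.prod I₂) x₀).withDensity (fun z =>
        ENNReal.ofReal (chartDensity g₁ x₀.1 z.1) * ENNReal.ofReal (chartDensity g₂ x₀.2 z.2)) := by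
    rw [← withDensity_smul' _ _ ENNReal.ofReal_ne_top]
    refine withDensity_congr_ae ?_
    filter_upwards [ae_chartLebesgue_mem (I := I₁.prod I₂) x₀] with y hy
    rw [h2 x₀ y hy, ENNReal.ofReal_mul hc.le, ENNReal.ofReal_mul (show 0 ≤ chartDensity g₁ x₀.1 y.1 from Real.sqrt_nonneg _)]
    rfl
  rw [h3]
  refine Measure.map_congr ?_
  refine Measure.ae_smul_measure ?_ _
  refine (withDensity_absolutelyContinuous _ _).ae_le ?_
  filter_upwards [ae_chartLebesgue_mem (I := I₁.prod I₂) x₀] with y hy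
  have hy' := hy
  rw [extChartAt_prod_target] at hy'
  rw [chartSymm_eq hy, extChartAt_prod_symm, Prod.map_apply', chartSymm_eq hy'.1,
    chartSymm_eq hy'.2]

/-- The Riemannian measure of a product is the product of the Riemannian measures. -/
theorem riemVolume_prod (hg₁ : IsRiemMetric g₁) (hg₂ : IsRiemMetric g₂) :
    riemVolume (prodMetric g₁ g₂) = (riemVolume g₁).prod (riemVolume g₂) := by
  have := hg₁.sFinite_riemVolume
  have := hg₂.sFinite_riemVolume
  obtain ⟨t, ht, hcov⟩ := exists_countable_cover (I₁.prod I₂) (M₁ × M₂)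
  rw [riemVolume_eq_iSup]
  refine iSup_measure_eq (U := fun x : M₁ × M₂ => (extChartAt (I₁.prod I₂) x).source)
    (fun x => measurableSet_source x) ht hcov fun x => ?_
  show ((riemVolume g₁).prod (riemVolume g₂)).restrict (extChartAt (I₁.prod I₂) x).source = _
  rw [extChartAt_prod_source, ← Measure.prod_restrict, hg₁.riemVolume_restrict,
    hg₂.riemVolume_restrict, chartMeasure_prod hg₁ hg₂]

lemma aestronglyMeasurable_chartLebesgue_prod {f : E₁ × E₂ → ℝ} {x₀ : M₁ × M₂}
    (hf : AEStronglyMeasurable f ((chartLebesgue I₁ x₀.1).prod (chartLebesgue I₂ x₀.2))) :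
    AEStronglyMeasurable f (chartLebesgue (I₁.prod I₂) x₀) := by
  obtain ⟨c, hc, h1, -⟩ := exists_addHaar_prod E₁ E₂
  rw [chartLebesgue_prod h1] at hf
  exact hf.mono_ac (Measure.absolutelyContinuous_smul (by simpa using hc))

end ProductMeasure

section LocalProduct

variable {E₁ : Type*} [NormedAddCommGroup E₁] [NormedSpace ℝ E₁] [FiniteDimensional ℝ E₁]
  [MeasurableSpace E₁] [BorelSpace E₁]
  {E₂ : Type*} [NormedAddCommGroup E₂] [NormedSpace ℝ E₂] [FiniteDimensional ℝ E₂]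
  [MeasurableSpace E₂] [BorelSpace E₂] {μ₁ : Measure E₁} {μ₂ : Measure E₂}
  [SFinite μ₁] [SFinite μ₂] {U₁ : Set E₁} {U₂ : Set E₂} {k l : ℕ}

lemma integrable_mul_prod {f₁ : E₁ → ℝ} {f₂ : E₂ → ℝ} {K₁ : Set E₁} {K₂ : Set E₂}
    (hK₁ : IsCompact K₁) (hK₂ : IsCompact K₂) (h₁ : IntegrableOn f₁ K₁ μ₁)
    (h₂ : IntegrableOn f₂ K₂ μ₂) {ψ : E₁ × E₂ → ℝ} (hψ : Continuous ψ)
    (hb : ∃ C, ∀ y, ‖ψ y‖ ≤ C) (hs : ∀ y, ψ y ≠ 0 → y.1 ∈ K₁ ∧ y.2 ∈ K₂) :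
    Integrable (fun y => ψ y * (f₁ y.1 * f₂ y.2)) (μ₁.prod μ₂) := by
  obtain ⟨C, hC⟩ := hb
  have h3 := (h₁.integrable_indicator hK₁.measurableSet).mul_prod
    (h₂.integrable_indicator hK₂.measurableSet)
  refine (h3.bdd_mul (c := C) hψ.aestronglyMeasurable (Eventually.of_forall hC)).congr
    (Eventually.of_forall fun y => ?_)
  by_cases hy : ψ y = 0
  · simp [hy]
  · obtain ⟨m₁, m₂⟩ := hs y hy
    simp [indicator_of_mem m₁, indicator_of_mem m₂]

section TestFunction

variable {φ : E₁ × E₂ → ℝ} (hφ : ContDiff ℝ ∞ φ) (hc : HasCompactSupport φ)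
  (hs : tsupport φ ⊆ U₁ ×ˢ U₂)

include hc hs in
lemma fst_image_tsupport : IsCompact (Prod.fst '' tsupport φ) ∧ Prod.fst '' tsupport φ ⊆ U₁ :=
  ⟨hc.isCompact.image continuous_fst, by rintro _ ⟨y, hy, rfl⟩; exact (hs hy).1⟩

include hc hs in
lemma snd_image_tsupport : IsCompact (Prod.snd '' tsupport φ) ∧ Prod.snd '' tsupport φ ⊆ U₂ :=
  ⟨hc.isCompact.image continuous_snd, by rintro _ ⟨y, hy, rfl⟩; exact (hs hy).2⟩

include hφ hc hs in
lemma integrable_test_mul {β₁ : E₁ → E₁ [⋀^Fin k]→ₗ[ℝ] ℝ} {β₂ : E₂ → E₂ [⋀^Fin l]→ₗ[ℝ] ℝ}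
    (h₁ : IsLocLp μ₁ U₁ 1 β₁) (h₂ : IsLocLp μ₂ U₂ 1 β₂) (a : Fin k → E₁) (b : Fin l → E₂) :
    Integrable (fun y => φ y * (β₁ y.1 a * β₂ y.2 b)) (μ₁.prod μ₂) := by
  obtain ⟨k₁, s₁⟩ := fst_image_tsupport hc hs
  obtain ⟨k₂, s₂⟩ := snd_image_tsupport hc hs
  exact integrable_mul_prod k₁ k₂ (memLp_one_iff_integrable.1 (h₁ _ k₁ s₁ a))
    (memLp_one_iff_integrable.1 (h₂ _ k₂ s₂ b)) hφ.continuous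
    (hφ.continuous.bounded_above_of_compact_support hc) fun y hy =>
      ⟨mem_image_of_mem _ (subset_tsupport _ hy), mem_image_of_mem _ (subset_tsupport _ hy)⟩

include hφ hc hs in
lemma integrable_fderiv_test_mul {β₁ : E₁ → E₁ [⋀^Fin k]→ₗ[ℝ] ℝ}
    {β₂ : E₂ → E₂ [⋀^Fin l]→ₗ[ℝ] ℝ}
    (h₁ : IsLocLp μ₁ U₁ 1 β₁) (h₂ : IsLocLp μ₂ U₂ 1 β₂) (w : E₁ × E₂) (a : Fin k → E₁)
    (b : Fin l → E₂) :
    Integrable (fun y => fderiv ℝ φ y w * (β₁ y.1 a * β₂ y.2 b)) (μ₁.prod μ₂) := by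
  obtain ⟨k₁, s₁⟩ := fst_image_tsupport hc hs
  obtain ⟨k₂, s₂⟩ := snd_image_tsupport hc hs
  obtain ⟨hw, hw'⟩ := bounded_fderiv_apply hφ hc w
  refine integrable_mul_prod k₁ k₂ (memLp_one_iff_integrable.1 (h₁ _ k₁ s₁ a))
    (memLp_one_iff_integrable.1 (h₂ _ k₂ s₂ b)) hw hw' fun y hy => ?_
  have := tsupport_fderiv_apply_subset_tsupport w (subset_tsupport _ hy)
  exact ⟨mem_image_of_mem _ this, mem_image_of_mem _ this⟩

include hφ in
lemma fderiv_comp_mk_right (x : E₁) (y : E₂) : fderiv ℝ (fun x => φ (x, y)) x =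
    (fderiv ℝ φ (x, y)).comp (ContinuousLinearMap.inl ℝ E₁ E₂) := by
  have h1 : HasFDerivAt φ (fderiv ℝ φ (x, y)) (x, y) :=
    (hφ.differentiable (by simp) (x, y)).hasFDerivAt
  exact (HasFDerivAt.comp x h1 (hasFDerivAt_prodMk_left x y)).fderiv

include hφ in
lemma fderiv_comp_mk_left (x : E₁) (y : E₂) : fderiv ℝ (fun y => φ (x, y)) y =
    (fderiv ℝ φ (x, y)).comp (ContinuousLinearMap.inr ℝ E₁ E₂) := by
  have h1 : HasFDerivAt φ (fderiv ℝ φ (x, y)) (x, y) :=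
    (hφ.differentiable (by simp) (x, y)).hasFDerivAt
  exact (HasFDerivAt.comp y h1 (hasFDerivAt_prodMk_right x y)).fderiv

include hφ hc hs in
lemma integrable_lwedge_inl_mul {β₁ : E₁ → E₁ [⋀^Fin k]→ₗ[ℝ] ℝ}
    {β₂ : E₂ → E₂ [⋀^Fin l]→ₗ[ℝ] ℝ} (h₁ : IsLocLp μ₁ U₁ 1 β₁) (h₂ : IsLocLp μ₂ U₂ 1 β₂)
    (a : Fin (k + 1) → E₁) (b : Fin l → E₂) :
    Integrable (fun y => lwedge ((fderiv ℝ φ y).toLinearMap ∘ₗ LinearMap.inl ℝ E₁ E₂) (β₁ y.1) a *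
      β₂ y.2 b) (μ₁.prod μ₂) := by
  simp only [lwedge_apply, Finset.sum_mul]
  refine integrable_finsetSum _ fun i _ => ?_
  refine ((integrable_fderiv_test_mul hφ hc hs h₁ h₂ (a i, 0) (fun j => a (i.succAbove j)) b).const_mul
    ((-1 : ℝ) ^ (i : ℕ))).congr (Eventually.of_forall fun y => ?_)
  show _ = (-1 : ℝ) ^ (i : ℕ) * (fderiv ℝ φ y (a i, 0) * _) * _
  ring

include hφ hc hs in
lemma integrable_mul_lwedge_inr {β₁ : E₁ → E₁ [⋀^Fin k]→ₗ[ℝ] ℝ}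
    {β₂ : E₂ → E₂ [⋀^Fin l]→ₗ[ℝ] ℝ} (h₁ : IsLocLp μ₁ U₁ 1 β₁) (h₂ : IsLocLp μ₂ U₂ 1 β₂)
    (a : Fin k → E₁) (b : Fin (l + 1) → E₂) :
    Integrable (fun y => β₁ y.1 a *
      lwedge ((fderiv ℝ φ y).toLinearMap ∘ₗ LinearMap.inr ℝ E₁ E₂) (β₂ y.2) b) (μ₁.prod μ₂) := by
  simp only [lwedge_apply, Finset.mul_sum]
  refine integrable_finsetSum _ fun i _ => ?_
  refine ((integrable_fderiv_test_mul hφ hc hs h₁ h₂ (0, b i) a fun j => b (i.succAbove j)).const_mul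
    ((-1 : ℝ) ^ (i : ℕ))).congr (Eventually.of_forall fun y => ?_)
  show _ = _ * ((-1 : ℝ) ^ (i : ℕ) * (fderiv ℝ φ y (0, b i) * _))
  ring

include hφ hc hs in
lemma IsLocalWeakDeriv.integral_prod_left {β₁ : E₁ → E₁ [⋀^Fin k]→ₗ[ℝ] ℝ}
    {θ₁ : E₁ → E₁ [⋀^Fin (k + 1)]→ₗ[ℝ] ℝ} {β₂ : E₂ → E₂ [⋀^Fin l]→ₗ[ℝ] ℝ}
    (hd : IsLocalWeakDeriv μ₁ U₁ β₁ θ₁)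
    (h₁ : IsLocLp μ₁ U₁ 1 β₁) (hθ : IsLocLp μ₁ U₁ 1 θ₁) (h₂ : IsLocLp μ₂ U₂ 1 β₂)
    (a : Fin (k + 1) → E₁) (b : Fin l → E₂) :
    ∫ y, φ y * (θ₁ y.1 a * β₂ y.2 b) ∂(μ₁.prod μ₂) =
      -∫ y, lwedge ((fderiv ℝ φ y).toLinearMap ∘ₗ LinearMap.inl ℝ E₁ E₂) (β₁ y.1) a *
        β₂ y.2 b ∂(μ₁.prod μ₂) := by
  rw [integral_prod_symm _ (integrable_test_mul hφ hc hs hθ h₂ a b),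
    integral_prod_symm _ (integrable_lwedge_inl_mul hφ hc hs h₁ h₂ a b), ← integral_neg]
  refine integral_congr_ae (Eventually.of_forall fun y => ?_)
  have hsub : tsupport (fun x => φ (x, y)) ⊆ (fun x => (x, y)) ⁻¹' tsupport φ :=
    tsupport_comp_subset_preimage φ (by fun_prop)
  obtain ⟨k₁, s₁⟩ := fst_image_tsupport hc hs
  have h4 := hd (fun x => φ (x, y)) (hφ.comp (by fun_prop))
    (k₁.of_isClosed_subset (isClosed_tsupport _) fun x hx => ⟨(x, y), hsub hx, rfl⟩)
    (fun x hx => (hs (hsub hx)).1) a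
  simp only [← mul_assoc]
  rw [integral_mul_const, integral_mul_const, h4, neg_mul]
  simp only [fderiv_comp_mk_right hφ]
  rfl

include hφ hc hs in
lemma IsLocalWeakDeriv.integral_prod_right {β₁ : E₁ → E₁ [⋀^Fin k]→ₗ[ℝ] ℝ}
    {θ₂ : E₂ → E₂ [⋀^Fin (l + 1)]→ₗ[ℝ] ℝ} {β₂ : E₂ → E₂ [⋀^Fin l]→ₗ[ℝ] ℝ}
    (hd : IsLocalWeakDeriv μ₂ U₂ β₂ θ₂)
    (h₁ : IsLocLp μ₁ U₁ 1 β₁) (hθ : IsLocLp μ₂ U₂ 1 θ₂) (h₂ : IsLocLp μ₂ U₂ 1 β₂)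
    (a : Fin k → E₁) (b : Fin (l + 1) → E₂) :
    ∫ y, φ y * (β₁ y.1 a * θ₂ y.2 b) ∂(μ₁.prod μ₂) =
      -∫ y, β₁ y.1 a * lwedge ((fderiv ℝ φ y).toLinearMap ∘ₗ LinearMap.inr ℝ E₁ E₂) (β₂ y.2) b
        ∂(μ₁.prod μ₂) := by
  rw [integral_prod _ (integrable_test_mul hφ hc hs h₁ hθ a b),
    integral_prod _ (integrable_mul_lwedge_inr hφ hc hs h₁ h₂ a b), ← integral_neg]
  refine integral_congr_ae (Eventually.of_forall fun x => ?_)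
  have hsub : tsupport (fun y => φ (x, y)) ⊆ (fun y => (x, y)) ⁻¹' tsupport φ :=
    tsupport_comp_subset_preimage φ (by fun_prop)
  obtain ⟨k₁, s₁⟩ := snd_image_tsupport hc hs
  have h4 := hd (fun y => φ (x, y)) (hφ.comp (by fun_prop))
    (k₁.of_isClosed_subset (isClosed_tsupport _) fun y hy => ⟨(x, y), hsub hy, rfl⟩)
    (fun y hy => (hs (hsub hy)).2) b
  simp only [mul_left_comm (φ _)]
  rw [integral_const_mul, integral_const_mul, h4, mul_neg]
  simp only [fderiv_comp_mk_left hφ]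
  rfl

end TestFunction

lemma integral_mul_vcross {μ : Measure (E₁ × E₂)} {φ : E₁ × E₂ → ℝ}
    {α : E₁ × E₂ → E₁ [⋀^Fin k]→ₗ[ℝ] ℝ} {β : E₁ × E₂ → E₂ [⋀^Fin l]→ₗ[ℝ] ℝ}
    (h : ∀ a b, Integrable (fun y => φ y * (α y a * β y b)) μ) (v : Fin (k + l) → E₁ × E₂) :
    Integrable (fun y => φ y * vcross (α y) (β y) v) μ ∧
    ∫ y, φ y * vcross (α y) (β y) v ∂μ = ∑ σ : Equiv.Perm (Fin (k + l)),
      ((Equiv.Perm.sign σ : ℤ) : ℝ) / (k.factorial * l.factorial) *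
        ∫ y, φ y * (α y (fun i => (v (σ (Fin.castAdd l i))).1) *
          β y (fun j => (v (σ (Fin.natAdd k j))).2)) ∂μ := by
  have h' (σ : Equiv.Perm (Fin (k + l))) : Integrable (fun y =>
      ((Equiv.Perm.sign σ : ℤ) : ℝ) / (k.factorial * l.factorial) *
        (φ y * (α y (fun i => (v (σ (Fin.castAdd l i))).1) *
          β y (fun j => (v (σ (Fin.natAdd k j))).2)))) μ := (h _ _).const_mul _
  simp only [vcross_apply, Finset.mul_sum, mul_left_comm (φ _)] at h' ⊢
  refine ⟨integrable_finsetSum _ fun σ _ => h' σ, ?_⟩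
  rw [integral_finsetSum _ fun σ _ => h' σ]
  simp only [integral_const_mul]

/-- The differential of a product of forms on open sets of two vector spaces. -/
theorem IsLocalWeakDeriv.vcross {β₁ : E₁ → E₁ [⋀^Fin k]→ₗ[ℝ] ℝ}
    {θ₁ : E₁ → E₁ [⋀^Fin (k + 1)]→ₗ[ℝ] ℝ} {β₂ : E₂ → E₂ [⋀^Fin l]→ₗ[ℝ] ℝ}
    {θ₂ : E₂ → E₂ [⋀^Fin (l + 1)]→ₗ[ℝ] ℝ} (h₁ : IsLocLp μ₁ U₁ 1 β₁) (h₁' : IsLocLp μ₁ U₁ 1 θ₁)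
    (h₂ : IsLocLp μ₂ U₂ 1 β₂) (h₂' : IsLocLp μ₂ U₂ 1 θ₂)
    (hd₁ : IsLocalWeakDeriv μ₁ U₁ β₁ θ₁) (hd₂ : IsLocalWeakDeriv μ₂ U₂ β₂ θ₂)
    (h : k + 1 + l = k + l + 1) {ε : ℝ}
    (hε : ∀ (ℓ : E₁ × E₂ →ₗ[ℝ] ℝ) (β : E₁ [⋀^Fin k]→ₗ[ℝ] ℝ) (γ : E₂ [⋀^Fin l]→ₗ[ℝ] ℝ),
      lwedge ℓ (LpForms.vcross β γ) =
        castDeg h (LpForms.vcross (lwedge (ℓ ∘ₗ LinearMap.inl ℝ E₁ E₂) β) γ) +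
          ε • LpForms.vcross β (lwedge (ℓ ∘ₗ LinearMap.inr ℝ E₁ E₂) γ)) :
    IsLocalWeakDeriv (μ₁.prod μ₂) (U₁ ×ˢ U₂) (fun y => LpForms.vcross (β₁ y.1) (β₂ y.2))
      (fun y => castDeg h (LpForms.vcross (θ₁ y.1) (β₂ y.2)) +
        ε • (LpForms.vcross (β₁ y.1) (θ₂ y.2) : (E₁ × E₂) [⋀^Fin (k + (l + 1))]→ₗ[ℝ] ℝ)) := by
  intro φ hφ hc hs v
  obtain ⟨i1, e1⟩ := integral_mul_vcross (fun a b => integrable_test_mul hφ hc hs h₁' h₂ a b)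
    (fun i => v (Fin.cast h i))
  obtain ⟨i2, e2⟩ := integral_mul_vcross (fun a b => integrable_test_mul hφ hc hs h₁ h₂' a b) v
  obtain ⟨i3, e3⟩ := integral_mul_vcross (φ := 1) (μ := μ₁.prod μ₂)
    (α := fun y => lwedge ((fderiv ℝ φ y).toLinearMap ∘ₗ LinearMap.inl ℝ E₁ E₂) (β₁ y.1))
    (β := fun y => β₂ y.2)
    (fun a b => by
      simp only [Pi.one_apply, one_mul]
      exact integrable_lwedge_inl_mul hφ hc hs h₁ h₂ a b) (fun i => v (Fin.cast h i))
  obtain ⟨i4, e4⟩ := integral_mul_vcross (φ := 1) (μ := μ₁.prod μ₂) (α := fun y => β₁ y.1)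
    (β := fun y => lwedge ((fderiv ℝ φ y).toLinearMap ∘ₗ LinearMap.inr ℝ E₁ E₂) (β₂ y.2))
    (fun a b => by
      simp only [Pi.one_apply, one_mul]
      exact integrable_mul_lwedge_inr hφ hc hs h₁ h₂ a b) v
  simp only [hd₁.integral_prod_left hφ hc hs h₁ h₁' h₂] at e1
  simp only [hd₂.integral_prod_right hφ hc hs h₁ h₂' h₂] at e2
  simp only [Pi.one_apply, one_mul] at i3 e3 i4 e4
  simp only [mul_neg, Finset.sum_neg_distrib] at e1 e2
  rw [← e3] at e1
  rw [← e4] at e2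
  simp only [hε, AlternatingMap.add_apply, AlternatingMap.smul_apply, castDeg_apply, smul_eq_mul,
    mul_add, mul_left_comm _ ε]
  rw [integral_add i1 (i2.const_mul ε), integral_add i3 (i4.const_mul ε), integral_const_mul,
    integral_const_mul, e1]
  refine (congrArg (fun t => _ + ε * t) e2).trans ?_
  ring

end LocalProduct

section CrossProduct

lemma eLpNorm_prod_mul {X Y : Type*} [MeasurableSpace X] [MeasurableSpace Y] {μ : Measure X}
    {ν : Measure Y} [SFinite μ] [SFinite ν] {f : X → ℝ} {f' : Y → ℝ}
    (hf : AEStronglyMeasurable f μ) (hf' : AEStronglyMeasurable f' ν) {p : ℝ≥0∞} (hp : p ≠ 0)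
    (hp' : p ≠ ⊤) :
    eLpNorm (fun z : X × Y => f z.1 * f' z.2) p (μ.prod ν) = eLpNorm f p μ * eLpNorm f' p ν := by
  have h0 : 0 ≤ p.toReal := ENNReal.toReal_nonneg
  simp only [eLpNorm_eq_lintegral_rpow_enorm_toReal hp hp', enorm_mul,
    ENNReal.mul_rpow_of_nonneg _ _ h0]
  rw [lintegral_prod_mul (hf.enorm.pow_const _) (hf'.enorm.pow_const _),
    ENNReal.mul_rpow_of_nonneg _ _ (by positivity)]

section Local

variable {E : Type*} [NormedAddCommGroup E] [NormedSpace ℝ E] [MeasurableSpace E] {μ : Measure E}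
  {U : Set E} {k : ℕ} {θ θ' : E → E [⋀^Fin k]→ₗ[ℝ] ℝ} {η η' : E → E [⋀^Fin (k + 1)]→ₗ[ℝ] ℝ}

lemma IsLocalWeakDeriv.congr (h : IsLocalWeakDeriv μ U θ η) (hθ : EqOn θ θ' U) (hη : EqOn η η' U) :
    IsLocalWeakDeriv μ U θ' η' := fun φ h1 h2 h3 v => by
  rw [integral_congr_ae (g := fun y => φ y * η y v) (Eventually.of_forall fun y => ?_),
    h φ h1 h2 h3 v, integral_congr_ae (Eventually.of_forall fun y => ?_)]
  · by_cases hy : y ∈ tsupport φ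
    · simp only [hθ (h3 hy)]
    · simp [lwedge_apply, image_eq_zero_of_notMem_tsupport
        (fun h => hy (tsupport_fderiv_subset ℝ h))]
  · by_cases hy : y ∈ tsupport φ
    · simp only [hη (h3 hy)]
    · simp [image_eq_zero_of_notMem_tsupport hy]

lemma IsLocalWeakDeriv.of_smul_measure {c : ℝ≥0∞} (hc : c ≠ 0) (hc' : c ≠ ⊤)
    (h : IsLocalWeakDeriv (c • μ) U θ η) : IsLocalWeakDeriv μ U θ η := fun φ h1 h2 h3 v => by
  have h4 := h φ h1 h2 h3 v
  rw [integral_smul_measure, integral_smul_measure, ← smul_neg] at h4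
  exact smul_right_injective ℝ (ENNReal.toReal_pos hc hc').ne' h4

end Local

section VCross

variable {V W : Type*} [AddCommGroup V] [Module ℝ V] [AddCommGroup W] [Module ℝ W] {k l : ℕ}

lemma vcross_castDeg {k' l' : ℕ} (hk : k = k') (hl : l = l') (h : k + l = k' + l') (α : V [⋀^Fin k]→ₗ[ℝ] ℝ)
    (β : W [⋀^Fin l]→ₗ[ℝ] ℝ) :
    vcross (castDeg hk α) (castDeg hl β) = castDeg h (vcross α β) := by
  subst hk hl
  rfl

lemma vcross_add_left (α α' : V [⋀^Fin k]→ₗ[ℝ] ℝ) (β : W [⋀^Fin l]→ₗ[ℝ] ℝ) :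
    vcross (α + α') β = vcross α β + vcross α' β := by
  ext v
  simp only [vcross_apply, AlternatingMap.add_apply, ← Finset.sum_add_distrib]
  exact Finset.sum_congr rfl fun σ _ => by ring

lemma vcross_add_right (α : V [⋀^Fin k]→ₗ[ℝ] ℝ) (β β' : W [⋀^Fin l]→ₗ[ℝ] ℝ) :
    vcross α (β + β') = vcross α β + vcross α β' := by
  ext v
  simp only [vcross_apply, AlternatingMap.add_apply, ← Finset.sum_add_distrib]
  exact Finset.sum_congr rfl fun σ _ => by ring

lemma vcross_smul_left (c : ℝ) (α : V [⋀^Fin k]→ₗ[ℝ] ℝ) (β : W [⋀^Fin l]→ₗ[ℝ] ℝ) :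
    vcross (c • α) β = c • vcross α β := by
  ext v
  simp only [vcross_apply, AlternatingMap.smul_apply, smul_eq_mul, Finset.mul_sum]
  exact Finset.sum_congr rfl fun σ _ => by ring

lemma vcross_smul_right (c : ℝ) (α : V [⋀^Fin k]→ₗ[ℝ] ℝ) (β : W [⋀^Fin l]→ₗ[ℝ] ℝ) :
    vcross α (c • β) = c • vcross α β := by
  ext v
  simp only [vcross_apply, AlternatingMap.smul_apply, smul_eq_mul, Finset.mul_sum]
  exact Finset.sum_congr rfl fun σ _ => by ring

end VCross

variable {E₁ : Type*} [NormedAddCommGroup E₁] [NormedSpace ℝ E₁] [FiniteDimensional ℝ E₁]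
  [MeasurableSpace E₁] [BorelSpace E₁]
  {H₁ : Type*} [TopologicalSpace H₁] {I₁ : ModelWithCorners ℝ E₁ H₁} [I₁.Boundaryless]
  {M₁ : Type*} [TopologicalSpace M₁] [ChartedSpace H₁ M₁] [IsManifold I₁ ∞ M₁]
  {E₂ : Type*} [NormedAddCommGroup E₂] [NormedSpace ℝ E₂] [FiniteDimensional ℝ E₂]
  [MeasurableSpace E₂] [BorelSpace E₂]
  {H₂ : Type*} [TopologicalSpace H₂] {I₂ : ModelWithCorners ℝ E₂ H₂} [I₂.Boundaryless]
  {M₂ : Type*} [TopologicalSpace M₂] [ChartedSpace H₂ M₂] [IsManifold I₂ ∞ M₂]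
  {g₁ : MetricField I₁ M₁} {g₂ : MetricField I₂ M₂}
  [T2Space M₁] [MeasurableSpace M₁] [BorelSpace M₁] [SecondCountableTopology M₁]
  [T2Space M₂] [MeasurableSpace M₂] [BorelSpace M₂] [SecondCountableTopology M₂]
  {p : ℝ} {k l k₁ k₂ l₁ l₂ : ℕ}

lemma cross_add_left (α α' : DiffForm I₁ M₁ k) (β : DiffForm I₂ M₂ l) :
    cross (α + α') β = cross α β + cross α' β := by
  funext x
  ext v
  exact (DFunLike.congr_fun (cross_eq (α + α') β x) v).trans
    ((DFunLike.congr_fun (vcross_add_left (α x.1) (α' x.1) (β x.2)) v).trans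
      (congrArg₂ (· + ·) (DFunLike.congr_fun (cross_eq α β x) v).symm
        (DFunLike.congr_fun (cross_eq α' β x) v).symm))

lemma cross_smul_left (c : ℝ) (α : DiffForm I₁ M₁ k) (β : DiffForm I₂ M₂ l) :
    cross (c • α) β = c • cross α β := by
  funext x
  ext v
  exact (DFunLike.congr_fun (cross_eq (c • α) β x) v).trans
    ((DFunLike.congr_fun (vcross_smul_left c (α x.1) (β x.2)) v).trans
      (congrArg (c * ·) (DFunLike.congr_fun (cross_eq α β x) v).symm))

lemma cross_add_right (α : DiffForm I₁ M₁ k) (β β' : DiffForm I₂ M₂ l) :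
    cross α (β + β') = cross α β + cross α β' := by
  funext x
  ext v
  exact (DFunLike.congr_fun (cross_eq α (β + β') x) v).trans
    ((DFunLike.congr_fun (vcross_add_right (α x.1) (β x.2) (β' x.2)) v).trans
      (congrArg₂ (· + ·) (DFunLike.congr_fun (cross_eq α β x) v).symm
        (DFunLike.congr_fun (cross_eq α β' x) v).symm))

lemma cross_smul_right (c : ℝ) (α : DiffForm I₁ M₁ k) (β : DiffForm I₂ M₂ l) :
    cross α (c • β) = c • cross α β := by
  funext x
  ext v
  exact (DFunLike.congr_fun (cross_eq α (c • β) x) v).trans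
    ((DFunLike.congr_fun (vcross_smul_right c (α x.1) (β x.2)) v).trans
      (congrArg (c * ·) (DFunLike.congr_fun (cross_eq α β x) v).symm))

lemma cross_sub_left (α α' : DiffForm I₁ M₁ k) (β : DiffForm I₂ M₂ l) :
    cross (α - α') β = cross α β - cross α' β := by
  rw [sub_eq_add_smul, cross_add_left, cross_smul_left, ← sub_eq_add_smul]

lemma cross_sub_right (α : DiffForm I₁ M₁ k) (β β' : DiffForm I₂ M₂ l) :
    cross α (β - β') = cross α β - cross α β' := by
  rw [sub_eq_add_smul, cross_add_right, cross_smul_right, ← sub_eq_add_smul]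

lemma cross_apply_of_left (β : DiffForm I₂ M₂ l) {α : DiffForm I₁ M₁ k} {x : M₁ × M₂}
    (h : α x.1 = 0) : cross α β x = 0 := by
  rw [cross_eq, h]
  refine AlternatingMap.ext fun v => (vcross_apply _ _ _).trans ?_
  simp
  rfl

lemma cross_apply_of_right (α : DiffForm I₁ M₁ k) {β : DiffForm I₂ M₂ l} {x : M₁ × M₂}
    (h : β x.2 = 0) : cross α β x = 0 := by
  rw [cross_eq, h]
  refine AlternatingMap.ext fun v => (vcross_apply _ _ _).trans ?_
  simp
  rfl

lemma aestronglyMeasurable_inChart_cross {α : DiffForm I₁ M₁ k} {β : DiffForm I₂ M₂ l}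
    (hα : ∀ x₀ v, AEStronglyMeasurable (fun y => inChart x₀ α y v) (chartLebesgue I₁ x₀))
    (hβ : ∀ x₀ v, AEStronglyMeasurable (fun y => inChart x₀ β y v) (chartLebesgue I₂ x₀))
    (x₀ : M₁ × M₂) (v : Fin (k + l) → E₁ × E₂) :
    AEStronglyMeasurable (fun y => inChart x₀ (cross α β) y v)
      (chartLebesgue (I₁.prod I₂) x₀) := by
  have h : AEStronglyMeasurable (fun y : E₁ × E₂ =>
      vcross (inChart x₀.1 α y.1) (inChart x₀.2 β y.2) v) (chartLebesgue (I₁.prod I₂) x₀) := by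
    refine aestronglyMeasurable_chartLebesgue_prod ?_
    simp only [vcross_apply]
    exact Finset.aestronglyMeasurable_fun_sum _ fun σ _ =>
      ((hα _ _).comp_fst.mul (hβ _ _).comp_snd).const_mul _
  refine h.congr ?_
  filter_upwards [ae_chartLebesgue_mem (I := I₁.prod I₂) x₀] with y hy
  rw [inChart_cross α β hy]

lemma exists_eLpNormForm_cross (hg₁ : IsRiemMetric g₁) (hg₂ : IsRiemMetric g₂) (hp : 0 < p)
    (k l : ℕ) : ∃ C : ℝ, 0 < C ∧ ∀ (α : DiffForm I₁ M₁ k) (β : DiffForm I₂ M₂ l),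
      IsLpForm g₁ p α → IsLpForm g₂ p β →
      eLpNormForm (prodMetric g₁ g₂) p (cross α β) ≤
        ENNReal.ofReal C * (eLpNormForm g₁ p α * eLpNormForm g₂ p β) ∧
      eLpNormForm g₁ p α * eLpNormForm g₂ p β ≤
        ENNReal.ofReal C * eLpNormForm (prodMetric g₁ g₂) p (cross α β) := by
  have := hg₁.sFinite_riemVolume
  have := hg₂.sFinite_riemVolume
  obtain ⟨C, hC, h⟩ := exists_formNorm_vcross_le (Module.finrank ℝ E₁) (Module.finrank ℝ E₂) k l
  refine ⟨C + 1, by linarith, fun α β hα hβ => ?_⟩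
  have e1 : eLpNormForm g₁ p α * eLpNormForm g₂ p β =
      eLpNorm (fun x : M₁ × M₂ => formNorm (V := TangentSpace I₁ x.1) (g₁ x.1) (α x.1) *
        formNorm (V := TangentSpace I₂ x.2) (g₂ x.2) (β x.2)) (ENNReal.ofReal p)
        (riemVolume (prodMetric g₁ g₂)) := by
    rw [riemVolume_prod hg₁ hg₂]
    exact (eLpNorm_prod_mul (hg₁.memLp_formNorm hα).1 (hg₂.memLp_formNorm hβ).1
      (by simpa using hp) ENNReal.ofReal_ne_top).symm
  have e2 (x : M₁ × M₂) : formNorm (V := TangentSpace (I₁.prod I₂) x) (prodMetric g₁ g₂ x)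
      (cross α β x) = formNorm (V := TangentSpace I₁ x.1 × TangentSpace I₂ x.2)
        (fun v w => g₁ x.1 v.1 w.1 + g₂ x.2 v.2 w.2) (vcross (α x.1) (β x.2)) := by
    rw [prodMetric_eq, cross_eq]
    rfl
  have n1 (x : M₁ × M₂) := (hg₁.scalar x.1).formNorm_nonneg (α x.1)
  have n2 (x : M₁ × M₂) := (hg₂.scalar x.2).formNorm_nonneg (β x.2)
  have n3 (x : M₁ × M₂) : 0 ≤ formNorm (V := TangentSpace (I₁.prod I₂) x) (prodMetric g₁ g₂ x)
      (cross α β x) := ((hg₁.prod hg₂).scalar x).formNorm_nonneg (cross α β x)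
  have h' (x : M₁ × M₂) := h (V := TangentSpace I₁ x.1) (W := TangentSpace I₂ x.2)
    (g := g₁ x.1) (g' := g₂ x.2) (by rfl) (by rfl) (hg₁.scalar x.1) (hg₂.scalar x.2) (α x.1) (β x.2)
  rw [e1]
  refine ⟨eLpNorm_le_mul_eLpNorm_of_ae_le_mul (Eventually.of_forall fun x => ?_) _,
    eLpNorm_le_mul_eLpNorm_of_ae_le_mul (Eventually.of_forall fun x => ?_) _⟩
  · rw [Real.norm_eq_abs, Real.norm_eq_abs, abs_of_nonneg (mul_nonneg (n1 x) (n2 x)),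
      abs_of_nonneg (n3 x), e2]
    refine (h' x).1.trans ?_
    rw [add_mul, one_mul]
    exact le_add_of_nonneg_right (mul_nonneg (n1 x) (n2 x))
  · rw [Real.norm_eq_abs, Real.norm_eq_abs, abs_of_nonneg (mul_nonneg (n1 x) (n2 x)),
      abs_of_nonneg (n3 x), add_mul, one_mul]
    refine le_trans ?_ (le_add_of_nonneg_right (n3 x))
    rw [e2]
    exact (h' x).2

lemma IsLpForm.cross (hg₁ : IsRiemMetric g₁) (hg₂ : IsRiemMetric g₂) (hp : 0 < p)
    {α : DiffForm I₁ M₁ k} {β : DiffForm I₂ M₂ l} (hα : IsLpForm g₁ p α) (hβ : IsLpForm g₂ p β) :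
    IsLpForm (prodMetric g₁ g₂) p (cross α β) := by
  obtain ⟨C, -, h⟩ := exists_eLpNormForm_cross hg₁ hg₂ hp k l
  exact ⟨aestronglyMeasurable_inChart_cross hα.1 hβ.1, (h α β hα hβ).1.trans_lt
    (ENNReal.mul_lt_top ENNReal.ofReal_lt_top (ENNReal.mul_lt_top hα.2 hβ.2))⟩

lemma exists_lpNormForm_cross (hg₁ : IsRiemMetric g₁) (hg₂ : IsRiemMetric g₂) (hp : 0 < p)
    (k l : ℕ) : ∃ C : ℝ, 0 < C ∧ ∀ (α : DiffForm I₁ M₁ k) (β : DiffForm I₂ M₂ l),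
      IsLpForm g₁ p α → IsLpForm g₂ p β →
      lpNormForm (prodMetric g₁ g₂) p (cross α β) ≤
        C * (lpNormForm g₁ p α * lpNormForm g₂ p β) ∧
      lpNormForm g₁ p α * lpNormForm g₂ p β ≤
        C * lpNormForm (prodMetric g₁ g₂) p (cross α β) := by
  obtain ⟨C, hC, h⟩ := exists_eLpNormForm_cross hg₁ hg₂ hp k l
  refine ⟨C, hC, fun α β hα hβ => ?_⟩
  obtain ⟨h1, h2⟩ := h α β hα hβ
  have h3 := (hα.cross hg₁ hg₂ hp hβ).2
  have e1 := ENNReal.toReal_mono (ENNReal.mul_ne_top ENNReal.ofReal_ne_top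
    (ENNReal.mul_ne_top hα.2.ne hβ.2.ne)) h1
  have e2 := ENNReal.toReal_mono (ENNReal.mul_ne_top ENNReal.ofReal_ne_top h3.ne) h2
  rw [ENNReal.toReal_mul, ENNReal.toReal_mul, ENNReal.toReal_ofReal hC.le] at e1
  rw [ENNReal.toReal_mul, ENNReal.toReal_mul, ENNReal.toReal_ofReal hC.le] at e2
  exact ⟨e1, e2⟩

/-- The differential of a product of forms. -/
theorem exists_sign_isWeakExtDeriv_cross (hg₁ : IsRiemMetric g₁) (hg₂ : IsRiemMetric g₂)
    (hp : 1 ≤ p) (h : k + 1 + l = k + l + 1) :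
    ∃ ε : ℝ, |ε| = 1 ∧ ∀ (β₁ : DiffForm I₁ M₁ k) (θ₁ : DiffForm I₁ M₁ (k + 1))
      (β₂ : DiffForm I₂ M₂ l) (θ₂ : DiffForm I₂ M₂ (l + 1)), IsLpForm g₁ p β₁ → IsLpForm g₁ p θ₁ →
      IsLpForm g₂ p β₂ → IsLpForm g₂ p θ₂ → IsWeakExtDeriv β₁ θ₁ → IsWeakExtDeriv β₂ θ₂ →
      IsWeakExtDeriv (cross β₁ β₂)
        (castForm h (cross θ₁ β₂) +
          ε • (cross β₁ θ₂ : DiffForm (I₁.prod I₂) (M₁ × M₂) (k + (l + 1)))) := by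
  obtain ⟨ε, hε, hw⟩ := exists_sign_lwedge_vcross k l h
  refine ⟨ε, hε, fun β₁ θ₁ β₂ θ₂ hβ₁ hθ₁ hβ₂ hθ₂ h1 h2 => isWeakExtDeriv_iff.2 fun x₀ => ?_⟩
  obtain ⟨c, hc, h3, -⟩ := exists_addHaar_prod E₁ E₂
  have h4 := IsLocalWeakDeriv.vcross (hβ₁.isLocLp_one hg₁ hp x₀.1) (hθ₁.isLocLp_one hg₁ hp x₀.1)
    (hβ₂.isLocLp_one hg₂ hp x₀.2) (hθ₂.isLocLp_one hg₂ hp x₀.2)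
    (isWeakExtDeriv_iff.1 h1 x₀.1) (isWeakExtDeriv_iff.1 h2 x₀.2) h fun ℓ b c => hw ℓ b c
  rw [h3] at h4
  have h5 := h4.of_smul_measure (by simpa using hc) ENNReal.ofReal_ne_top
  rw [← extChartAt_prod_target] at h5
  refine h5.congr (fun y hy => (inChart_cross β₁ β₂ hy).symm) fun y hy => ?_
  ext v
  rw [inChart_add, inChart_smul, AlternatingMap.add_apply, AlternatingMap.smul_apply,
    AlternatingMap.add_apply, AlternatingMap.smul_apply, inChart_castForm,
    inChart_cross θ₁ β₂ hy, inChart_cross β₁ θ₂ hy]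
  rfl

lemma IsVolumeForm.apply_ne_zero (hg₁ : IsRiemMetric g₁)
    {vol₁ : DiffForm I₁ M₁ (Module.finrank ℝ E₁)} (h₁ : IsVolumeForm g₁ vol₁) (x : M₁) :
    vol₁ x (Module.finBasis ℝ E₁) ≠ 0 := by
  have h0 : vol₁ x ≠ 0 := fun h => by
    have h2 := h₁.1 x
    rw [h] at h2
    exact zero_ne_one ((hg₁.scalar x).formNorm_zero.symm.trans h2)
  exact (AlternatingMap.map_basis_ne_zero_iff (Module.finBasis ℝ E₁) (vol₁ x)).2 h0

lemma topRatio_cross (hg₁ : IsRiemMetric g₁) (hg₂ : IsRiemMetric g₂)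
    {vol₁ : DiffForm I₁ M₁ (Module.finrank ℝ E₁)} {vol₂ : DiffForm I₂ M₂ (Module.finrank ℝ E₂)}
    (h₁ : IsVolumeForm g₁ vol₁) (h₂ : IsVolumeForm g₂ vol₂)
    (τ₁ : DiffForm I₁ M₁ (Module.finrank ℝ E₁)) (τ₂ : DiffForm I₂ M₂ (Module.finrank ℝ E₂))
    (x : M₁ × M₂) :
    topRatio (prodVolumeForm vol₁ vol₂) (castForm Module.finrank_prod.symm (cross τ₁ τ₂)) x =
      topRatio vol₁ τ₁ x.1 * topRatio vol₂ τ₂ x.2 := by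
  let w : Fin (Module.finrank ℝ E₁ + Module.finrank ℝ E₂) → E₁ × E₂ :=
    Fin.append (fun i => (Module.finBasis ℝ E₁ i, 0)) fun j => (0, Module.finBasis ℝ E₂ j)
  have key (α : DiffForm I₁ M₁ (Module.finrank ℝ E₁)) (β : DiffForm I₂ M₂ (Module.finrank ℝ E₂)) :
      castForm (Module.finrank_prod (R := ℝ) (M := E₁) (M' := E₂)).symm (cross α β) x
        (fun i => w (Fin.cast Module.finrank_prod i)) =
      α x.1 (Module.finBasis ℝ E₁) * β x.2 (Module.finBasis ℝ E₂) := by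
    have h3 : cross α β x w = α x.1 (Module.finBasis ℝ E₁) * β x.2 (Module.finBasis ℝ E₂) := by
      refine (DFunLike.congr_fun (cross_eq α β x) w).trans ?_
      exact vcross_append (α x.1) (β x.2) _ _
    exact h3
  have hv : prodVolumeForm vol₁ vol₂ x (fun i => w (Fin.cast Module.finrank_prod i)) =
      vol₁ x.1 (Module.finBasis ℝ E₁) * vol₂ x.2 (Module.finBasis ℝ E₂) := key vol₁ vol₂
  rw [topRatio_eq (w := fun i => w (Fin.cast Module.finrank_prod i)), key, hv,
    mul_div_mul_comm]
  · rfl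
  · rw [hv]
    exact mul_ne_zero (h₁.apply_ne_zero hg₁ _) (h₂.apply_ne_zero hg₂ _)

/-- The integral of a product of products of forms. -/
theorem exists_sign_integralForm_cross (hg₁ : IsRiemMetric g₁) (hg₂ : IsRiemMetric g₂)
    {vol₁ : DiffForm I₁ M₁ (Module.finrank ℝ E₁)} {vol₂ : DiffForm I₂ M₂ (Module.finrank ℝ E₂)}
    (hv₁ : IsVolumeForm g₁ vol₁) (hv₂ : IsVolumeForm g₂ vol₂)
    (h₁ : k₁ + l₁ = Module.finrank ℝ E₁) (h₂ : k₂ + l₂ = Module.finrank ℝ E₂)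
    (h : k₁ + k₂ + (l₁ + l₂) = Module.finrank ℝ (E₁ × E₂)) :
    ∃ ε : ℝ, |ε| = 1 ∧ ∀ (α₁ : DiffForm I₁ M₁ k₁) (α₂ : DiffForm I₂ M₂ k₂)
      (β₁ : DiffForm I₁ M₁ l₁) (β₂ : DiffForm I₂ M₂ l₂),
      integralForm (prodMetric g₁ g₂) (prodVolumeForm vol₁ vol₂)
          (castForm h (wedgeForm (cross α₁ α₂) (cross β₁ β₂))) =
        ε * (integralForm g₁ vol₁ (castForm h₁ (wedgeForm α₁ β₁)) *
          integralForm g₂ vol₂ (castForm h₂ (wedgeForm α₂ β₂))) := by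
  have := hg₁.sFinite_riemVolume
  have := hg₂.sFinite_riemVolume
  have h0 : k₁ + k₂ + (l₁ + l₂) = k₁ + l₁ + (k₂ + l₂) := by omega
  obtain ⟨ε, hε, hw⟩ := exists_sign_wedge_vcross k₁ k₂ l₁ l₂ h0
  refine ⟨ε, hε, fun α₁ α₂ β₁ β₂ => ?_⟩
  have hε2 : ε * ε = 1 := by rw [← sq, ← sq_abs, hε, one_pow]
  have h3 (x : M₁ × M₂) : castForm Module.finrank_prod.symm (cross (castForm h₁ (wedgeForm α₁ β₁))
      (castForm h₂ (wedgeForm α₂ β₂))) x =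
      ε • castForm h (wedgeForm (cross α₁ α₂) (cross β₁ β₂)) x := by
    have h4 : cross (castForm h₁ (wedgeForm α₁ β₁)) (castForm h₂ (wedgeForm α₂ β₂)) x =
        castDeg (by omega) (vcross (wedge (α₁ x.1) (β₁ x.1)) (wedge (α₂ x.2) (β₂ x.2))) :=
      (cross_eq _ _ x).trans (vcross_castDeg h₁ h₂ (by omega) _ _)
    have h5 : wedgeForm (cross α₁ α₂) (cross β₁ β₂) x =
        wedge (vcross (α₁ x.1) (α₂ x.2)) (vcross (β₁ x.1) (β₂ x.2)) := by
      rw [wedgeForm, cross_eq, cross_eq]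
      rfl
    show castDeg _ (cross (castForm h₁ (wedgeForm α₁ β₁)) (castForm h₂ (wedgeForm α₂ β₂)) x) =
      ε • castDeg h (wedgeForm (cross α₁ α₂) (cross β₁ β₂) x)
    rw [h4, h5, hw]
    rfl
  have h6 (x : M₁ × M₂) : topRatio (prodVolumeForm vol₁ vol₂)
      (castForm h (wedgeForm (cross α₁ α₂) (cross β₁ β₂))) x =
      ε * (topRatio vol₁ (castForm h₁ (wedgeForm α₁ β₁)) x.1 *
        topRatio vol₂ (castForm h₂ (wedgeForm α₂ β₂)) x.2) := by
    rw [← topRatio_cross hg₁ hg₂ hv₁ hv₂]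
    have key (a b d : ℝ) (h : b = ε * a) : a / d = ε * (b / d) := by
      rw [h, mul_div_assoc, ← mul_assoc, hε2, one_mul]
    exact key _ _ _ (DFunLike.congr_fun (h3 x) _)
  have h7 : integralForm (prodMetric g₁ g₂) (prodVolumeForm vol₁ vol₂)
      (castForm h (wedgeForm (cross α₁ α₂) (cross β₁ β₂))) =
      ∫ x, topRatio (prodVolumeForm vol₁ vol₂)
        (castForm h (wedgeForm (cross α₁ α₂) (cross β₁ β₂))) x ∂(riemVolume (prodMetric g₁ g₂)) := rfl
  rw [h7]
  simp only [h6]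
  rw [riemVolume_prod hg₁ hg₂, integral_const_mul, integral_prod_mul]
  rfl

end CrossProduct

section Cohomology

variable {E : Type*} [NormedAddCommGroup E] [NormedSpace ℝ E] [FiniteDimensional ℝ E]
  [MeasurableSpace E] [BorelSpace E]
  {H : Type*} [TopologicalSpace H] {I : ModelWithCorners ℝ E H} [I.Boundaryless]
  {M : Type*} [TopologicalSpace M] [ChartedSpace H M] [IsManifold I ∞ M]
  [T2Space M] [MeasurableSpace M] [BorelSpace M] [SecondCountableTopology M] {g : MetricField I M}
  {p : ℝ} {k l : ℕ}

omit [I.Boundaryless] [IsManifold I ∞ M] [T2Space M] [BorelSpace M]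
  [SecondCountableTopology M] in
lemma lpNormForm_nonneg {θ : DiffForm I M k} : 0 ≤ lpNormForm g p θ := ENNReal.toReal_nonneg

lemma IsExactLp.isLpForm : ∀ {k : ℕ} {θ : DiffForm I M k}, IsExactLp g p θ → IsLpForm g p θ
  | 0, _, h => h.1
  | _ + 1, _, h => h.1

lemma isExactLp_of_isWeakExtDeriv {m : ℕ} (h : k + 1 = m) {φ : DiffForm I M k}
    {θ : DiffForm I M m} (hθ : IsLpForm g p θ) (hφ : IsLpForm g p φ)
    (hd : IsWeakExtDeriv φ (castForm h.symm θ)) : IsExactLp g p θ := by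
  subst h
  exact ⟨hθ, φ, hφ, hd⟩

lemma isExactLp_of_ae (hg : IsRiemMetric g) : ∀ {k : ℕ} {θ : DiffForm I M k}, IsLpForm g p θ →
    (∀ᵐ x ∂(riemVolume g), θ x = 0) → IsExactLp g p θ
  | 0, _, hθ, h => ⟨hθ, h⟩
  | _ + 1, _, hθ, h => ⟨hθ, 0, isLpForm_zero hg, isWeakExtDeriv_zero_of_ae hg h⟩

lemma isExactLp_zero (hg : IsRiemMetric g) : IsExactLp g p (0 : DiffForm I M k) :=
  isExactLp_of_ae hg (isLpForm_zero hg) (Eventually.of_forall fun _ => rfl)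

lemma IsExactLp.smul (hg : IsRiemMetric g) (c : ℝ) : ∀ {k : ℕ} {θ : DiffForm I M k},
    IsExactLp g p θ → IsExactLp g p (c • θ)
  | 0, θ, h => ⟨h.1.smul hg c, by
      filter_upwards [h.2] with x hx
      show c • θ x = 0
      rw [hx, smul_zero]⟩
  | _ + 1, _, ⟨h1, φ, h2, h3⟩ => ⟨h1.smul hg c, c • φ, h2.smul hg c, h3.smul c⟩

lemma IsExactLp.add (hg : IsRiemMetric g) (hp : 1 ≤ p) : ∀ {k : ℕ} {θ θ' : DiffForm I M k},
    IsExactLp g p θ → IsExactLp g p θ' → IsExactLp g p (θ + θ')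
  | 0, θ, θ', h, h' => ⟨h.1.add hg hp h'.1, by
      filter_upwards [h.2, h'.2] with x hx hx'
      show θ x + θ' x = 0
      rw [hx, hx', add_zero]⟩
  | _ + 1, _, _, ⟨h1, φ, h2, h3⟩, ⟨h1', φ', h2', h3'⟩ =>
    ⟨h1.add hg hp h1', φ + φ', h2.add hg hp h2', h3.add hg hp h2 h2' h1 h1' h3'⟩

lemma IsExactLp.sub (hg : IsRiemMetric g) (hp : 1 ≤ p) {θ θ' : DiffForm I M k}
    (h : IsExactLp g p θ) (h' : IsExactLp g p θ') : IsExactLp g p (θ - θ') := by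
  rw [sub_eq_add_smul]; exact h.add hg hp (h'.smul hg _)

lemma mem_lpClass_self (hg : IsRiemMetric g) {θ : DiffForm I M k} (hθ : IsClosedLp g p θ) :
    θ ∈ lpClass g p θ := ⟨hθ, by rw [sub_self]; exact isExactLp_zero hg⟩

/-- Two elements of a cohomology class differ by an exact form. -/
lemma isExactLp_sub_of_mem (hg : IsRiemMetric g) (hp : 1 ≤ p) {c : Set (DiffForm I M k)}
    (hc : c ∈ lpCohomology g p k) {θ θ' : DiffForm I M k} (h : θ ∈ c) (h' : θ' ∈ c) :
    IsExactLp g p (θ - θ') := by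
  obtain ⟨ϑ, -, rfl⟩ := hc
  have := h.2.sub hg hp h'.2
  rwa [sub_sub_sub_cancel_right] at this

lemma isClosedLp_of_mem {c : Set (DiffForm I M k)} (hc : c ∈ lpCohomology g p k)
    {θ : DiffForm I M k} (h : θ ∈ c) : IsClosedLp g p θ := by
  obtain ⟨ϑ, -, rfl⟩ := hc
  exact h.1

end Cohomology

lemma isBigO_pow_mul_exp {a b : ℝ} (h : b < a) (N : ℕ) :
    (fun j : ℕ => (j : ℝ) ^ N * Real.exp (-a * j)) =O[atTop] fun j : ℕ => Real.exp (-b * j) := by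
  have h1 := ((isLittleO_pow_exp_pos_mul_atTop (k := N) (sub_pos.2 h)).isBigO.comp_tendsto
    tendsto_natCast_atTop_atTop).mul
    (Asymptotics.isBigO_refl (fun j : ℕ => Real.exp (-a * j)) atTop)
  refine h1.congr_right fun j => ?_
  simp only [Function.comp_apply]
  rw [← Real.exp_add]
  ring_nf

section ProductClasses

variable {E₁ : Type*} [NormedAddCommGroup E₁] [NormedSpace ℝ E₁] [FiniteDimensional ℝ E₁]
  [MeasurableSpace E₁] [BorelSpace E₁]
  {H₁ : Type*} [TopologicalSpace H₁] {I₁ : ModelWithCorners ℝ E₁ H₁} [I₁.Boundaryless]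
  {M₁ : Type*} [TopologicalSpace M₁] [ChartedSpace H₁ M₁] [IsManifold I₁ ∞ M₁]
  {E₂ : Type*} [NormedAddCommGroup E₂] [NormedSpace ℝ E₂] [FiniteDimensional ℝ E₂]
  [MeasurableSpace E₂] [BorelSpace E₂]
  {H₂ : Type*} [TopologicalSpace H₂] {I₂ : ModelWithCorners ℝ E₂ H₂} [I₂.Boundaryless]
  {M₂ : Type*} [TopologicalSpace M₂] [ChartedSpace H₂ M₂] [IsManifold I₂ ∞ M₂]
  {g₁ : MetricField I₁ M₁} {g₂ : MetricField I₂ M₂}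
  [T2Space M₁] [MeasurableSpace M₁] [BorelSpace M₁] [SecondCountableTopology M₁]
  [T2Space M₂] [MeasurableSpace M₂] [BorelSpace M₂] [SecondCountableTopology M₂]
  {p : ℝ} {k l k₁ k₂ : ℕ}

lemma cross_zero_left (β : DiffForm I₂ M₂ l) :
    cross (0 : DiffForm I₁ M₁ k) β = 0 :=
  funext fun _ => cross_apply_of_left β rfl

lemma cross_zero_right (α : DiffForm I₁ M₁ k) :
    cross α (0 : DiffForm I₂ M₂ l) = 0 :=
  funext fun _ => cross_apply_of_right α rfl

lemma IsClosedLp.cross (hg₁ : IsRiemMetric g₁) (hg₂ : IsRiemMetric g₂) (hp : 1 ≤ p)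
    {θ₁ : DiffForm I₁ M₁ k₁} {θ₂ : DiffForm I₂ M₂ k₂} (h₁ : IsClosedLp g₁ p θ₁)
    (h₂ : IsClosedLp g₂ p θ₂) : IsClosedLp (prodMetric g₁ g₂) p (cross θ₁ θ₂) := by
  refine ⟨h₁.1.cross hg₁ hg₂ (by linarith) h₂.1, ?_⟩
  have h0 : k₁ + 1 + k₂ = k₁ + k₂ + 1 := by omega
  obtain ⟨ε, -, hd⟩ := exists_sign_isWeakExtDeriv_cross hg₁ hg₂ hp h0
  have h := hd θ₁ 0 θ₂ 0 h₁.1 (isLpForm_zero hg₁) h₂.1 (isLpForm_zero hg₂) h₁.2 h₂.2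
  rw [cross_zero_left, cross_zero_right, smul_zero, add_zero] at h
  exact h

lemma IsExactLp.cross_left (hg₁ : IsRiemMetric g₁) (hg₂ : IsRiemMetric g₂) (hp : 1 ≤ p)
    {θ₁ : DiffForm I₁ M₁ k₁} {θ₂ : DiffForm I₂ M₂ k₂} (h₁ : IsExactLp g₁ p θ₁)
    (h₂ : IsClosedLp g₂ p θ₂) : IsExactLp (prodMetric g₁ g₂) p (cross θ₁ θ₂) := by
  have := hg₁.sFinite_riemVolume
  have := hg₂.sFinite_riemVolume
  have hc := h₁.isLpForm.cross hg₁ hg₂ (by linarith) h₂.1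
  cases k₁ with
  | zero =>
    refine isExactLp_of_ae (hg₁.prod hg₂) hc ?_
    rw [riemVolume_prod hg₁ hg₂]
    filter_upwards [Measure.quasiMeasurePreserving_fst.ae h₁.2] with x hx
    exact cross_apply_of_left θ₂ hx
  | succ m =>
    obtain ⟨hL, φ, hφ, hd⟩ := h₁
    have h0 : m + 1 + k₂ = m + k₂ + 1 := by omega
    obtain ⟨ε, -, hw⟩ := exists_sign_isWeakExtDeriv_cross hg₁ hg₂ hp h0
    have h := hw φ θ₁ θ₂ 0 hφ hL h₂.1 (isLpForm_zero hg₂) hd h₂.2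
    rw [cross_zero_right, smul_zero, add_zero] at h
    exact isExactLp_of_isWeakExtDeriv h0.symm hc (hφ.cross hg₁ hg₂ (by linarith) h₂.1) h

lemma IsExactLp.cross_right (hg₁ : IsRiemMetric g₁) (hg₂ : IsRiemMetric g₂) (hp : 1 ≤ p)
    {θ₁ : DiffForm I₁ M₁ k₁} {θ₂ : DiffForm I₂ M₂ k₂} (h₁ : IsClosedLp g₁ p θ₁)
    (h₂ : IsExactLp g₂ p θ₂) : IsExactLp (prodMetric g₁ g₂) p (cross θ₁ θ₂) := by
  have := hg₁.sFinite_riemVolume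
  have := hg₂.sFinite_riemVolume
  have hc := h₁.1.cross hg₁ hg₂ (by linarith) h₂.isLpForm
  cases k₂ with
  | zero =>
    refine isExactLp_of_ae (hg₁.prod hg₂) hc ?_
    rw [riemVolume_prod hg₁ hg₂]
    filter_upwards [Measure.quasiMeasurePreserving_snd.ae h₂.2] with x hx
    exact cross_apply_of_right θ₁ hx
  | succ m =>
    obtain ⟨hL, φ, hφ, hd⟩ := h₂
    have h0 : k₁ + 1 + m = k₁ + m + 1 := by omega
    obtain ⟨ε, hε, hw⟩ := exists_sign_isWeakExtDeriv_cross hg₁ hg₂ hp h0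
    have h := hw θ₁ 0 φ θ₂ h₁.1 (isLpForm_zero hg₁) hφ hL h₁.2 hd
    have hz : castForm h0 (cross (0 : DiffForm I₁ M₁ (k₁ + 1)) φ) = 0 := by
      rw [cross_zero_left]; rfl
    rw [hz, zero_add] at h
    have hε2 : ε * ε = 1 := by rw [← sq, ← sq_abs, hε, one_pow]
    have h' := h.smul ε
    rw [smul_smul, hε2, one_smul] at h'
    exact ⟨hc, ε • cross θ₁ φ, (h₁.1.cross hg₁ hg₂ (by linarith) hφ).smul (hg₁.prod hg₂) ε, h'⟩

/-- The product of two forms with the robustness property has the robustness property. -/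
theorem IsRobustForm.cross (hg₁ : IsRiemMetric g₁) (hg₂ : IsRiemMetric g₂)
    {vol₁ : DiffForm I₁ M₁ (Module.finrank ℝ E₁)} {vol₂ : DiffForm I₂ M₂ (Module.finrank ℝ E₂)}
    (hv₁ : IsVolumeForm g₁ vol₁) (hv₂ : IsVolumeForm g₂ vol₂) (hp : 1 < p)
    {θ₁ : DiffForm I₁ M₁ k₁} {θ₂ : DiffForm I₂ M₂ k₂} (h₁ : IsRobustForm g₁ vol₁ p θ₁)
    (h₂ : IsRobustForm g₂ vol₂ p θ₂) :
    IsRobustForm (prodMetric g₁ g₂) (prodVolumeForm vol₁ vol₂) p (cross θ₁ θ₂) := by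
  obtain ⟨l₁, hl₁, θ₁', η₁, f₁, ⟨δ₁, hδ₁, i₁⟩, ⟨t₁, N₁, o₁⟩, a₁, ha₁, e₁⟩ := h₁
  obtain ⟨l₂, hl₂, θ₂', η₂, f₂, ⟨δ₂, hδ₂, i₂⟩, ⟨t₂, N₂, o₂⟩, a₂, ha₂, e₂⟩ := h₂
  have hg := hg₁.prod hg₂
  set q := p / (p - 1)
  have hq : 1 < q := (Real.HolderConjugate.conjExponent hp).symm.lt
  have hq0 : 0 < q := by linarith
  have h0 : l₁ + 1 + l₂ = l₁ + l₂ + 1 := by omega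
  have hl : k₁ + k₂ + (l₁ + l₂) = Module.finrank ℝ (E₁ × E₂) := by
    rw [Module.finrank_prod]; omega
  obtain ⟨ε, hε, hd⟩ := exists_sign_isWeakExtDeriv_cross hg₁ hg₂ hq.le h0
  obtain ⟨ε', hε', hi⟩ := exists_sign_integralForm_cross hg₁ hg₂ hv₁ hv₂ hl₁ hl₂ hl
  obtain ⟨C, hC, hCn⟩ := exists_lpNormForm_cross hg₁ hg₂ hq0 l₁ l₂
  obtain ⟨C', hC', hCn'⟩ := exists_lpNormForm_cross hg₁ hg₂ hq0 (l₁ + 1) l₂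
  obtain ⟨C'', hC'', hCn''⟩ := exists_lpNormForm_cross hg₁ hg₂ hq0 l₁ (l₂ + 1)
  refine ⟨l₁ + l₂, hl, fun j => LpForms.cross (θ₁' j) (θ₂' j), fun j =>
    castForm h0 (LpForms.cross (η₁ j) (θ₂' j)) + ε • (LpForms.cross (θ₁' j) (η₂ j) :
      DiffForm (I₁.prod I₂) (M₁ × M₂) (l₁ + (l₂ + 1))), fun j => ?_, ?_, ⟨?_, ?_⟩, ?_⟩
  · exact ⟨(f₁ j).1.cross hg₁ hg₂ hq0 (f₂ j).1,
      (((f₁ j).2.1.cross hg₁ hg₂ hq0 (f₂ j).1).castForm h0).add hg hq.le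
        (((f₁ j).1.cross hg₁ hg₂ hq0 (f₂ j).2.1).smul hg ε),
      hd _ _ _ _ (f₁ j).1 (f₁ j).2.1 (f₂ j).1 (f₂ j).2.1 (f₁ j).2.2 (f₂ j).2.2⟩
  · refine ⟨δ₁ * δ₂, mul_pos hδ₁ hδ₂, ?_⟩
    filter_upwards [i₁, i₂] with j hj₁ hj₂
    refine le_of_le_of_eq ?_ (congrArg abs (hi θ₁ θ₂ (θ₁' j) (θ₂' j))).symm
    rw [abs_mul, hε', one_mul, abs_mul]
    exact mul_le_mul hj₁ hj₂ hδ₂.le (abs_nonneg _)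
  · have h3 := (t₁.atTop_mul_atTop₀ t₂).atTop_div_const hC
    refine tendsto_atTop_mono (fun j => ?_) h3
    rw [div_le_iff₀' hC]
    exact (hCn _ _ (f₁ j).1 (f₂ j).1).2
  · refine ⟨N₁ + N₂, ?_⟩
    have h3 := o₁.mul o₂
    simp only [← pow_add] at h3
    refine (Asymptotics.IsBigO.of_bound C (Eventually.of_forall fun j => ?_)).trans h3
    rw [Real.norm_of_nonneg lpNormForm_nonneg, Real.norm_of_nonneg
      (mul_nonneg lpNormForm_nonneg lpNormForm_nonneg)]
    exact (hCn _ _ (f₁ j).1 (f₂ j).1).1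
  · have hm : 0 < min a₁ a₂ := lt_min ha₁ ha₂
    refine ⟨min a₁ a₂ / 2, by linarith, ?_⟩
    have b₁ : min a₁ a₂ / 2 < a₁ := (by linarith : min a₁ a₂ / 2 < min a₁ a₂).trans_le (min_le_left _ _)
    have b₂ : min a₁ a₂ / 2 < a₂ := (by linarith : min a₁ a₂ / 2 < min a₁ a₂).trans_le (min_le_right _ _)
    have h3 := ((o₂.mul e₁).trans (isBigO_pow_mul_exp b₁ N₂)).const_mul_left C'
    have h4 := ((o₁.mul e₂).trans (isBigO_pow_mul_exp b₂ N₁)).const_mul_left C''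
    refine (Asymptotics.IsBigO.of_bound 1 (Eventually.of_forall fun j => ?_)).trans (h3.add h4)
    rw [one_mul, Real.norm_of_nonneg lpNormForm_nonneg]
    refine le_trans ?_ (le_abs_self _)
    refine (lpNormForm_add_le hg hq.le (((f₁ j).2.1.cross hg₁ hg₂ hq0 (f₂ j).1).castForm h0)
        (((f₁ j).1.cross hg₁ hg₂ hq0 (f₂ j).2.1).smul hg ε)).trans (add_le_add ?_ ?_)
    · rw [lpNormForm, eLpNormForm_castForm, mul_comm (lpNormForm g₂ q (θ₂' j))]
      exact (hCn' _ _ (f₁ j).2.1 (f₂ j).1).1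
    · rw [lpNormForm_smul hg, hε, one_mul]
      exact (hCn'' _ _ (f₁ j).1 (f₂ j).2.1).1

/-- The products of the elements of two cohomology classes lie in one cohomology class. -/
lemma cross_mem_lpClass (hg₁ : IsRiemMetric g₁) (hg₂ : IsRiemMetric g₂) (hp : 1 ≤ p)
    {c₁ : Set (DiffForm I₁ M₁ k₁)} {c₂ : Set (DiffForm I₂ M₂ k₂)}
    (h₁ : c₁ ∈ lpCohomology g₁ p k₁) (h₂ : c₂ ∈ lpCohomology g₂ p k₂)
    {θ₁ α₁ : DiffForm I₁ M₁ k₁} {θ₂ α₂ : DiffForm I₂ M₂ k₂} (hθ₁ : θ₁ ∈ c₁) (hα₁ : α₁ ∈ c₁)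
    (hθ₂ : θ₂ ∈ c₂) (hα₂ : α₂ ∈ c₂) :
    cross α₁ α₂ ∈ lpClass (prodMetric g₁ g₂) p (cross θ₁ θ₂) := by
  refine ⟨(isClosedLp_of_mem h₁ hα₁).cross hg₁ hg₂ hp (isClosedLp_of_mem h₂ hα₂), ?_⟩
  have e : cross α₁ α₂ - cross θ₁ θ₂ = cross (α₁ - θ₁) α₂ + cross θ₁ (α₂ - θ₂) := by
    rw [cross_sub_left, cross_sub_right, sub_add_sub_cancel]
  rw [e]
  exact ((isExactLp_sub_of_mem hg₁ hp h₁ hα₁ hθ₁).cross_left hg₁ hg₂ hp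
    (isClosedLp_of_mem h₂ hα₂)).add (hg₁.prod hg₂) hp
    (IsExactLp.cross_right hg₁ hg₂ hp (isClosedLp_of_mem h₁ hθ₁)
      (isExactLp_sub_of_mem hg₂ hp h₂ hα₂ hθ₂))

/-- The product of a torsion class and a cohomology class is a torsion class. -/
lemma lpClass_cross_mem_lpTorsion (hg₁ : IsRiemMetric g₁) (hg₂ : IsRiemMetric g₂) (hp : 1 ≤ p)
    {c₁ : Set (DiffForm I₁ M₁ k₁)} (h₁ : c₁ ∈ lpTorsion g₁ p k₁) {θ₁ : DiffForm I₁ M₁ k₁}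
    {θ₂ : DiffForm I₂ M₂ k₂} (hθ₁ : θ₁ ∈ c₁) (hθ₂ : IsClosedLp g₂ p θ₂) :
    lpClass (prodMetric g₁ g₂) p (cross θ₁ θ₂) ∈ lpTorsion (prodMetric g₁ g₂) p (k₁ + k₂) := by
  have hc₁ := isClosedLp_of_mem h₁.1 hθ₁
  refine ⟨⟨_, hc₁.cross hg₁ hg₂ hp hθ₂, rfl⟩, fun θ hθ ε hε => ?_⟩
  obtain ⟨C, hC, hCn⟩ := exists_eLpNormForm_cross hg₁ hg₂ (by linarith : 0 < p) k₁ k₂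
  set D := ENNReal.ofReal C * eLpNormForm g₂ p θ₂
  have hD : D + 1 ≠ ⊤ := ENNReal.add_ne_top.2
    ⟨ENNReal.mul_ne_top ENNReal.ofReal_ne_top hθ₂.1.2.ne, ENNReal.one_ne_top⟩
  obtain ⟨β, hβ, hβε⟩ := h₁.2 θ₁ hθ₁ (ε / (D + 1)) (ENNReal.div_pos hε.ne' hD)
  refine ⟨cross β θ₂ + (θ - cross θ₁ θ₂),
    (hβ.cross_left hg₁ hg₂ hp hθ₂).add (hg₁.prod hg₂) hp hθ.2, ?_⟩
  have e : θ - (cross β θ₂ + (θ - cross θ₁ θ₂)) = cross (θ₁ - β) θ₂ := by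
    rw [cross_sub_left]; abel
  rw [e]
  refine (hCn _ _ (hc₁.1.sub hg₁ hp hβ.isLpForm) hθ₂.1).1.trans ?_
  calc ENNReal.ofReal C * (eLpNormForm g₁ p (θ₁ - β) * eLpNormForm g₂ p θ₂)
      = eLpNormForm g₁ p (θ₁ - β) * D := by ring
    _ ≤ ε / (D + 1) * (D + 1) := mul_le_mul' hβε le_self_add
    _ ≤ ε := ENNReal.mul_le_of_le_div le_rfl

end ProductClasses

end LpForms

end

theorem mainTheorem10
    {E₁ : Type*} [NormedAddCommGroup E₁] [NormedSpace ℝ E₁] [FiniteDimensional ℝ E₁]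
    [MeasurableSpace E₁] [BorelSpace E₁]
    {H₁ : Type*} [TopologicalSpace H₁] (I₁ : ModelWithCorners ℝ E₁ H₁) [I₁.Boundaryless]
    (M₁ : Type*) [EMetricSpace M₁] [SecondCountableTopology M₁]
    [MeasurableSpace M₁] [BorelSpace M₁] [ChartedSpace H₁ M₁] [IsManifold I₁ ∞ M₁]
    [RiemannianBundle (fun x : M₁ => TangentSpace I₁ x)]
    [IsContMDiffRiemannianBundle I₁ ∞ E₁ (fun x : M₁ => TangentSpace I₁ x)]
    [IsRiemannianManifold I₁ M₁] [CompleteSpace M₁]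
    {E₂ : Type*} [NormedAddCommGroup E₂] [NormedSpace ℝ E₂] [FiniteDimensional ℝ E₂]
    [MeasurableSpace E₂] [BorelSpace E₂]
    {H₂ : Type*} [TopologicalSpace H₂] (I₂ : ModelWithCorners ℝ E₂ H₂) [I₂.Boundaryless]
    (M₂ : Type*) [EMetricSpace M₂] [SecondCountableTopology M₂]
    [MeasurableSpace M₂] [BorelSpace M₂] [ChartedSpace H₂ M₂] [IsManifold I₂ ∞ M₂]
    [RiemannianBundle (fun x : M₂ => TangentSpace I₂ x)]
    [IsContMDiffRiemannianBundle I₂ ∞ E₂ (fun x : M₂ => TangentSpace I₂ x)]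
    [IsRiemannianManifold I₂ M₂] [CompleteSpace M₂]
    (vol₁ : LpForms.DiffForm I₁ M₁ (Module.finrank ℝ E₁))
    (hvol₁ : LpForms.IsVolumeForm (LpForms.metricOf I₁ M₁) vol₁)
    (vol₂ : LpForms.DiffForm I₂ M₂ (Module.finrank ℝ E₂))
    (hvol₂ : LpForms.IsVolumeForm (LpForms.metricOf I₂ M₂) vol₂)
    (p : ℝ) (hp : 1 < p) (k₁ k₂ : ℕ)
    (c₁ : Set (LpForms.DiffForm I₁ M₁ k₁))
    (hc₁ : c₁ ∈ LpForms.robustTorsion (LpForms.metricOf I₁ M₁) vol₁ p k₁)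
    (c₂ : Set (LpForms.DiffForm I₂ M₂ k₂))
    (hc₂ : c₂ ∈ LpForms.robustTorsion (LpForms.metricOf I₂ M₂) vol₂ p k₂) :
    ∃ c : Set (LpForms.DiffForm (I₁.prod I₂) (M₁ × M₂) (k₁ + k₂)),
      c ∈ LpForms.lpCohomology
        (LpForms.prodMetric (LpForms.metricOf I₁ M₁) (LpForms.metricOf I₂ M₂)) p (k₁ + k₂) ∧
      (∀ θ₁ ∈ c₁, ∀ θ₂ ∈ c₂, LpForms.cross θ₁ θ₂ ∈ c) ∧
      c ∈ LpForms.robustClasses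
        (LpForms.prodMetric (LpForms.metricOf I₁ M₁) (LpForms.metricOf I₂ M₂))
        (LpForms.prodVolumeForm vol₁ vol₂) p (k₁ + k₂) ∧
      c ≠ LpForms.lpClass
        (LpForms.prodMetric (LpForms.metricOf I₁ M₁) (LpForms.metricOf I₂ M₂)) p 0 ∧
      (k₁ = Module.finrank ℝ E₁ ∨ k₂ = Module.finrank ℝ E₂ →
        c ∈ LpForms.robustTorsion
          (LpForms.prodMetric (LpForms.metricOf I₁ M₁) (LpForms.metricOf I₂ M₂))
          (LpForms.prodVolumeForm vol₁ vol₂) p (k₁ + k₂)) := by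
  have hg₁ : LpForms.IsRiemMetric (LpForms.metricOf I₁ M₁) := LpForms.isRiemMetric_metricOf
  have hg₂ : LpForms.IsRiemMetric (LpForms.metricOf I₂ M₂) := LpForms.isRiemMetric_metricOf
  have hg := hg₁.prod hg₂
  have hcut := (LpForms.hasCutoffs_metricOf I₁ M₁).prod hg₁ hg₂ (LpForms.hasCutoffs_metricOf I₂ M₂)
  have hvol := hvol₁.prod hg₁ hg₂ hvol₂
  obtain ⟨⟨hH₁, θ₁, hθ₁, hr₁⟩, ht₁⟩ := hc₁
  obtain ⟨⟨hH₂, θ₂, hθ₂, hr₂⟩, -⟩ := hc₂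
  have hcl := (LpForms.isClosedLp_of_mem hH₁ hθ₁).cross hg₁ hg₂ hp.le
    (LpForms.isClosedLp_of_mem hH₂ hθ₂)
  have hrob := hr₁.cross hg₁ hg₂ hvol₁ hvol₂ hp hr₂
  have hmem := LpForms.mem_lpClass_self hg hcl
  have hrc : LpForms.lpClass (LpForms.prodMetric (LpForms.metricOf I₁ M₁) (LpForms.metricOf I₂ M₂)) p
      (LpForms.cross θ₁ θ₂) ∈ LpForms.robustClasses
        (LpForms.prodMetric (LpForms.metricOf I₁ M₁) (LpForms.metricOf I₂ M₂))
        (LpForms.prodVolumeForm vol₁ vol₂) p (k₁ + k₂) := ⟨⟨_, hcl, rfl⟩, _, hmem, hrob⟩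
  refine ⟨_, ⟨_, hcl, rfl⟩, fun α₁ hα₁ α₂ hα₂ =>
    LpForms.cross_mem_lpClass hg₁ hg₂ hp.le hH₁ hH₂ hθ₁ hα₁ hθ₂ hα₂, hrc, fun h0 => ?_,
    fun _ => ⟨hrc, LpForms.lpClass_cross_mem_lpTorsion hg₁ hg₂ hp.le ht₁ hθ₁
      (LpForms.isClosedLp_of_mem hH₂ hθ₂)⟩⟩
  have he := (h0 ▸ hmem : LpForms.cross θ₁ θ₂ ∈ LpForms.lpClass _ p 0).2
  rw [sub_zero] at he
  exact hrob.not_isExactLp hg hcut hvol hp he
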